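/- Let $X$ be a complex algebraic variety, i.e. a reduced separated scheme of finite type over $\operatorname{Spec}\mathbb C$. Let $\overline K(X)$ be the abelian group generated by the isomorphism classes $[P]$ of algebraic vector bundles on $X$ (locally free sheaves of finite rank), with relations $[P]=[M]+[N]$ whenever $P\cong M\oplus N$ (no relations are imposed for non-split exact sequences). It is a commutative ring with $[M][N]=[M\otimes N]$, and it has a $\lambda$-structure, that is, operations $\lambda^i:\overline K(X)\to\overline K(X)$, $i\ge 0$, with $$\lambda^0(x)=1,\qquad \lambda^1(x)=x,\qquad \lambda^n(x+y)=\sum_{i+j=n}\lambda^i(x)\lambda^j(y),$$ determined by these identities and $\lambda^i[P]=[\Lambda^iP]$. A $\lambda$-homomorphism is a ring homomorphism that commutes with all the $\lambda^i$. For a commutative ring $A$, the set $1+tA[[t]]$ has the following $\lambda$-ring operations: its addition is the multiplication of power series, its unit element is $1+t$, and its product $\cdot$ and its operations $\Lambda^k$ are given on coefficients by the universal polynomials with integer coefficients that are characterized by $$\prod_{i}(1+a_it)\cdot\prod_{j}(1+b_jt)=\prod_{i,j}(1+a_ib_jt),\qquad \Lambda^k\prod_{i=1}^n(1+a_it)=\prod_{S\subset\{1,\dots,n\},\,|S|=k}\Bigl(1+t\prod_{j\in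 S}a_j\Bigr).$$ A $\lambda$-ring $A$ is called special if the map $\lambda_t:A\to 1+tA[[t]]$, $\lambda_t(x)=\sum_{n\ge0}\lambda^n(x)t^n$, is a $\lambda$-homomorphism, i.e. preserves sums, products, the unit element and the $\lambda$-operations. For $n\ge1$ the Adams operation is $\Psi^n(x)=N_n(\lambda^1x,\dots,\lambda^nx)$, where $N_n$ is the polynomial with integer coefficients that expresses the power sum $a_1^n+\dots+a_n^n$ through the elementary symmetric polynomials $e_1,\dots,e_n$ of $a_1,\dots,a_n$. **Theorem.** The $\lambda$-ring $\overline K(X)$ is special. Moreover, for every $n\ge1$ the Adams operation $\Psi^n:\overline K(X)\to\overline K(X)$ is a $\lambda$-homomorphism. -/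

import Mathlib

universe u
open TensorProduct CategoryTheory AlgebraicGeometry

namespace SplitK

section ExtScalars

variable {R S : Type u} [CommRing R] [CommRing S]

def IsExtScalars (σ : R →+* S) {M N : Type u} [AddCommGroup M] [Module R M]
    [AddCommGroup N] [Module S N] (f : M →ₛₗ[σ] N) : Prop :=
  ∀ (Q : Type u) [AddCommGroup Q] [Module S Q] (g : M →ₛₗ[σ] Q),
    ∃! g' : N →ₗ[S] Q, ∀ m, g' (f m) = g m

variable {σ : R →+* S} {M N M' N' : Type u} [AddCommGroup M] [Module R M]
  [AddCommGroup N] [Module S N] [AddCommGroup M'] [Module R M'] [AddCommGroup N'] [Module S N']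

theorem IsExtScalars.hom_ext {f : M →ₛₗ[σ] N} (hf : IsExtScalars σ f) {Q : Type u}
    [AddCommGroup Q] [Module S Q] {g h : N →ₗ[S] Q} (H : ∀ m, g (f m) = h (f m)) : g = h :=
  (hf Q (h.comp f)).unique (fun m => H m) (fun _ => rfl)

/-- `M → S ⊗[R] M` is an extension of scalars. -/
theorem isExtScalars_mk (R S M : Type u) [CommRing R] [CommRing S] [Algebra R S]
    [AddCommGroup M] [Module R M] :
    ∃ f : M →ₛₗ[algebraMap R S] (S ⊗[R] M), (∀ m, f m = 1 ⊗ₜ m) ∧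
      IsExtScalars (algebraMap R S) f := by
  refine ⟨{ toFun := fun m => 1 ⊗ₜ m, map_add' := fun a b => TensorProduct.tmul_add _ _ _,
            map_smul' := fun r m => ?_ }, fun _ => rfl, ?_⟩
  · rw [TensorProduct.tmul_smul, algebraMap_smul]
  · intro Q _ _ g
    let _ : Module R Q := Module.compHom Q (algebraMap R S)
    have : IsScalarTower R S Q := ⟨fun r s q => by
      rw [Algebra.smul_def, mul_smul]; rfl⟩
    let g0 : M →ₗ[R] Q := { toFun := g, map_add' := g.map_add, map_smul' := fun r m => g.map_smulₛₗ r m }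
    refine ⟨LinearMap.liftBaseChange S g0, fun m => by simp [g0], fun h hh => ?_⟩
    ext m
    simpa [g0] using hh m

theorem IsExtScalars.exists_equiv [Algebra R S] {f : M →ₛₗ[algebraMap R S] N}
    (hf : IsExtScalars (algebraMap R S) f) :
    ∃ e : (S ⊗[R] M) ≃ₗ[S] N, ∀ m, e (1 ⊗ₜ m) = f m := by
  obtain ⟨j, hj, hj'⟩ := isExtScalars_mk R S M
  obtain ⟨a, ha, -⟩ := hf _ j
  obtain ⟨b, hb, -⟩ := hj' _ f
  refine ⟨LinearEquiv.ofLinearMap b a ?_ ?_, fun m => ?_⟩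
  · exact hf.hom_ext fun m => by simp [ha, hb]
  · exact hj'.hom_ext fun m => by simp [ha, hb]
  · simp [← hj, hb]

theorem IsExtScalars.free_finite {f : M →ₛₗ[σ] N} (hf : IsExtScalars σ f)
    (h : Module.Free R M ∧ Module.Finite R M) : Module.Free S N ∧ Module.Finite S N := by
  let _ := σ.toAlgebra
  obtain ⟨e, -⟩ := IsExtScalars.exists_equiv (f := f) hf
  obtain ⟨_, _⟩ := h
  exact ⟨Module.Free.of_equiv e, Module.Finite.equiv e⟩

theorem isExtScalars_self (σ : R →+* S) :
    IsExtScalars σ (σ.toSemilinearMap) := by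
  intro Q _ _ g
  refine ⟨LinearMap.toSpanSingleton S Q (g 1), fun r => ?_, fun h hh => ?_⟩
  · have := g.map_smulₛₗ r 1
    simpa using this.symm
  · ext
    simpa using hh 1

/-- The product of two semilinear maps. -/
def semiProd (f : M →ₛₗ[σ] N) (f' : M' →ₛₗ[σ] N') : M × M' →ₛₗ[σ] N × N' where
  toFun x := (f x.1, f' x.2)
  map_add' x y := by simp
  map_smul' r x := by simp

/-- The product of a family of semilinear maps. -/
def semiPi {ι : Type} {P P' : ι → Type u}
    [∀ i, AddCommGroup (P i)] [∀ i, Module R (P i)]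
    [∀ i, AddCommGroup (P' i)] [∀ i, Module S (P' i)] (f : ∀ i, P i →ₛₗ[σ] P' i) :
    (∀ i, P i) →ₛₗ[σ] (∀ i, P' i) where
  toFun x := fun i => f i (x i)
  map_add' x y := by ext; simp
  map_smul' r x := by ext; simp

section Semi

variable {P P' : Type u} [AddCommGroup P] [Module R P] [AddCommGroup P'] [Module S P']
  (f : M →ₛₗ[σ] N) (g : M' →ₛₗ[σ] N') (k : P →ₛₗ[σ] P')

theorem assoc_map (x : (M ⊗[R] M') ⊗[R] P) :
    TensorProduct.assoc S N N' P' (TensorProduct.map (TensorProduct.map f g) k x) =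
      TensorProduct.map f (TensorProduct.map g k) (TensorProduct.assoc R M M' P x) := by
  induction x with
  | zero => simp
  | add a b ha hb => simp only [map_add, ha, hb]
  | tmul a b =>
    induction a with
    | zero => simp
    | add a b ha hb => simp only [map_add, TensorProduct.add_tmul, ha, hb]
    | tmul a c => rfl

theorem lid_map (x : R ⊗[R] M) :
    TensorProduct.lid S N (TensorProduct.map σ.toSemilinearMap f x) =
      f (TensorProduct.lid R M x) := by
  induction x with
  | zero => simp
  | add a b ha hb => simp only [map_add, ha, hb]
  | tmul a b => simp [map_smulₛₗ]

theorem prodLeft_map (x : (M × M') ⊗[R] P) :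
    TensorProduct.prodLeft S S N N' P' (TensorProduct.map (semiProd f g) k x) =
      semiProd (TensorProduct.map f k) (TensorProduct.map g k)
        (TensorProduct.prodLeft R R M M' P x) := by
  induction x with
  | zero => simp
  | add a b ha hb => simp only [map_add, ha, hb]
  | tmul a b => obtain ⟨a, a'⟩ := a; simp [semiProd]

theorem subsingleton_punit_tensor (R M : Type u) [CommRing R] [AddCommGroup M] [Module R M] :
    Subsingleton (PUnit.{u + 1} ⊗[R] M) := by
  refine subsingleton_of_forall_eq 0 fun x => ?_
  induction x with
  | zero => rfl
  | add a b ha hb => rw [ha, hb, add_zero]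
  | tmul a b => exact TensorProduct.zero_tmul _ _

end Semi

theorem isExtScalars_pi {ι : Type} [Fintype ι] {P P' : ι → Type u}
    [∀ i, AddCommGroup (P i)] [∀ i, Module R (P i)]
    [∀ i, AddCommGroup (P' i)] [∀ i, Module S (P' i)] (f : ∀ i, P i →ₛₗ[σ] P' i)
    (hf : ∀ i, IsExtScalars σ (f i)) :
    IsExtScalars σ (semiPi f) := by
  classical
  intro Q _ _ g
  choose a ha ha' using fun i => hf i Q (g.comp (LinearMap.single R P i))
  have key : ∀ i m, semiPi f (Pi.single i m)
      = Pi.single i (f i m) := by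
    intro i m
    ext j
    by_cases h : j = i
    · subst h; simp [semiPi]
    · simp [semiPi, h]
  refine ⟨LinearMap.lsum S P' S a, fun m => ?_, fun h hh => ?_⟩
  · have : m = ∑ i, Pi.single i (m i) := (Finset.univ_sum_single m).symm
    have h2 : g m = ∑ i, g (Pi.single i (m i)) := by conv_lhs => rw [this, map_sum]
    rw [h2]
    simp only [LinearMap.lsum_apply, LinearMap.sum_apply, LinearMap.comp_apply]
    refine Finset.sum_congr rfl fun i _ => ?_
    simpa [semiPi] using ha i (m i)
  · refine LinearMap.pi_ext' fun i => ?_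
    refine (hf i).hom_ext fun m => ?_
    have h1 := hh (Pi.single i m)
    rw [key] at h1
    have h2 := ha i m
    simp only [LinearMap.comp_apply, LinearMap.coe_single] at h2 ⊢
    rw [h1, ← h2]
    simp only [LinearMap.lsum_apply, LinearMap.sum_apply, LinearMap.comp_apply]
    rw [Finset.sum_eq_single i]
    · simp
    · intro j _ hj; simp [hj]
    · simp

theorem isExtScalars_prod {f : M →ₛₗ[σ] N} {f' : M' →ₛₗ[σ] N'} (hf : IsExtScalars σ f)
    (hf' : IsExtScalars σ f') :
    IsExtScalars σ (semiProd f f') := by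
  intro Q _ _ g
  obtain ⟨a, ha, -⟩ := hf Q (g.comp (LinearMap.inl R M M'))
  obtain ⟨b, hb, -⟩ := hf' Q (g.comp (LinearMap.inr R M M'))
  refine ⟨a.coprod b, fun m => ?_, fun h hh => ?_⟩
  · simp [semiProd, ha, hb, ← map_add]
  · refine LinearMap.prod_ext (hf.hom_ext fun m => ?_) (hf'.hom_ext fun m => ?_)
    · have := hh (m, 0)
      simp [semiProd] at this
      simp [ha, this]
    · have := hh (0, m)
      simp [semiProd] at this
      simp [hb, this]

theorem isExtScalars_tensor {f : M →ₛₗ[σ] N} {f' : M' →ₛₗ[σ] N'} (hf : IsExtScalars σ f)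
    (hf' : IsExtScalars σ f') : IsExtScalars σ (TensorProduct.map f f') := by
  intro Q _ _ g
  choose a ha ha' using fun m' => hf Q
    ({ toFun := fun m => g (m ⊗ₜ m')
       map_add' := fun x y => by rw [TensorProduct.add_tmul, map_add]
       map_smul' := fun r x => by rw [← TensorProduct.smul_tmul', map_smulₛₗ] } : M →ₛₗ[σ] Q)
  let c : M' →ₛₗ[σ] (N →ₗ[S] Q) :=
    { toFun := a
      map_add' := fun x y => hf.hom_ext fun m => by
        simp only [LinearMap.add_apply, ha]; simp [TensorProduct.tmul_add]
      map_smul' := fun r x => hf.hom_ext fun m => by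
        simp only [LinearMap.smul_apply, ha]; simp [TensorProduct.tmul_smul] }
  obtain ⟨b, hb, -⟩ := hf' _ c
  have hb' : ∀ m m', b (f' m') (f m) = g (m ⊗ₜ m') := fun m m' => by
    rw [hb]; exact ha m' m
  refine ⟨TensorProduct.lift b.flip, fun x => ?_, fun h hh => ?_⟩
  · induction x with
    | zero => simp
    | add x y hx hy => rw [map_add, map_add, map_add, hx, hy]
    | tmul m m' => simp [hb']
  · refine TensorProduct.ext ?_
    refine hf.hom_ext fun m => hf'.hom_ext fun m' => ?_
    have := hh (m ⊗ₜ m')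
    simpa [hb'] using this

/-- The semilinear map on exterior powers induced by a semilinear map. -/
theorem exists_extMap (n : ℕ) (f : M →ₛₗ[σ] N) :
    ∃ F : (⋀[R]^n M) →ₛₗ[σ] (⋀[S]^n N),
      ∀ v : Fin n → M, F (exteriorPower.ιMulti R n v) = exteriorPower.ιMulti S n (fun i => f (v i)) := by
  let _ : Module R (⋀[S]^n N) := Module.compHom _ σ
  let a : M [⋀^Fin n]→ₗ[R] (⋀[S]^n N) :=
    { toFun := fun v => exteriorPower.ιMulti S n (fun i => f (v i))
      map_update_add' := fun {_} v i x y => by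
        have h : ∀ z, (fun j => f (Function.update v i z j)) =
            Function.update (fun j => f (v j)) i (f z) := fun z => by
          ext j; by_cases hj : j = i
          · subst hj; simp
          · simp [hj]
        cases Subsingleton.elim ‹DecidableEq (Fin n)› (instDecidableEqFin n)
        simp only [h, map_add]
        exact (exteriorPower.ιMulti S n).map_update_add _ _ _ _
      map_update_smul' := fun {_} v i r x => by
        have h : ∀ z, (fun j => f (Function.update v i z j)) =
            Function.update (fun j => f (v j)) i (f z) := fun z => by
          ext j; by_cases hj : j = i
          · subst hj; simp
          · simp [hj]
        cases Subsingleton.elim ‹DecidableEq (Fin n)› (instDecidableEqFin n)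
        simp only [h, map_smulₛₗ]
        exact (exteriorPower.ιMulti S n).map_update_smul _ _ _ _
      map_eq_zero_of_eq' := fun v i j hij hne =>
        (exteriorPower.ιMulti S n).map_eq_zero_of_eq _ (by simp [hij]) hne }
  let F := exteriorPower.alternatingMapLinearEquiv a
  exact ⟨{ toFun := F, map_add' := F.map_add, map_smul' := fun r x => F.map_smul r x },
    fun v => exteriorPower.alternatingMapLinearEquiv_apply_ιMulti a v⟩

/-- The semilinear map `⋀ⁿ f` on exterior powers,
`m₁ ∧ ⋯ ∧ mₙ ↦ f m₁ ∧ ⋯ ∧ f mₙ`, induced by a semilinear map `f`. -/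
noncomputable def extMap (n : ℕ) (f : M →ₛₗ[σ] N) : (⋀[R]^n M) →ₛₗ[σ] (⋀[S]^n N) :=
  (exists_extMap n f).choose

theorem extMap_ιMulti (n : ℕ) (f : M →ₛₗ[σ] N) (v : Fin n → M) :
    extMap n f (exteriorPower.ιMulti R n v) = exteriorPower.ιMulti S n (fun i => f (v i)) :=
  (exists_extMap n f).choose_spec v

theorem extPow_induction {n : ℕ} {p : (⋀[R]^n M) → Prop} (x : ⋀[R]^n M)
    (hι : ∀ v, p (exteriorPower.ιMulti R n v)) (hz : p 0) (ha : ∀ x y, p x → p y → p (x + y))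
    (hs : ∀ (r : R) x, p x → p (r • x)) : p x := by
  have hx : x ∈ Submodule.span R (Set.range (exteriorPower.ιMulti R n (M := M))) := by
    rw [exteriorPower.ιMulti_span]; trivial
  induction hx using Submodule.span_induction with
  | mem x h => obtain ⟨v, rfl⟩ := h; exact hι v
  | zero => exact hz
  | add x y _ _ hx hy => exact ha x y hx hy
  | smul r x _ hx => exact hs r x hx

theorem IsExtScalars.span_range {f : M →ₛₗ[σ] N} (hf : IsExtScalars σ f) :
    Submodule.span S (Set.range f) = ⊤ := by
  have : (Submodule.span S (Set.range f)).mkQ = 0 := hf.hom_ext fun m => by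
    simpa using Submodule.subset_span (R := S) (Set.mem_range_self (f := f) m)
  rw [← Submodule.ker_mkQ (Submodule.span S (Set.range f)), this, LinearMap.ker_zero]

/-- The algebra map `⋀ (S ⊗ M) → S ⊗ ⋀ M`. -/
theorem exists_extBaseChange (R S M : Type u) [CommRing R] [CommRing S] [Algebra R S]
    [AddCommGroup M] [Module R M] (n : ℕ) :
    ∃ F : (⋀[S]^n (S ⊗[R] M)) →ₗ[S] (S ⊗[R] (⋀[R]^n M)),
      ∀ v : Fin n → M, F (exteriorPower.ιMulti S n (fun i => 1 ⊗ₜ v i)) =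
        1 ⊗ₜ exteriorPower.ιMulti R n v := by
  let l : (S ⊗[R] M) →ₗ[S] (S ⊗[R] ExteriorAlgebra R M) :=
    LinearMap.baseChange S (ExteriorAlgebra.ι R)
  have anti : ∀ x y, l x * l y + l y * l x = 0 := by
    intro x y
    induction x with
    | zero => simp
    | add a b ha hb =>
      rw [map_add, add_mul, mul_add]
      rw [add_add_add_comm, ha, hb, add_zero]
    | tmul s m =>
      induction y with
      | zero => simp
      | add a b ha hb =>
        rw [map_add, add_mul, mul_add]
        rw [add_add_add_comm, ha, hb, add_zero]
      | tmul t m' =>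
        simp only [l, LinearMap.baseChange_tmul, Algebra.TensorProduct.tmul_mul_tmul]
        rw [mul_comm t s, ← TensorProduct.tmul_add, ExteriorAlgebra.ι_add_mul_swap,
          TensorProduct.tmul_zero]
  have sq : ∀ x, l x * l x = 0 := by
    intro x
    induction x with
    | zero => simp
    | add a b ha hb =>
      rw [map_add, add_mul, mul_add, mul_add, ha, hb, zero_add, add_zero, anti]
    | tmul s m =>
      simp only [l, LinearMap.baseChange_tmul, Algebra.TensorProduct.tmul_mul_tmul,
        ExteriorAlgebra.ι_sq_zero, TensorProduct.tmul_zero]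
  let L := ExteriorAlgebra.lift S ⟨l, sq⟩
  let pr : ExteriorAlgebra R M →ₗ[R] (⋀[R]^n M) :=
    ExteriorAlgebra.liftAlternating (Function.update 0 n (exteriorPower.ιMulti R n))
  refine ⟨(LinearMap.baseChange S pr) ∘ₗ L.toLinearMap ∘ₗ (⋀[S]^n (S ⊗[R] M)).subtype, fun v => ?_⟩
  have h1 : L (ExteriorAlgebra.ιMulti S n (fun i => (1 : S) ⊗ₜ[R] v i)) =
      1 ⊗ₜ ExteriorAlgebra.ιMulti R n v := by
    rw [ExteriorAlgebra.ιMulti_apply, map_list_prod, List.map_ofFn, ExteriorAlgebra.ιMulti_apply]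
    have h2 : (1 : S) ⊗ₜ[R] (List.ofFn fun i => (ExteriorAlgebra.ι R) (v i)).prod =
      (Algebra.TensorProduct.includeRight : ExteriorAlgebra R M →ₐ[R] S ⊗[R] ExteriorAlgebra R M)
        (List.ofFn fun i => (ExteriorAlgebra.ι R) (v i)).prod := rfl
    rw [h2, map_list_prod, List.map_ofFn]
    congr 2
    ext i
    simp [L, l]
  simp [h1, pr]

theorem isExtScalars_extMap (n : ℕ) {f : M →ₛₗ[σ] N} (hf : IsExtScalars σ f) :
    IsExtScalars σ (extMap n f) := by
  let _ := σ.toAlgebra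
  have hσ : σ = algebraMap R S := rfl
  obtain ⟨e, he⟩ := IsExtScalars.exists_equiv (f := f) hf
  obtain ⟨F, hF⟩ := exists_extBaseChange R S M n
  obtain ⟨j, hj, hj'⟩ := isExtScalars_mk R S (⋀[R]^n M)
  intro Q _ _ g
  obtain ⟨g1, hg1, -⟩ := hj' Q g
  have key : ∀ x, (g1 ∘ₗ F ∘ₗ exteriorPower.map n e.symm.toLinearMap) (extMap n f x) = g x := by
    intro x
    induction x using extPow_induction with
    | hι v =>
      have : ∀ i, e.symm (f (v i)) = 1 ⊗ₜ v i := fun i => by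
        rw [LinearEquiv.symm_apply_eq, he]
      rw [extMap_ιMulti]
      simp only [LinearMap.comp_apply, exteriorPower.map_apply_ιMulti]
      have h3 : (⇑e.symm.toLinearMap ∘ fun i => f (v i)) = fun i => (1 : S) ⊗ₜ[R] v i := by
        ext i; exact this i
      rw [h3, hF, ← hj, hg1]
    | hz => simp
    | ha x y hx hy => simp only [map_add, hx, hy]
    | hs r x hx => rw [map_smulₛₗ, g.map_smulₛₗ, map_smul, hx]
  refine ⟨g1 ∘ₗ F ∘ₗ exteriorPower.map n e.symm.toLinearMap, key, fun h hh => ?_⟩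
  · refine LinearMap.ext_on (exteriorPower.ιMulti_span_of_span S n N hf.span_range) ?_
    rintro _ ⟨v, hv, rfl⟩
    choose w hw using fun i => hv (Set.mem_range_self i)
    obtain rfl : (fun i => f (w i)) = v := funext hw
    rw [← extMap_ιMulti, hh]
    exact (key _).symm

end ExtScalars

section ExtSum

variable {R : Type u} [CommRing R] {M N M' N' : Type u} [AddCommGroup M] [Module R M]
  [AddCommGroup N] [Module R N]

/-- The projection of the exterior algebra to its degree `n` part. -/
noncomputable def extProj (R M : Type u) [CommRing R] [AddCommGroup M] [Module R M] (n : ℕ) :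
    ExteriorAlgebra R M →ₗ[R] (⋀[R]^n M) :=
  ExteriorAlgebra.liftAlternating (Function.update 0 n (exteriorPower.ιMulti R n))

theorem extProj_self (n : ℕ) (x : ⋀[R]^n M) : extProj R M n x = x := by
  induction x using extPow_induction with
  | hι v => simp [extProj]
  | hz => simp
  | ha x y hx hy => simp only [Submodule.coe_add, map_add, hx, hy]
  | hs r x hx => simp only [Submodule.coe_smul, map_smul, hx]

theorem extProj_ne {n i : ℕ} (h : i ≠ n) (x : ⋀[R]^i M) : extProj R M n x = 0 := by
  induction x using extPow_induction with
  | hι v => simp [extProj, h]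
  | hz => simp
  | ha x y hx hy => simp only [Submodule.coe_add, map_add, hx, hy, add_zero]
  | hs r x hx => simp only [Submodule.coe_smul, map_smul, hx, smul_zero]

theorem extAlg_induction {p : ExteriorAlgebra R M → Prop} (x : ExteriorAlgebra R M)
    (hι : ∀ i (a : ⋀[R]^i M), p a) (hz : p 0) (ha : ∀ x y, p x → p y → p (x + y))
    (hs : ∀ (r : R) x, p x → p (r • x)) : p x := by
  have hx := Submodule.mem_top (R := R) (x := x)
  rw [← ExteriorAlgebra.ιMulti_span] at hx
  induction hx using Submodule.span_induction with
  | mem x h => obtain ⟨v, rfl⟩ := h; exact hι v.1 (exteriorPower.ιMulti R v.1 v.2)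
  | zero => exact hz
  | add x y _ _ hx hy => exact ha x y hx hy
  | smul r x _ hx => exact hs r x hx

/-- The isomorphism `⋀ⁿ e` induced by an isomorphism `e`. -/
noncomputable def extEquiv (n : ℕ) (e : M ≃ₗ[R] N) : (⋀[R]^n M) ≃ₗ[R] (⋀[R]^n N) :=
  LinearEquiv.ofLinearMap (exteriorPower.map n e.toLinearMap)
    (exteriorPower.map n e.symm.toLinearMap)
    (by rw [← exteriorPower.map_comp]; simp) (by rw [← exteriorPower.map_comp]; simp)

theorem map_mem_extPow {P : Type u} [AddCommGroup P] [Module R P] (f : M →ₗ[R] P) (i : ℕ)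
    (x : ⋀[R]^i M) : ExteriorAlgebra.map f x ∈ ⋀[R]^i P := by
  induction x using extPow_induction with
  | hι v =>
    rw [exteriorPower.ιMulti_apply_coe, ExteriorAlgebra.map_apply_ιMulti]
    exact ExteriorAlgebra.ιMulti_range R i ⟨_, rfl⟩
  | hz => simp
  | ha x y hx hy => simpa using add_mem hx hy
  | hs r x hx => simpa using Submodule.smul_mem _ r hx

theorem mul_mem_extPow {i j n : ℕ} (h : i + j = n) (x : ⋀[R]^i M) (y : ⋀[R]^j N) :
    ExteriorAlgebra.map (LinearMap.inl R M N) x * ExteriorAlgebra.map (LinearMap.inr R M N) y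
      ∈ ⋀[R]^n (M × N) := by
  subst h
  exact SetLike.GradedMul.mul_mem (A := fun i : ℕ => ⋀[R]^i (M × N))
    (map_mem_extPow _ _ x) (map_mem_extPow _ _ y)

/-- `⋀ⁱ M ⊗ ⋀ʲ N → ⋀ⁿ (M × N)` for `i + j = n`. -/
noncomputable def extMulMap {i j n : ℕ} (h : i + j = n) :
    (⋀[R]^i M) ⊗[R] (⋀[R]^j N) →ₗ[R] (⋀[R]^n (M × N)) :=
  TensorProduct.lift (LinearMap.mk₂ R (fun x y => ⟨_, mul_mem_extPow h x y⟩)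
    (fun x y z => by ext; simp [add_mul]) (fun r x y => by ext; simp)
    (fun x y z => by ext; simp [mul_add]) (fun r x y => by ext; simp))

theorem extMulMap_tmul {i j n : ℕ} (h : i + j = n) (x : ⋀[R]^i M) (y : ⋀[R]^j N) :
    ((extMulMap h (x ⊗ₜ[R] y) : ⋀[R]^n (M × N)) : ExteriorAlgebra R (M × N)) =
    ExteriorAlgebra.map (LinearMap.inl R M N) x * ExteriorAlgebra.map (LinearMap.inr R M N) y :=
  rfl

/-- The canonical map `⨁_{i+j=n} ⋀ⁱ M ⊗ ⋀ʲ N → ⋀ⁿ (M × N)`. -/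
noncomputable def extSumMap (R M N : Type u) [CommRing R] [AddCommGroup M] [Module R M]
    [AddCommGroup N] [Module R N] (n : ℕ) :
    (∀ p : {p : ℕ × ℕ // p ∈ Finset.HasAntidiagonal.antidiagonal n}, (⋀[R]^p.1.1 M) ⊗[R] (⋀[R]^p.1.2 N)) →ₗ[R]
      (⋀[R]^n (M × N)) :=
  ∑ p, extMulMap (Finset.HasAntidiagonal.mem_antidiagonal.1 p.2) ∘ₗ LinearMap.proj p

/-- `⋀ M ⊗ ⋀ N ≃ ⋀ (M × N)`. -/
theorem exists_extProdEquiv (R M N : Type u) [CommRing R] [AddCommGroup M] [Module R M]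
    [AddCommGroup N] [Module R N] :
    ∃ T : (ExteriorAlgebra R M ⊗[R] ExteriorAlgebra R N) ≃ₗ[R] ExteriorAlgebra R (M × N),
      ∀ x y, T (x ⊗ₜ y) = ExteriorAlgebra.map (LinearMap.inl R M N) x *
        ExteriorAlgebra.map (LinearMap.inr R M N) y := by
  let I : ((0 : QuadraticForm R M).prod (0 : QuadraticForm R N)).IsometryEquiv
      (0 : QuadraticForm R (M × N)) := ⟨LinearEquiv.refl R _, fun x => by simp⟩
  let e1 := CliffordAlgebra.equivOfIsometry I
  let e2 := CliffordAlgebra.prodEquiv (0 : QuadraticForm R M) (0 : QuadraticForm R N)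
  refine ⟨(GradedTensorProduct.of R (CliffordAlgebra.evenOdd (0 : QuadraticForm R M))
      (CliffordAlgebra.evenOdd (0 : QuadraticForm R N))).trans
      (e2.symm.toLinearEquiv.trans e1.toLinearEquiv), fun x y => ?_⟩
  have h1 : e2.symm (GradedTensorProduct.of R (CliffordAlgebra.evenOdd (0 : QuadraticForm R M))
      (CliffordAlgebra.evenOdd (0 : QuadraticForm R N)) (x ⊗ₜ y)) =
      CliffordAlgebra.map (QuadraticMap.Isometry.inl (0 : QuadraticForm R M) (0 : QuadraticForm R N)) x *
      CliffordAlgebra.map (QuadraticMap.Isometry.inr (0 : QuadraticForm R M) (0 : QuadraticForm R N)) y := by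
    exact GradedTensorProduct.lift_tmul (CliffordAlgebra.evenOdd (0 : QuadraticForm R M))
      (CliffordAlgebra.evenOdd (0 : QuadraticForm R N)) _ _
      (fun _ _ x₁ x₂ => CliffordAlgebra.map_mul_map_of_isOrtho_of_mem_evenOdd _ _
        QuadraticMap.IsOrtho.inl_inr _ _ x₁.prop x₂.prop) x y
  have h2 : ∀ x : ExteriorAlgebra R M, e1 (CliffordAlgebra.map (QuadraticMap.Isometry.inl (0 : QuadraticForm R M) (0 : QuadraticForm R N)) x) =
      ExteriorAlgebra.map (LinearMap.inl R M N) x := by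
    intro x
    have : (e1 : _ →ₐ[R] _).comp (CliffordAlgebra.map (QuadraticMap.Isometry.inl (0 : QuadraticForm R M) (0 : QuadraticForm R N))) =
        ExteriorAlgebra.map (LinearMap.inl R M N) := by
      apply ExteriorAlgebra.hom_ext
      ext m
      simp [e1, I, ExteriorAlgebra.ι]
      rfl
    exact DFunLike.congr_fun this x
  have h3 : ∀ x : ExteriorAlgebra R N, e1 (CliffordAlgebra.map (QuadraticMap.Isometry.inr (0 : QuadraticForm R M) (0 : QuadraticForm R N)) x) =
      ExteriorAlgebra.map (LinearMap.inr R M N) x := by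
    intro x
    have : (e1 : _ →ₐ[R] _).comp (CliffordAlgebra.map (QuadraticMap.Isometry.inr (0 : QuadraticForm R M) (0 : QuadraticForm R N))) =
        ExteriorAlgebra.map (LinearMap.inr R M N) := by
      apply ExteriorAlgebra.hom_ext
      ext m
      simp [e1, I, ExteriorAlgebra.ι]
      rfl
    exact DFunLike.congr_fun this x
  exact (congrArg e1 h1).trans (by rw [map_mul, h2, h3])

theorem extSumMap_bijective (n : ℕ) : Function.Bijective (extSumMap R M N n) := by
  classical
  obtain ⟨T, hT⟩ := exists_extProdEquiv R M N
  let J : (∀ p : {p : ℕ × ℕ // p ∈ Finset.HasAntidiagonal.antidiagonal n},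
      (⋀[R]^p.1.1 M) ⊗[R] (⋀[R]^p.1.2 N)) →ₗ[R] ExteriorAlgebra R M ⊗[R] ExteriorAlgebra R N :=
    ∑ p, TensorProduct.map (Submodule.subtype _) (Submodule.subtype _) ∘ₗ LinearMap.proj p
  let K : ExteriorAlgebra R M ⊗[R] ExteriorAlgebra R N →ₗ[R]
      (∀ p : {p : ℕ × ℕ // p ∈ Finset.HasAntidiagonal.antidiagonal n}, (⋀[R]^p.1.1 M) ⊗[R] (⋀[R]^p.1.2 N)) :=
    LinearMap.pi fun p => TensorProduct.map (extProj R M _) (extProj R N _)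
  have hKJ : K ∘ₗ J = LinearMap.id := by
    refine LinearMap.pi_ext' fun p => TensorProduct.ext' fun x y => ?_
    ext q
    simp only [K, J, LinearMap.comp_apply, LinearMap.sum_apply, LinearMap.proj_apply,
      LinearMap.coe_single, LinearMap.pi_apply, LinearMap.id_apply]
    rw [Finset.sum_eq_single p]
    · by_cases hq : q = p
      · subst hq
        simp [extProj_self]
      · rw [Pi.single_eq_of_ne hq]
        simp only [Pi.single_eq_same, TensorProduct.map_tmul, Submodule.subtype_apply]
        by_cases h1 : p.1.1 = q.1.1
        · have h2 : p.1.2 ≠ q.1.2 := fun h2 => hq (Subtype.ext (Prod.ext h1.symm h2.symm))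
          rw [extProj_ne h2, TensorProduct.tmul_zero]
        · rw [extProj_ne h1, TensorProduct.zero_tmul]
    · intro r _ hr
      rw [Pi.single_eq_of_ne hr, map_zero]
    · simp
  have hTJ : ∀ z, T (J z) = (extSumMap R M N n z : ExteriorAlgebra R (M × N)) := by
    intro z
    have : T.toLinearMap ∘ₗ J = (Submodule.subtype _) ∘ₗ extSumMap R M N n := by
      refine LinearMap.pi_ext' fun p => TensorProduct.ext' fun x y => ?_
      simp only [J, extSumMap, LinearMap.comp_apply, LinearMap.sum_apply, LinearMap.proj_apply,
        LinearMap.coe_single]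
      rw [Finset.sum_eq_single p, Finset.sum_eq_single p]
      · simp [hT, extMulMap_tmul]
      · intro r _ hr
        rw [Pi.single_eq_of_ne hr, map_zero]
      · simp
      · intro r _ hr
        rw [Pi.single_eq_of_ne hr, map_zero]
      · simp
    exact DFunLike.congr_fun this z
  have hP : extProj R (M × N) n ∘ₗ T.toLinearMap = extSumMap R M N n ∘ₗ K := by
    refine TensorProduct.ext' fun x y => ?_
    induction x using extAlg_induction with
    | hz => simp
    | ha a b ha hb => rw [TensorProduct.add_tmul, map_add, map_add, ha, hb]
    | hs r a ha => rw [← TensorProduct.smul_tmul', map_smul, map_smul, ha]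
    | hι i a =>
    induction y using extAlg_induction with
    | hz => simp
    | ha a b ha hb => rw [TensorProduct.tmul_add, map_add, map_add, ha, hb]
    | hs r a ha => rw [TensorProduct.tmul_smul, map_smul, map_smul, ha]
    | hι j b =>
    simp only [LinearMap.comp_apply, LinearEquiv.coe_coe, hT, extSumMap, K, LinearMap.sum_apply,
      LinearMap.proj_apply, LinearMap.pi_apply, TensorProduct.map_tmul]
    by_cases hn : i + j = n
    · rw [Finset.sum_eq_single ⟨(i, j), Finset.HasAntidiagonal.mem_antidiagonal.2 hn⟩]
      · rw [extProj_self, extProj_self]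
        exact extProj_self n ⟨_, mul_mem_extPow hn a b⟩
      · intro q _ hq
        by_cases h1 : i = q.1.1
        · have h2 : j ≠ q.1.2 := fun h2 => hq (Subtype.ext (Prod.ext h1.symm h2.symm))
          rw [extProj_ne h2, TensorProduct.tmul_zero, map_zero]
        · rw [extProj_ne h1, TensorProduct.zero_tmul, map_zero]
      · simp
    · have := extProj_ne hn ⟨_, mul_mem_extPow rfl a b⟩
      rw [this, Finset.sum_eq_zero]
      intro q _
      by_cases h1 : i = q.1.1
      · have h2 : j ≠ q.1.2 := fun h2 => hn (by
          rw [h1, h2]; exact Finset.HasAntidiagonal.mem_antidiagonal.1 q.2)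
        rw [extProj_ne h2, TensorProduct.tmul_zero, map_zero]
      · rw [extProj_ne h1, TensorProduct.zero_tmul, map_zero]
  constructor
  · intro a b h
    have h' : J a = J b := T.injective (by rw [hTJ, hTJ, h])
    simpa using (DFunLike.congr_fun hKJ a).symm.trans ((congrArg K h').trans (DFunLike.congr_fun hKJ b))
  · intro y
    obtain ⟨z, hz⟩ := T.surjective y
    refine ⟨K z, ?_⟩
    rw [← extProj_self n y, ← hz]
    exact (DFunLike.congr_fun hP z).symm

theorem extMulMap_ιMulti {i j n : ℕ} (h : i + j = n) (v : Fin i → M) (w : Fin j → N) :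
    extMulMap h (exteriorPower.ιMulti R i v ⊗ₜ[R] exteriorPower.ιMulti R j w) =
      exteriorPower.ιMulti R n
        (Fin.append (LinearMap.inl R M N ∘ v) (LinearMap.inr R M N ∘ w) ∘ Fin.cast h.symm) := by
  subst h
  ext
  rw [extMulMap_tmul]
  simp only [exteriorPower.ιMulti_apply_coe, ExteriorAlgebra.map_apply_ιMulti,
    ExteriorAlgebra.ιMulti_mul_ιMulti]
  rfl

variable {S : Type u} [CommRing S] {σ : R →+* S} [AddCommGroup M'] [Module S M']
  [AddCommGroup N'] [Module S N']

theorem extMap_extMulMap {i j n : ℕ} (h : i + j = n) (f : M →ₛₗ[σ] M') (f' : N →ₛₗ[σ] N')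
    (z : (⋀[R]^i M) ⊗[R] (⋀[R]^j N)) :
    extMap n (semiProd f f') (extMulMap h z) =
      extMulMap h (TensorProduct.map (extMap i f) (extMap j f') z) := by
  induction z with
  | zero => simp
  | add a b ha hb => simp only [map_add, ha, hb]
  | tmul x y =>
  induction x using extPow_induction with
  | hz => simp
  | ha a b ha hb => simp only [TensorProduct.add_tmul, map_add, ha, hb]
  | hs r a ha => rw [← TensorProduct.smul_tmul', map_smul, map_smulₛₗ, ha, map_smulₛₗ, map_smul]
  | hι v =>
  induction y using extPow_induction with
  | hz => simp
  | ha a b ha hb => simp only [TensorProduct.tmul_add, map_add, ha, hb]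
  | hs r a ha => rw [TensorProduct.tmul_smul, map_smul, map_smulₛₗ, ha, map_smulₛₗ, map_smul]
  | hι w =>
  rw [TensorProduct.map_tmul, extMap_ιMulti, extMap_ιMulti, extMulMap_ιMulti, extMulMap_ιMulti,
    extMap_ιMulti]
  congr 1
  subst h
  ext k
  · refine Fin.addCases (fun k => ?_) (fun k => ?_) k <;> simp [semiProd]
  · refine Fin.addCases (fun k => ?_) (fun k => ?_) k <;> simp [semiProd]

theorem extMap_extSumMap (n : ℕ) (f : M →ₛₗ[σ] M') (f' : N →ₛₗ[σ] N') (z) :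
    extMap n (semiProd f f') (extSumMap R M N n z) =
      extSumMap S M' N' n
        (semiPi (fun p => TensorProduct.map (extMap p.1.1 f) (extMap p.1.2 f')) z) := by
  simp only [extSumMap, LinearMap.sum_apply, map_sum, LinearMap.comp_apply, LinearMap.proj_apply,
    extMap_extMulMap]
  rfl

end ExtSum

section Bundles

/-- The ring of functions on an affine open `U` of `X`. -/
abbrev Fun (X : Scheme.{u}) (U : X.affineOpens) : Type u := Γ(X, U.1)

/-- Restriction of functions from the affine open `U` to a smaller affine open `V`. -/
abbrev resFun (X : Scheme.{u}) {U V : X.affineOpens} (h : V ≤ U) : Fun X U →+* Fun X V :=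
  (X.presheaf.map (homOfLE h : V.1 ⟶ U.1).op).hom

/-- An (algebraic) vector bundle on a scheme `X`, i.e. a locally free quasi-coherent sheaf of
`𝒪_X`-modules of finite rank, given by its modules of sections over the affine opens of `X`:
for all affine opens `V ⊆ U`, sections restrict from `U` to `V`, and the
sections over `V` are obtained from the sections over `U` by extension of scalars
(quasi-coherence); and every point has an affine neighbourhood over which the module of sections
is free of finite rank (local triviality). The rank may vary. -/
structure AlgVectorBundle (X : Scheme.{u}) where
  sec : X.affineOpens → Type u
  [acg : ∀ U, AddCommGroup (sec U)]
  [mod : ∀ U, Module (Fun X U) (sec U)]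
  res : ∀ {U V : X.affineOpens} (h : V ≤ U), sec U →ₛₗ[resFun X h] sec V
  res_self : ∀ {U : X.affineOpens} (x : sec U), res (le_refl U) x = x
  res_res : ∀ {U V W : X.affineOpens} (h : V ≤ U) (h' : W ≤ V) (x : sec U),
    res h' (res h x) = res (h'.trans h) x
  isExtScalars : ∀ {U V : X.affineOpens} (h : V ≤ U), IsExtScalars (resFun X h) (res h)
  locallyTrivial : ∀ x : X, ∃ U : X.affineOpens, x ∈ U.1 ∧
    Module.Free (Fun X U) (sec U) ∧ Module.Finite (Fun X U) (sec U)

attribute [instance] AlgVectorBundle.acg AlgVectorBundle.mod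

namespace AlgVectorBundle

variable {X : Scheme.{u}}

/-- Two vector bundles are isomorphic if there are isomorphisms of their modules of sections over
all affine opens, compatible with restriction. -/
def Iso (E F : AlgVectorBundle X) : Prop :=
  ∃ e : ∀ U, E.sec U ≃ₗ[Fun X U] F.sec U,
    ∀ {U V : X.affineOpens} (h : V ≤ U) (x : E.sec U), e V (E.res h x) = F.res h (e U x)

instance setoid (X : Scheme.{u}) : Setoid (AlgVectorBundle X) where
  r := Iso
  iseqv :=
    { refl := fun E => ⟨fun U => LinearEquiv.refl _ _, fun _ _ => rfl⟩
      symm := fun ⟨e, he⟩ => ⟨fun U => (e U).symm, fun h x => by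
        rw [LinearEquiv.symm_apply_eq, he, LinearEquiv.apply_symm_apply]⟩
      trans := fun ⟨e, he⟩ ⟨f, hf⟩ => ⟨fun U => (e U).trans (f U), fun h x => by
        simp [he, hf]⟩ }

theorem resFun_self {U : X.affineOpens} (x : Fun X U) : resFun X (le_refl U) x = x := by
  simp [resFun]

theorem resFun_resFun {U V W : X.affineOpens} (h : V ≤ U) (h' : W ≤ V) (x : Fun X U) :
    resFun X h' (resFun X h x) = resFun X (h'.trans h) x := by
  have := X.presheaf.map_comp (homOfLE h : V.1 ⟶ U.1).op (homOfLE h' : W.1 ⟶ V.1).op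
  rw [resFun, resFun, ← CommRingCat.comp_apply, ← this]
  rfl

theorem trivial_of_le (E : AlgVectorBundle X) {U V : X.affineOpens} (h : V ≤ U)
    (hU : Module.Free (Fun X U) (E.sec U) ∧ Module.Finite (Fun X U) (E.sec U)) :
    Module.Free (Fun X V) (E.sec V) ∧ Module.Finite (Fun X V) (E.sec V) :=
  (E.isExtScalars h).free_finite hU

theorem exists_affine_le (x : X) (U V : X.affineOpens) (hU : x ∈ U.1) (hV : x ∈ V.1) :
    ∃ W : X.affineOpens, x ∈ W.1 ∧ W ≤ U ∧ W ≤ V := by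
  obtain ⟨W, hW, hxW, hle⟩ := exists_isAffineOpen_mem_and_subset (U := U.1 ⊓ V.1) ⟨hU, hV⟩
  exact ⟨⟨W, hW⟩, hxW, fun y hy => (hle hy).1, fun y hy => (hle hy).2⟩

/-- A finite family of bundles is trivialised on a common affine neighbourhood. -/
theorem exists_common {ι : Type} [Finite ι] [Nonempty ι] (E : ι → AlgVectorBundle X) (x : X) :
    ∃ U : X.affineOpens, x ∈ U.1 ∧ ∀ i, Module.Free (Fun X U) ((E i).sec U) ∧
      Module.Finite (Fun X U) ((E i).sec U) := by
  have := Fintype.ofFinite ι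
  have key : ∀ s : Finset ι, ∃ U : X.affineOpens, x ∈ U.1 ∧ ∀ i ∈ s,
      Module.Free (Fun X U) ((E i).sec U) ∧ Module.Finite (Fun X U) ((E i).sec U) := by
    classical
    intro s
    induction s using Finset.induction_on with
    | empty =>
      obtain ⟨U, hU, -⟩ := (E (Classical.arbitrary ι)).locallyTrivial x
      exact ⟨U, hU, by simp⟩
    | insert i s _ ih =>
      obtain ⟨U, hU, h⟩ := ih
      obtain ⟨V, hV, h'⟩ := (E i).locallyTrivial x
      obtain ⟨W, hW, h1, h2⟩ := exists_affine_le x U V hU hV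
      refine ⟨W, hW, fun j hj => ?_⟩
      rcases Finset.mem_insert.1 hj with rfl | hj
      · exact (E j).trivial_of_le h2 h'
      · exact (E j).trivial_of_le h1 (h j hj)
  obtain ⟨U, hU, h⟩ := key Finset.univ
  exact ⟨U, hU, fun i => h i (Finset.mem_univ i)⟩

theorem exists_common₂ (E F : AlgVectorBundle X) (x : X) :
    ∃ U : X.affineOpens, x ∈ U.1 ∧
      (Module.Free (Fun X U) (E.sec U) ∧ Module.Finite (Fun X U) (E.sec U)) ∧
      (Module.Free (Fun X U) (F.sec U) ∧ Module.Finite (Fun X U) (F.sec U)) := by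
  obtain ⟨U, hU, h⟩ := exists_common (fun b : Bool => if b then E else F) x
  exact ⟨U, hU, h true, h false⟩

/-- The trivial line bundle `𝒪_X`. -/
def unit (X : Scheme.{u}) : AlgVectorBundle X where
  sec U := Fun X U
  res h := (resFun X h).toSemilinearMap
  res_self := resFun_self
  res_res := resFun_resFun
  isExtScalars h := isExtScalars_self _
  locallyTrivial x := by
    obtain ⟨W, hW, hx, -⟩ := exists_isAffineOpen_mem_and_subset (X := X) (x := x) (U := ⊤) trivial
    exact ⟨⟨W, hW⟩, hx, inferInstance, inferInstance⟩

/-- The direct sum `E ⊕ F`. -/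
def sum (E F : AlgVectorBundle X) : AlgVectorBundle X where
  sec U := E.sec U × F.sec U
  res h := semiProd (E.res h) (F.res h)
  res_self x := Prod.ext (E.res_self _) (F.res_self _)
  res_res h h' x := Prod.ext (E.res_res _ _ _) (F.res_res _ _ _)
  isExtScalars h := isExtScalars_prod (E.isExtScalars h) (F.isExtScalars h)
  locallyTrivial x := by
    obtain ⟨U, hU, ⟨_, _⟩, ⟨_, _⟩⟩ := exists_common₂ E F x
    exact ⟨U, hU, inferInstance, inferInstance⟩

/-- The direct sum of a finite family of vector bundles. -/
def pi {ι : Type} [Fintype ι] (E : ι → AlgVectorBundle X) : AlgVectorBundle X where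
  sec U := ∀ i, (E i).sec U
  res h := semiPi fun i => (E i).res h
  res_self x := funext fun i => (E i).res_self _
  res_res h h' x := funext fun i => (E i).res_res _ _ _
  isExtScalars h := isExtScalars_pi _ fun i => (E i).isExtScalars h
  locallyTrivial x := by
    obtain ⟨U, hU, h⟩ := exists_common (fun o : Option ι => o.elim (unit X) E) x
    have h1 : ∀ i, Module.Free (Fun X U) ((E i).sec U) := fun i => (h (some i)).1
    have h2 : ∀ i, Module.Finite (Fun X U) ((E i).sec U) := fun i => (h (some i)).2
    exact ⟨U, hU, Module.Free.pi _ _, Module.Finite.pi⟩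

/-- The zero bundle. -/
def zero (X : Scheme.{u}) : AlgVectorBundle X where
  sec _ := PUnit
  res h := { toFun := fun _ => PUnit.unit, map_add' := fun _ _ => rfl, map_smul' := fun _ _ => rfl }
  res_self _ := rfl
  res_res _ _ _ := rfl
  isExtScalars h := fun Q _ _ g =>
    ⟨0, fun m => by rw [Subsingleton.elim m 0, map_zero, map_zero], fun h _ => by
      exact LinearMap.ext fun x => by rw [Subsingleton.elim x 0, map_zero, map_zero]⟩
  locallyTrivial x := by
    obtain ⟨U, hU, -⟩ := (unit X).locallyTrivial x
    exact ⟨U, hU, inferInstance, inferInstance⟩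

/-- The tensor product `E ⊗ F`. -/
noncomputable def tensor (E F : AlgVectorBundle X) : AlgVectorBundle X where
  sec U := E.sec U ⊗[Fun X U] F.sec U
  res h := TensorProduct.map (E.res h) (F.res h)
  res_self x := by
    induction x with
    | zero => simp
    | add a b ha hb => rw [map_add, ha, hb]
    | tmul a b => rw [TensorProduct.map_tmul, E.res_self, F.res_self]
  res_res h h' x := by
    induction x with
    | zero => simp
    | add a b ha hb => simp only [map_add, ha, hb]
    | tmul a b => simp only [TensorProduct.map_tmul, E.res_res, F.res_res]
  isExtScalars h := isExtScalars_tensor (E.isExtScalars h) (F.isExtScalars h)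
  locallyTrivial x := by
    obtain ⟨U, hU, ⟨_, _⟩, ⟨_, _⟩⟩ := exists_common₂ E F x
    exact ⟨U, hU, inferInstance, inferInstance⟩

/-- The exterior power `⋀ⁿ E`. -/
noncomputable def ext (n : ℕ) (E : AlgVectorBundle X) : AlgVectorBundle X where
  sec U := ⋀[Fun X U]^n (E.sec U)
  res h := extMap n (E.res h)
  res_self x := by
    induction x using extPow_induction with
    | hι v => simp only [extMap_ιMulti, E.res_self]
    | hz => simp
    | ha a b ha hb => rw [map_add, ha, hb]
    | hs r a ha => rw [map_smulₛₗ, ha, resFun_self]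
  res_res h h' x := by
    induction x using extPow_induction with
    | hι v => simp only [extMap_ιMulti, E.res_res]
    | hz => simp
    | ha a b ha hb => simp only [map_add, ha, hb]
    | hs r a ha => simp only [map_smulₛₗ, ha, resFun_resFun]
  isExtScalars h := isExtScalars_extMap n (E.isExtScalars h)
  locallyTrivial x := by
    obtain ⟨U, hU, _, _⟩ := E.locallyTrivial x
    exact ⟨U, hU, inferInstance, inferInstance⟩

theorem Iso.sum {E E' F F' : AlgVectorBundle X} (h : Iso E E') (h' : Iso F F') :
    Iso (E.sum F) (E'.sum F') := by
  obtain ⟨e, he⟩ := h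
  obtain ⟨f, hf⟩ := h'
  exact ⟨fun U => (e U).prodCongr (f U), fun h x => Prod.ext (he h x.1) (hf h x.2)⟩

theorem Iso.tensor {E E' F F' : AlgVectorBundle X} (h : Iso E E') (h' : Iso F F') :
    Iso (E.tensor F) (E'.tensor F') := by
  obtain ⟨e, he⟩ := h
  obtain ⟨f, hf⟩ := h'
  refine ⟨fun U => TensorProduct.congr (e U) (f U), fun {U V} h x => ?_⟩
  change TensorProduct.congr (e V) (f V) (TensorProduct.map (E.res h) (F.res h) x) =
    TensorProduct.map (E'.res h) (F'.res h) (TensorProduct.congr (e U) (f U) x)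
  induction x using TensorProduct.induction_on with
  | zero => simp
  | add a b ha hb => simp only [map_add, ha, hb]
  | tmul a b => simp only [TensorProduct.map_tmul, TensorProduct.congr_tmul, he, hf]

theorem Iso.ext (n : ℕ) {E F : AlgVectorBundle X} (h : Iso E F) : Iso (E.ext n) (F.ext n) := by
  obtain ⟨e, he⟩ := h
  refine ⟨fun U => extEquiv n (e U),
    fun {U V} h x => ?_⟩
  change exteriorPower.map n (e V).toLinearMap (extMap n (E.res h) x) =
    extMap n (F.res h) (exteriorPower.map n (e U).toLinearMap x)
  induction x using extPow_induction with
  | hι v =>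
    simp only [extMap_ιMulti, exteriorPower.map_apply_ιMulti]
    congr 1
    ext i
    exact he h (v i)
  | hz => simp
  | ha a b ha hb => simp only [map_add, ha, hb]
  | hs r a ha => simp only [map_smulₛₗ, RingHom.id_apply, ha]

section Laws

variable (E F G : AlgVectorBundle X)

theorem sum_comm : Iso (E.sum F) (F.sum E) :=
  ⟨fun _ => LinearEquiv.prodComm _ _ _, fun _ _ => rfl⟩

theorem sum_assoc : Iso ((E.sum F).sum G) (E.sum (F.sum G)) :=
  ⟨fun _ => LinearEquiv.prodAssoc _ _ _ _, fun _ _ => rfl⟩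

theorem zero_sum : Iso ((zero X).sum E) E :=
  ⟨fun _ => { toFun := fun x => x.2, invFun := fun x => (PUnit.unit, x), left_inv := fun _ => rfl,
              right_inv := fun _ => rfl, map_add' := fun _ _ => rfl, map_smul' := fun _ _ => rfl },
    fun _ _ => rfl⟩

theorem tensor_comm : Iso (E.tensor F) (F.tensor E) := by
  refine ⟨fun U => TensorProduct.comm _ _ _, fun {U V} h x => ?_⟩
  change TensorProduct.comm _ _ _ (TensorProduct.map (E.res h) (F.res h) x) =
    TensorProduct.map (F.res h) (E.res h) (TensorProduct.comm _ _ _ x)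
  induction x using TensorProduct.induction_on with
  | zero => simp
  | add a b ha hb => simp only [map_add, ha, hb]
  | tmul a b => rfl

theorem tensor_assoc : Iso ((E.tensor F).tensor G) (E.tensor (F.tensor G)) :=
  ⟨fun U => TensorProduct.assoc (Fun X U) (E.sec U) (F.sec U) (G.sec U),
    fun h x => assoc_map (E.res h) (F.res h) (G.res h) x⟩

theorem unit_tensor : Iso ((unit X).tensor E) E :=
  ⟨fun U => TensorProduct.lid (Fun X U) (E.sec U), fun h x => lid_map (E.res h) x⟩

theorem zero_tensor : Iso ((zero X).tensor E) (zero X) := by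
  have _ : ∀ U, Subsingleton (((zero X).tensor E).sec U) := fun U =>
    subsingleton_punit_tensor (Fun X U) (E.sec U)
  exact ⟨fun U => { toFun := fun _ => PUnit.unit, invFun := fun _ => 0,
                    left_inv := fun _ => Subsingleton.elim _ _, right_inv := fun _ => rfl,
                    map_add' := fun _ _ => rfl, map_smul' := fun _ _ => rfl }, fun _ _ => rfl⟩

theorem sum_tensor : Iso ((E.sum F).tensor G) ((E.tensor G).sum (F.tensor G)) :=
  ⟨fun U => TensorProduct.prodLeft (Fun X U) (Fun X U) (E.sec U) (F.sec U) (G.sec U),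
    fun h x => prodLeft_map (E.res h) (F.res h) (G.res h) x⟩

theorem ext_zero : Iso (E.ext 0) (unit X) := by
  refine ⟨fun U => exteriorPower.zeroEquiv _ _, fun {U V} h x => ?_⟩
  change exteriorPower.zeroEquiv _ _ (extMap 0 (E.res h) x) =
    resFun X h (exteriorPower.zeroEquiv _ _ x)
  induction x using extPow_induction with
  | hι v => rw [extMap_ιMulti]; simp only [exteriorPower.zeroEquiv_ιMulti, map_one]
  | hz => simp
  | ha a b ha hb => simp only [map_add, ha, hb]
  | hs r a ha => simp only [map_smulₛₗ, RingHom.id_apply, ha, smul_eq_mul, map_mul]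

theorem ext_one : Iso (E.ext 1) E := by
  refine ⟨fun U => exteriorPower.oneEquiv _ _, fun {U V} h x => ?_⟩
  change exteriorPower.oneEquiv _ _ (extMap 1 (E.res h) x) =
    E.res h (exteriorPower.oneEquiv _ _ x)
  induction x using extPow_induction with
  | hι v => rw [extMap_ιMulti]; simp only [exteriorPower.oneEquiv_ιMulti]
  | hz => simp
  | ha a b ha hb => simp only [map_add, ha, hb]
  | hs r a ha => simp only [map_smulₛₗ, RingHom.id_apply, ha]

theorem ext_sum (n : ℕ) : Iso (pi fun p : {p : ℕ × ℕ // p ∈ Finset.HasAntidiagonal.antidiagonal n} =>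
    (E.ext p.1.1).tensor (F.ext p.1.2)) ((E.sum F).ext n) :=
  ⟨fun U => LinearEquiv.ofBijective (extSumMap (Fun X U) (E.sec U) (F.sec U) n)
    (extSumMap_bijective n), fun h x => (extMap_extSumMap n (E.res h) (F.res h) x).symm⟩

theorem Iso.pi {ι : Type} [Fintype ι] {E F : ι → AlgVectorBundle X} (h : ∀ i, Iso (E i) (F i)) :
    Iso (pi E) (pi F) := by
  choose e he using h
  exact ⟨fun U => LinearEquiv.piCongrRight fun i => e i U, fun h x => funext fun i => he i h (x i)⟩

theorem pi_empty (E : PEmpty → AlgVectorBundle X) : Iso (pi E) (zero X) :=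
  ⟨fun _ => { toFun := fun _ => PUnit.unit, invFun := fun _ => 0,
              left_inv := fun _ => funext fun i => i.elim, right_inv := fun _ => rfl,
              map_add' := fun _ _ => rfl, map_smul' := fun _ _ => rfl }, fun _ _ => rfl⟩

theorem pi_option {ι : Type} [Fintype ι] (E : Option ι → AlgVectorBundle X) :
    Iso (pi E) ((E none).sum (pi fun i => E (some i))) :=
  ⟨fun _ => { toFun := fun x => (x none, fun i => x (some i))
              invFun := fun x o => Option.rec x.1 x.2 o
              left_inv := fun x => funext fun o => by cases o <;> rfl
              right_inv := fun _ => rfl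
              map_add' := fun _ _ => rfl, map_smul' := fun _ _ => rfl }, fun _ _ => rfl⟩

theorem pi_equiv {ι κ : Type} [Fintype ι] [Fintype κ] (e : ι ≃ κ) (E : κ → AlgVectorBundle X) :
    Iso (pi E) (pi fun i => E (e i)) :=
  ⟨fun U => { toFun := fun x i => x (e i)
              invFun := fun x => (Equiv.piCongrLeft (fun k => (E k).sec U) e) x
              left_inv := fun x => (Equiv.piCongrLeft (fun k => (E k).sec U) e).apply_symm_apply x
              right_inv := fun x => (Equiv.piCongrLeft (fun k => (E k).sec U) e).symm_apply_apply x
              map_add' := fun _ _ => rfl, map_smul' := fun _ _ => rfl }, fun _ _ => rfl⟩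

end Laws

end AlgVectorBundle

end Bundles

section GrothendieckRing

/-! The ring structure on the Grothendieck group of a commutative semiring. -/

variable (S : Type u) [CommSemiring S]

open Algebra

/-- The Grothendieck ring of a commutative semiring `S`: the abelian group generated by symbols
`[a]` for `a` in `S` with relations `[a + b] = [a] + [b]`, with product `[a] * [b] = [a * b]`. -/
def GrothendieckRing : Type u := GrothendieckAddGroup S

namespace GrothendieckRing

instance : AddCommGroup (GrothendieckRing S) :=
  inferInstanceAs (AddCommGroup (GrothendieckAddGroup S))

variable {S}

/-- The class `[a]`. -/
def of : S →+ GrothendieckRing S := GrothendieckAddGroup.of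

/-- The universal property of the Grothendieck group. -/
noncomputable def lift {G : Type*} [AddCommGroup G] (f : S →+ G) : GrothendieckRing S →+ G :=
  GrothendieckAddGroup.lift f

theorem lift_of {G : Type*} [AddCommGroup G] (f : S →+ G) (a : S) : lift f (of a) = f a :=
  DFunLike.congr_fun (GrothendieckAddGroup.lift.symm_apply_apply f) a

theorem hom_ext {G : Type*} [AddCommGroup G] {f g : GrothendieckRing S →+ G}
    (h : ∀ a, f (of a) = g (of a)) : f = g :=
  GrothendieckAddGroup.lift.symm.injective (AddMonoidHom.ext h)

variable (S) in
/-- The multiplication, as a biadditive map. -/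
noncomputable def mulHom : GrothendieckRing S →+ GrothendieckRing S →+ GrothendieckRing S :=
  lift
    { toFun := fun a => lift (of.comp (AddMonoidHom.mulLeft a))
      map_zero' := hom_ext fun b => by simp [lift_of]
      map_add' := fun a a' => hom_ext fun b => by simp [lift_of, add_mul] }

theorem mulHom_of (a b : S) : mulHom S (of a) (of b) = of (a * b) := by
  simp [mulHom, lift_of]

theorem induction {p : GrothendieckRing S → Prop} (x : GrothendieckRing S)
    (h : ∀ a b, p (of a - of b)) : p x := by
  let H : AddSubgroup (GrothendieckRing S) :=
    { carrier := {x | ∃ a b, x = of a - of b}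
      zero_mem' := ⟨0, 0, by simp⟩
      add_mem' := by
        rintro _ _ ⟨a, b, rfl⟩ ⟨c, d, rfl⟩
        exact ⟨a + c, b + d, by rw [map_add, map_add]; abel⟩
      neg_mem' := by
        rintro _ ⟨a, b, rfl⟩
        exact ⟨b, a, by abel⟩ }
  have h0 : QuotientAddGroup.mk' H = 0 := hom_ext fun a =>
    (QuotientAddGroup.eq_zero_iff _).2 ⟨a, 0, by simp⟩
  obtain ⟨a, b, rfl⟩ := (QuotientAddGroup.eq_zero_iff x).1 (DFunLike.congr_fun h0 x)
  exact h a b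

noncomputable instance : CommRing (GrothendieckRing S) where
  __ := (inferInstance : AddCommGroup (GrothendieckRing S))
  mul x y := mulHom S x y
  one := of 1
  left_distrib x y z := map_add (mulHom S x) y z
  right_distrib x y z := by
    change mulHom S (x + y) z = mulHom S x z + mulHom S y z
    rw [map_add]; rfl
  zero_mul x := by
    change mulHom S 0 x = 0
    rw [map_zero]; rfl
  mul_zero x := map_zero (mulHom S x)
  mul_assoc x y z := by
    change mulHom S (mulHom S x y) z = mulHom S x (mulHom S y z)
    induction x using induction with | h a a'
    induction y using induction with | h b b'
    induction z using induction with | h c c'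
    simp only [map_sub, AddMonoidHom.sub_apply, mulHom_of, mul_assoc]
  one_mul x := by
    change mulHom S (of 1) x = x
    induction x using induction with | h a a'
    simp only [map_sub, mulHom_of, one_mul]
  mul_one x := by
    change mulHom S x (of 1) = x
    induction x using induction with | h a a'
    simp only [map_sub, AddMonoidHom.sub_apply, mulHom_of, mul_one]
  mul_comm x y := by
    change mulHom S x y = mulHom S y x
    induction x using induction with | h a a'
    induction y using induction with | h b b'
    simp only [map_sub, AddMonoidHom.sub_apply, mulHom_of, mul_comm _ a, mul_comm _ a']
    abel

theorem of_mul (a b : S) : of (a * b) = of a * of b := (mulHom_of a b).symm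

theorem of_one : (of 1 : GrothendieckRing S) = 1 := rfl

end GrothendieckRing

end GrothendieckRing

section LambdaRings

/-- A `λ`-structure on a commutative ring. -/
class LambdaRing (A : Type*) [CommRing A] where
  lam : ℕ → A → A
  lam_zero : ∀ x, lam 0 x = 1
  lam_one : ∀ x, lam 1 x = x
  lam_add : ∀ n x y, lam n (x + y) =
    ∑ p ∈ Finset.HasAntidiagonal.antidiagonal n, lam p.1 x * lam p.2 y

/-- A `λ`-homomorphism is a ring homomorphism commuting with the `λ`-operations. -/
def IsLambdaHom {A B : Type*} [CommRing A] [CommRing B] [LambdaRing A] [LambdaRing B]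
    (f : A →+* B) : Prop :=
  ∀ n x, f (LambdaRing.lam n x) = LambdaRing.lam n (f x)

namespace GrothendieckRing

variable {S : Type u} [CommSemiring S] (e : ℕ → S → S)

/-- The power series `∑ [e n a] tⁿ`. -/
noncomputable def opSeries (a : S) : PowerSeries (GrothendieckRing S) :=
  PowerSeries.mk fun n => of (e n a)

theorem isUnit_opSeries (e_zero : ∀ a, e 0 a = 1) (a : S) : IsUnit (opSeries e a) := by
  rw [PowerSeries.isUnit_iff_constantCoeff]
  simp [opSeries, e_zero, of_one]

theorem opSeries_add (e_add : ∀ n a b, e n (a + b) =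
      ∑ p ∈ Finset.HasAntidiagonal.antidiagonal n, e p.1 a * e p.2 b) (a b : S) :
    opSeries e (a + b) = opSeries e a * opSeries e b := by
  ext n
  simp [opSeries, PowerSeries.coeff_mul, e_add, of_mul]

/-- The additive map to the multiplicative group of power series
with `[a] ↦ ∑ [e n a] tⁿ`. -/
noncomputable def opHom (e_zero : ∀ a, e 0 a = 1)
    (e_add : ∀ n a b, e n (a + b) =
      ∑ p ∈ Finset.HasAntidiagonal.antidiagonal n, e p.1 a * e p.2 b) :
    GrothendieckRing S →+ Additive (PowerSeries (GrothendieckRing S))ˣ :=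
  lift
    { toFun := fun a => Additive.ofMul (isUnit_opSeries e e_zero a).unit
      map_zero' := by
        have h := opSeries_add e e_add 0 0
        rw [add_zero] at h
        apply Additive.toMul.injective
        ext1
        exact (isUnit_opSeries e e_zero 0).mul_left_cancel (h.symm.trans (mul_one _).symm)
      map_add' := fun a b => by
        apply Additive.toMul.injective
        ext1
        exact opSeries_add e e_add a b }

theorem opHom_of (e_zero) (e_add) (a : S) :
    ((opHom e e_zero e_add (of a)).toMul : PowerSeries (GrothendieckRing S)) = opSeries e a := by
  rw [opHom, lift_of]; rfl

theorem opHom_sub_mul (e_zero) (e_add) (a b : S) :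
    ((opHom e e_zero e_add (of a - of b)).toMul : PowerSeries (GrothendieckRing S)) *
      opSeries e b = opSeries e a := by
  have h := opHom_of e e_zero e_add a
  rw [← sub_add_cancel (of a) (of b), map_add, toMul_add, Units.val_mul, opHom_of] at h
  exact h

/-- Operations `e n` on a commutative semiring `S` with `e 0 a = 1`, `e 1 a = a` and
`e n (a + b) = ∑_{i+j=n} e i a * e j b` extend to a `λ`-structure on the Grothendieck ring. -/
@[reducible] noncomputable def lambdaRing (e_zero : ∀ a, e 0 a = 1) (e_one : ∀ a, e 1 a = a)
    (e_add : ∀ n a b, e n (a + b) =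
      ∑ p ∈ Finset.HasAntidiagonal.antidiagonal n, e p.1 a * e p.2 b) :
    LambdaRing (GrothendieckRing S) where
  lam n x := PowerSeries.coeff n
    ((opHom e e_zero e_add x).toMul : PowerSeries (GrothendieckRing S))
  lam_zero x := by
    induction x using induction with | h a b
    have h := opHom_sub_mul e e_zero e_add a b
    obtain ⟨x, hx⟩ : ∃ x, x = of a - of b := ⟨_, rfl⟩
    rw [← hx] at h ⊢
    have h0 := congrArg (PowerSeries.coeff 0) h
    simpa [PowerSeries.coeff_mul, opSeries, e_zero, of_one] using h0
  lam_one x := by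
    induction x using induction with | h a b
    have h := opHom_sub_mul e e_zero e_add a b
    obtain ⟨x, hx⟩ : ∃ x, x = of a - of b := ⟨_, rfl⟩
    rw [← hx] at h ⊢
    have h0 := congrArg (PowerSeries.coeff 0) h
    have h1 := congrArg (PowerSeries.coeff 1) h
    simp [PowerSeries.coeff_mul, opSeries, e_zero, of_one,
      Finset.Nat.antidiagonal_succ, e_one] at h0 h1
    rw [h0, one_mul] at h1
    rw [eq_sub_of_add_eq' h1, hx]
  lam_add n x y := by
    rw [map_add, toMul_add, Units.val_mul, PowerSeries.coeff_mul]

theorem lambdaRing_lam_of (e_zero) (e_one) (e_add) (n : ℕ) (a : S) :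
    (lambdaRing e e_zero e_one e_add).lam n (of a) = of (e n a) := by
  change PowerSeries.coeff n _ = _
  rw [opHom_of, opSeries, PowerSeries.coeff_mk]

end GrothendieckRing

end LambdaRings

section Universal
open MvPolynomial

theorem existsUnique_esymm {R : Type*} [CommRing R] {N : ℕ} {T : MvPolynomial (Fin N) R}
    (hT : T.IsSymmetric) :
    ∃! P : MvPolynomial (Fin N) R, aeval (fun i : Fin N => esymm (Fin N) R (i + 1)) P = T := by
  let e := esymmAlgEquiv (Fin N) R (Fintype.card_fin N)
  have he : ∀ P, ((e P : symmetricSubalgebra (Fin N) R) : MvPolynomial (Fin N) R) =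
      aeval (fun i : Fin N => esymm (Fin N) R (i + 1)) P := fun P => by
    rw [← esymmAlgHom_apply]; rfl
  refine ⟨e.symm ⟨T, hT⟩, ?_, fun P hP => ?_⟩
  · change aeval _ _ = T
    rw [← he, e.apply_symm_apply]
  · rw [AlgEquiv.eq_symm_apply]
    exact Subtype.ext ((he P).trans hP)

/-- The coefficient of `t^m` in `∏_{|S| = k} (1 + t ∏_{j ∈ S} a_j)`, in `m * k` variables `a_j`. -/
noncomputable def subsetCoeff (m k : ℕ) : MvPolynomial (Fin (m * k)) ℤ :=
  Polynomial.coeff (∏ S ∈ Finset.powersetCard k (Finset.univ : Finset (Fin (m * k))),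
    (1 + Polynomial.X * Polynomial.C (∏ j ∈ S, X j))) m

theorem isSymmetric_subsetCoeff (m k : ℕ) : (subsetCoeff m k).IsSymmetric := by
  intro e
  rw [subsetCoeff, ← AlgHom.coe_toRingHom, ← Polynomial.coeff_map, Polynomial.map_prod]
  congr 1
  refine Finset.prod_bij (fun S _ => S.map e.toEmbedding) (fun S hS => ?_) (fun S _ S' _ h => ?_)
    (fun S hS => ?_) (fun S _ => ?_)
  · simpa [Finset.mem_powersetCard] using hS
  · exact Finset.map_injective _ h
  · refine ⟨S.map e.symm.toEmbedding, ?_, ?_⟩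
    · simpa [Finset.mem_powersetCard] using hS
    · ext; simp
  · simp [Polynomial.map_prod, map_prod]

/-- The coefficient of `t^n` in `∏_{i,j} (1 + a_i b_j t)`, in `n + n` variables `a_i`, `b_j`. -/
noncomputable def productCoeff (n : ℕ) : MvPolynomial (Fin n ⊕ Fin n) ℤ :=
  Polynomial.coeff (∏ i : Fin n, ∏ j : Fin n,
    (1 + Polynomial.X * Polynomial.C (X (Sum.inl i) * X (Sum.inr j)))) n

/-- The `k`-th elementary symmetric polynomials in the `a_i` and in the `b_j`, `1 ≤ k ≤ n`. -/
noncomputable def esymm₂ (n : ℕ) : Fin n ⊕ Fin n → MvPolynomial (Fin n ⊕ Fin n) ℤ :=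
  Sum.elim (fun i => rename Sum.inl (esymm (Fin n) ℤ (i + 1)))
    (fun j => rename Sum.inr (esymm (Fin n) ℤ (j + 1)))

theorem prod_one_add_linear {A : Type*} [CommRing A] {n : ℕ} (y : A) (x : Fin n → A) :
    ∏ j, (1 + Polynomial.X * Polynomial.C (y * x j)) = ∑ k ∈ Finset.range (n + 1),
      Polynomial.C ((∑ S ∈ Finset.powersetCard k Finset.univ, ∏ j ∈ S, x j) * y ^ k) *
        Polynomial.X ^ k := by
  rw [Finset.prod_one_add, Finset.sum_powerset, Finset.card_univ, Fintype.card_fin]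
  refine Finset.sum_congr rfl fun k _ => ?_
  rw [Finset.sum_mul, map_sum, Finset.sum_mul]
  refine Finset.sum_congr rfl fun S hS => ?_
  rw [Finset.prod_mul_distrib, ← map_prod, Finset.prod_mul_distrib, Finset.prod_const,
    Finset.prod_const, (Finset.mem_powersetCard.1 hS).2, mul_comm, mul_comm (y ^ k)]

theorem existsUnique_mulPoly (n : ℕ) :
    ∃! P : MvPolynomial (Fin n ⊕ Fin n) ℤ, aeval (esymm₂ n) P = productCoeff n := by
  -- `P` as a polynomial in the elementary symmetric polynomials of the `a_i`, with coefficients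
  -- polynomials in those of the `b_j`
  let B := MvPolynomial (Fin n) ℤ
  let E := sumAlgEquiv ℤ (Fin n) (Fin n)
  let ε : B →ₐ[ℤ] B := aeval (fun j : Fin n => esymm (Fin n) ℤ (j + 1))
  have hε : Function.Injective ε := fun P Q h =>
    esymmAlgHom_injective ℤ (σ := Fin n) (n := n) (by simp)
      (Subtype.ext (by rw [esymmAlgHom_apply, esymmAlgHom_apply]; exact h))
  have hεX : ∀ j : Fin n, ε (X j) = esymm (Fin n) ℤ (j + 1) := fun j => aeval_X _ _
  have hεC : ∀ b : B, MvPolynomial.map ε.toRingHom (C b : MvPolynomial (Fin n) B) = C (ε b) :=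
    fun b => map_C _ _
  have hinl : ∀ p, E (rename Sum.inl p) = MvPolynomial.map C p := fun p => by
    induction p using MvPolynomial.induction_on with
    | C r => simp [E]
    | add p q hp hq => simp only [map_add, hp, hq]
    | mul_X p i hp => simp only [map_mul, hp, rename_X, map_X]; simp [E]
  have hinr : ∀ p, E (rename Sum.inr p) = C p := fun p => by
    induction p using MvPolynomial.induction_on with
    | C r => simp [E]
    | add p q hp hq => simp only [map_add, hp, hq]
    | mul_X p i hp => simp only [map_mul, hp, rename_X]; simp [E]
  let δ : MvPolynomial (Fin n) B →ₐ[B] MvPolynomial (Fin n) B :=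
    aeval (fun j : Fin n => esymm (Fin n) B (j + 1))
  have key : ∀ P, E (aeval (esymm₂ n) P) = MvPolynomial.map ε.toRingHom (δ (E P)) := by
    intro P
    induction P using MvPolynomial.induction_on with
    | C r => simp [E, δ]
    | add p q hp hq => simp only [map_add, hp, hq]
    | mul_X p i hp =>
      simp only [map_mul, hp, aeval_X]
      congr 1
      cases i with
      | inl i =>
        simp only [esymm₂, Sum.elim_inl, hinl, E, sumAlgEquiv_X_inl, δ, aeval_X, map_esymm]
        rfl
      | inr j =>
        simp only [esymm₂, Sum.elim_inr, hinr, E, sumAlgEquiv_X_inr, δ]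
        have h1 : aeval (fun j : Fin n => esymm (Fin n) B (j + 1)) (C (X j) : MvPolynomial (Fin n) B)
            = C (X j) := aeval_C _ _
        rw [h1, hεC, hεX]
  let T : MvPolynomial (Fin n) B := Polynomial.coeff (∏ i : Fin n,
    (1 + ∑ j : Fin n, Polynomial.C (C (X j) * X i ^ (j.1 + 1)) * Polynomial.X ^ (j.1 + 1))) n
  have hT : T.IsSymmetric := by
    intro e
    rw [← AlgHom.coe_toRingHom, ← Polynomial.coeff_map, Polynomial.map_prod]
    congr 1
    refine Fintype.prod_equiv e _ _ fun i => ?_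
    simp [Polynomial.map_sum]
  have hTn : MvPolynomial.map ε.toRingHom T = E (productCoeff n) := by
    have h2 : E (productCoeff n) = Polynomial.coeff (Polynomial.map E.toRingEquiv.toRingHom
      (∏ i : Fin n, ∏ j : Fin n,
        (1 + Polynomial.X * Polynomial.C (X (Sum.inl i) * X (Sum.inr j))))) n := by
      rw [Polynomial.coeff_map]; rfl
    rw [h2, ← Polynomial.coeff_map, Polynomial.map_prod, Polynomial.map_prod]
    congr 1
    refine Finset.prod_congr rfl fun i _ => ?_
    rw [Polynomial.map_prod]
    simp only [Polynomial.map_add, Polynomial.map_one, Polynomial.map_mul, Polynomial.map_X,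
      Polynomial.map_C, Polynomial.map_sum, Polynomial.map_pow]
    have h3 : ∀ j : Fin n, E.toRingEquiv.toRingHom (X (Sum.inl i) * X (Sum.inr j)) =
        X i * C (X j) := fun j => by
      change E _ = _
      simp [E]
    have h4 : ∀ j : Fin n, MvPolynomial.map ε.toRingHom (C (X j) * X i ^ (j.1 + 1)) =
        C (esymm (Fin n) ℤ (j.1 + 1)) * X i ^ (j.1 + 1) := fun j => by
      rw [map_mul, map_pow, map_X, hεC, hεX]
    simp only [h3, h4]
    rw [prod_one_add_linear, Finset.sum_range_succ', Finset.sum_range, add_comm]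
    simp [esymm, map_sum, map_prod]
  obtain ⟨P, hP, hu⟩ := existsUnique_esymm hT
  refine ⟨E.symm P, ?_, fun Q hQ => ?_⟩
  · apply E.injective
    rw [key, E.apply_symm_apply, ← hTn]
    exact congrArg _ hP
  · rw [AlgEquiv.eq_symm_apply]
    refine hu _ (MvPolynomial.map_injective ε.toRingHom hε ?_)
    rw [hTn, ← hQ, key]

/-- The universal polynomial `P_n` with
`P_n(e_1(a), …, e_n(a), e_1(b), …, e_n(b))` equal to the coefficient of `t^n` in
`∏_{i,j} (1 + a_i b_j t)`. -/
noncomputable def mulPoly (n : ℕ) : MvPolynomial (Fin n ⊕ Fin n) ℤ :=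
  (existsUnique_mulPoly n).choose

theorem mulPoly_spec (n : ℕ) : aeval (esymm₂ n) (mulPoly n) = productCoeff n :=
  (existsUnique_mulPoly n).choose_spec.1

theorem mulPoly_zero : mulPoly 0 = 1 :=
  (existsUnique_mulPoly 0).unique (mulPoly_spec 0) (by simp [productCoeff])

/-- The universal polynomial `Q_{m,k}` with `Q_{m,k}(e_1(a), …, e_{mk}(a))` equal to the coefficient
of `t^m` in `∏_{|S| = k} (1 + t ∏_{j ∈ S} a_j)`. -/
noncomputable def lamPoly (m k : ℕ) : MvPolynomial (Fin (m * k)) ℤ :=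
  (existsUnique_esymm (isSymmetric_subsetCoeff m k)).choose

theorem lamPoly_spec (m k : ℕ) :
    aeval (fun i : Fin (m * k) => esymm (Fin (m * k)) ℤ (i + 1)) (lamPoly m k) = subsetCoeff m k :=
  (existsUnique_esymm (isSymmetric_subsetCoeff m k)).choose_spec.1

theorem lamPoly_zero (k : ℕ) : lamPoly 0 k = 1 :=
  (existsUnique_esymm (isSymmetric_subsetCoeff 0 k)).unique (lamPoly_spec 0 k) (by
    rw [map_one, subsetCoeff, Polynomial.coeff_zero_eq_eval_zero, Polynomial.eval_prod]
    simp)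

/-- The Newton polynomial `N_n` with `N_n(e_1(a), …, e_n(a)) = a_1^n + ⋯ + a_n^n`. -/
noncomputable def newtonPoly (n : ℕ) : MvPolynomial (Fin n) ℤ :=
  (existsUnique_esymm (psum_isSymmetric (Fin n) ℤ n)).choose

theorem newtonPoly_spec (n : ℕ) :
    aeval (fun i : Fin n => esymm (Fin n) ℤ (i + 1)) (newtonPoly n) = psum (Fin n) ℤ n :=
  (existsUnique_esymm (psum_isSymmetric (Fin n) ℤ n)).choose_spec.1

end Universal

section Special

/-- The set `1 + t A[[t]]`. -/
def OnePlus (A : Type*) [CommRing A] : Type _ :=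
  {f : PowerSeries A // PowerSeries.constantCoeff f = 1}

namespace OnePlus

variable {A : Type*} [CommRing A]

/-- The coefficient of `t^n`. -/
noncomputable def coeff (n : ℕ) (f : OnePlus A) : A := PowerSeries.coeff n f.1

/-- The addition of the `λ`-ring `1 + t A[[t]]`: the product of power series. -/
noncomputable def add (f g : OnePlus A) : OnePlus A :=
  ⟨f.1 * g.1, by rw [map_mul, f.2, g.2, one_mul]⟩

/-- The unit element `1 + t` of the `λ`-ring `1 + t A[[t]]`. -/
noncomputable def one : OnePlus A :=
  ⟨1 + PowerSeries.X, by simp⟩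

/-- The multiplication of the `λ`-ring `1 + t A[[t]]`, given by universal polynomials such that
`∏ (1 + a_i t) · ∏ (1 + b_j t) = ∏ (1 + a_i b_j t)`. -/
noncomputable def mul (f g : OnePlus A) : OnePlus A :=
  ⟨PowerSeries.mk fun n => MvPolynomial.aeval
    (Sum.elim (fun i : Fin n => coeff (i + 1) f) (fun j : Fin n => coeff (j + 1) g)) (mulPoly n),
    by rw [← PowerSeries.coeff_zero_eq_constantCoeff_apply, PowerSeries.coeff_mk, mulPoly_zero,
      map_one]⟩

/-- The operation `Λ^k` of the `λ`-ring `1 + t A[[t]]`, given by universal polynomials such that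
`Λ^k ∏ (1 + a_i t) = ∏_{|S| = k} (1 + t ∏_{j ∈ S} a_j)`. -/
noncomputable def lam (k : ℕ) (f : OnePlus A) : OnePlus A :=
  ⟨PowerSeries.mk fun m => MvPolynomial.aeval
    (fun i : Fin (m * k) => coeff (i + 1) f) (lamPoly m k),
    by rw [← PowerSeries.coeff_zero_eq_constantCoeff_apply, PowerSeries.coeff_mk, lamPoly_zero,
      map_one]⟩

end OnePlus

variable {A : Type*} [CommRing A] [LambdaRing A]

/-- The map `λ_t : A → 1 + t A[[t]]`, `λ_t(x) = ∑ λ^n(x) t^n`. -/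
noncomputable def lambdaT (x : A) : OnePlus A :=
  ⟨PowerSeries.mk fun n => LambdaRing.lam n x, by
    rw [← PowerSeries.coeff_zero_eq_constantCoeff_apply, PowerSeries.coeff_mk,
      LambdaRing.lam_zero]⟩

variable (A) in
/-- A `λ`-ring `A` is special if `λ_t : A → 1 + t A[[t]]` is a `λ`-homomorphism. -/
structure IsSpecial : Prop where
  map_add : ∀ x y : A, lambdaT (x + y) = (lambdaT x).add (lambdaT y)
  map_one : lambdaT (1 : A) = OnePlus.one
  map_mul : ∀ x y : A, lambdaT (x * y) = (lambdaT x).mul (lambdaT y)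
  map_lam : ∀ (k : ℕ) (x : A), lambdaT (LambdaRing.lam k x) = (lambdaT x).lam k

/-- The Adams operation `Ψ^n(x) = N_n(λ^1 x, …, λ^n x)`, where `N_n` is the Newton polynomial. -/
noncomputable def adams (n : ℕ) (x : A) : A :=
  MvPolynomial.aeval (fun i : Fin n => LambdaRing.lam (i + 1) x) (newtonPoly n)

end Special

section Classes

variable (X : Scheme.{u})

/-- The isomorphism classes of vector bundles on `X`. -/
def BundleClass : Type (u + 1) := Quotient (AlgVectorBundle.setoid X)

namespace BundleClass

open AlgVectorBundle

variable {X}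

/-- The isomorphism class of a vector bundle. -/
def mk (E : AlgVectorBundle X) : BundleClass X := Quotient.mk _ E

theorem mk_eq {E F : AlgVectorBundle X} (h : Iso E F) : mk E = mk F := Quotient.sound h

instance : Add (BundleClass X) :=
  ⟨Quotient.map₂ AlgVectorBundle.sum fun _ _ h _ _ h' => h.sum h'⟩

instance : Zero (BundleClass X) := ⟨mk (zero X)⟩

noncomputable instance : Mul (BundleClass X) :=
  ⟨Quotient.map₂ AlgVectorBundle.tensor fun _ _ h _ _ h' => h.tensor h'⟩

instance : One (BundleClass X) := ⟨mk (unit X)⟩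

/-- Isomorphism classes form a commutative semiring under `⊕` and `⊗`. -/
noncomputable instance : CommSemiring (BundleClass X) where
  add_assoc := by
    rintro ⟨E⟩ ⟨F⟩ ⟨G⟩; exact mk_eq (sum_assoc E F G)
  add_comm := by
    rintro ⟨E⟩ ⟨F⟩; exact mk_eq (sum_comm E F)
  zero_add := by
    rintro ⟨E⟩; exact mk_eq (zero_sum E)
  add_zero := by
    rintro ⟨E⟩; exact mk_eq ((setoid X).trans (sum_comm _ _) (zero_sum E))
  mul_assoc := by
    rintro ⟨E⟩ ⟨F⟩ ⟨G⟩; exact mk_eq (tensor_assoc E F G)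
  mul_comm := by
    rintro ⟨E⟩ ⟨F⟩; exact mk_eq (tensor_comm E F)
  one_mul := by
    rintro ⟨E⟩; exact mk_eq (unit_tensor E)
  mul_one := by
    rintro ⟨E⟩; exact mk_eq ((setoid X).trans (tensor_comm _ _) (unit_tensor E))
  zero_mul := by
    rintro ⟨E⟩; exact mk_eq (zero_tensor E)
  mul_zero := by
    rintro ⟨E⟩; exact mk_eq ((setoid X).trans (tensor_comm _ _) (zero_tensor E))
  right_distrib := by
    rintro ⟨E⟩ ⟨F⟩ ⟨G⟩; exact mk_eq (sum_tensor E F G)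
  left_distrib := by
    rintro ⟨E⟩ ⟨F⟩ ⟨G⟩
    exact mk_eq ((setoid X).trans (tensor_comm _ _) ((setoid X).trans (sum_tensor F G E)
      ((tensor_comm _ _).sum (tensor_comm _ _))))
  nsmul := nsmulRec

theorem mk_sum (E F : AlgVectorBundle X) : mk (E.sum F) = mk E + mk F := rfl

theorem mk_tensor (E F : AlgVectorBundle X) : mk (E.tensor F) = mk E * mk F := rfl

/-- The exterior powers of an isomorphism class. -/
noncomputable def ext (n : ℕ) : BundleClass X → BundleClass X :=
  Quotient.map (AlgVectorBundle.ext n) fun _ _ h => h.ext n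

theorem mk_pi {ι : Type} [Fintype ι] (E : ι → AlgVectorBundle X) : mk (pi E) = ∑ i, mk (E i) := by
  suffices h : ∀ (ι : Type) [Fintype ι] (E : ι → AlgVectorBundle X), mk (pi E) = ∑ i, mk (E i) from
    h ι E
  intro ι _
  refine Fintype.induction_empty_option (P := fun ι _ => ∀ E : ι → AlgVectorBundle X,
    mk (pi E) = ∑ i, mk (E i)) ?_ ?_ ?_ ι
  · intro α β _ e ih E
    have := Fintype.ofEquiv β e.symm
    rw [mk_eq (pi_equiv e E), ← e.sum_comp]
    convert ih fun i => E (e i)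
  · exact fun E => (mk_eq (pi_empty E)).trans (by simp; rfl)
  · intro α _ ih E
    rw [mk_eq (pi_option E), mk_sum, Fintype.sum_option, ih]

theorem ext_zero (a : BundleClass X) : ext 0 a = 1 := by
  obtain ⟨E⟩ := a; exact mk_eq (AlgVectorBundle.ext_zero E)

theorem ext_one (a : BundleClass X) : ext 1 a = a := by
  obtain ⟨E⟩ := a; exact mk_eq (AlgVectorBundle.ext_one E)

theorem ext_add (n : ℕ) (a b : BundleClass X) :
    ext n (a + b) = ∑ p ∈ Finset.HasAntidiagonal.antidiagonal n, ext p.1 a * ext p.2 b := by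
  obtain ⟨E⟩ := a
  obtain ⟨F⟩ := b
  rw [← Finset.sum_coe_sort]
  exact (mk_eq (ext_sum E F n)).symm.trans (mk_pi _)

end BundleClass

variable (X : Scheme.{u})

/-- The ring `K̄(X)`: the abelian group generated by the isomorphism classes of vector bundles
on `X` with relations `[M ⊕ N] = [M] + [N]`, with product `[M] * [N] = [M ⊗ N]`. -/
def Kbar : Type (u + 1) := GrothendieckRing (BundleClass X)

namespace Kbar

noncomputable instance : CommRing (Kbar X) :=
  inferInstanceAs (CommRing (GrothendieckRing (BundleClass X)))

/-- The `λ`-structure on `K̄(X)` given by the exterior powers, `λ^n [E] = [Λ^n E]`. -/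
noncomputable instance : LambdaRing (Kbar X) :=
  GrothendieckRing.lambdaRing BundleClass.ext BundleClass.ext_zero BundleClass.ext_one
    BundleClass.ext_add

variable {X}

/-- The class of a vector bundle in `K̄(X)`. -/
noncomputable def cls (E : AlgVectorBundle X) : Kbar X := GrothendieckRing.of (BundleClass.mk E)

theorem cls_sum (E F : AlgVectorBundle X) : cls (E.sum F) = cls E + cls F :=
  map_add GrothendieckRing.of (BundleClass.mk E) (BundleClass.mk F)

theorem cls_tensor (E F : AlgVectorBundle X) : cls (E.tensor F) = cls E * cls F :=
  GrothendieckRing.of_mul (BundleClass.mk E) (BundleClass.mk F)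

theorem lam_cls (n : ℕ) (E : AlgVectorBundle X) : LambdaRing.lam n (cls E) = cls (E.ext n) :=
  GrothendieckRing.lambdaRing_lam_of BundleClass.ext BundleClass.ext_zero BundleClass.ext_one
    BundleClass.ext_add n (BundleClass.mk E)

end Kbar

end Classes

end SplitK

/-! Everything rests on the plethysm identity `λ^m(λ^k x) = Q_{m,k}(λ^1 x, …, λ^{mk} x)` for the
class `x` of a bundle `E` (`lam_lam_cls`). Only direct sums give relations, so filtrations are of no
use, and honest isomorphisms of bundles have to be produced. They come from the symmetric group. All
rings of sections contain `ℚ`, so `⋀^m ⋀^k E` and each product of exterior powers of total degree `n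
= mk` is the image of an idempotent of `ℚ[S_n]` acting on `E^{⊗n}`. Split `Q_{m,k}` into its
positive and negative monomials. What is needed is that the sum of the positive ones is isomorphic
to `⋀^m ⋀^k E` plus the sum of the negative ones. An isomorphism between the corresponding sums of
left ideals of `ℚ[S_n]` is given by right multiplication by matrices over `ℚ[S_n]`
(`exists_matrices_of_idempotents`). The same matrices act on summands of `E^{⊗n}`, compatibly with
restriction, and give the isomorphism of bundles (`BundleRetract.iso_pi`).

The left ideals are isomorphic because their characters agree (`nonempty_equiv_of_modChar_eq`). The
character of the left ideal of `e` is given by the sums of `e` over conjugacy classes. These are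
determined by the trace of `diag(X_1, …, X_n)^{⊗n} ∘ e`, a symmetric function in the `X_i`
(`classSum_eq_zero`). For the idempotents at hand this trace is a product of elementary symmetric
functions, or `e_m` of the products of `k` variables, and the two sides agree by the defining
property of `Q_{m,k}` (`sum_class_eq`).

Speciality then follows formally (`isSpecial_of_generators`). The plethysm identity for `λ^2(a + b)`
contains the multiplicativity `λ_t(ab) = λ_t(a)λ_t(b)` as its middle term, and expanding `λ^k((a -
b) + b)` extends the `λ`-compatibility to differences.

Identities in `1 + tA[[t]]` are checked on formal roots: modulo a power of `t`, every series is a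
product of factors `1 + at` over an extension of `A` (`exists_hasRoots`). This makes `1 + tA[[t]]` a
commutative ring. It also shows that the `n`-th power sum of the roots is additive and
multiplicative, and that it matches the Newton polynomial of the operations `Λ^i`
(`coeff_newton_lam`). Since `Ψ^n` is the power sum of `λ_t`, it is a `λ`-homomorphism whenever `λ_t`
is one. -/

namespace SplitK

/-! ### Multisets of formal roots and universal polynomials in one family of variables. -/

section SymmetricPolynomials
open MvPolynomial

/-- The multiset of products of `k`-element submultisets. -/
def wedge {A : Type*} [CommRing A] (k : ℕ) (s : Multiset A) : Multiset A :=
  (Multiset.powersetCard k s).map Multiset.prod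

section Wedge

variable {A B : Type*} [CommRing A] [CommRing B]

theorem wedge_zero_left (s : Multiset A) : wedge 0 s = {1} := by simp [wedge]

theorem wedge_succ_zero (k : ℕ) : wedge (k + 1) (0 : Multiset A) = 0 := by
  simp [wedge, Multiset.powersetCard_zero_right]

theorem wedge_succ_cons (k : ℕ) (a : A) (s : Multiset A) :
    wedge (k + 1) (a ::ₘ s) = wedge (k + 1) s + (wedge k s).map (a * ·) := by
  simp [wedge, Multiset.powersetCard_cons, Multiset.map_map]

theorem wedge_one (s : Multiset A) : wedge 1 s = s := by
  simp [wedge, Multiset.powersetCard_one, Multiset.map_map]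

theorem wedge_map (φ : A →+* B) (k : ℕ) (s : Multiset A) :
    wedge k (s.map φ) = (wedge k s).map φ := by
  simp [wedge, Multiset.powersetCard_map, Multiset.map_map, map_multiset_prod]

theorem sum_wedge (k : ℕ) (s : Multiset A) : (wedge k s).sum = s.esymm k := rfl

theorem esymm_zero_right (s : Multiset A) : s.esymm 0 = 1 := by simp [Multiset.esymm]

theorem esymm_succ_zero (k : ℕ) : (0 : Multiset A).esymm (k + 1) = 0 := by
  simp [Multiset.esymm, Multiset.powersetCard_zero_right]

theorem sum_map_mul (a : A) (s : Multiset A) : (s.map (a * ·)).sum = a * s.sum :=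
  (map_multiset_sum (AddMonoidHom.mulLeft a) s).symm

theorem esymm_succ_cons (k : ℕ) (a : A) (s : Multiset A) :
    (a ::ₘ s).esymm (k + 1) = s.esymm (k + 1) + a * s.esymm k := by
  simp only [← sum_wedge, wedge_succ_cons, Multiset.sum_add, sum_map_mul]

theorem esymm_map (φ : A →+* B) (k : ℕ) (s : Multiset A) :
    (s.map φ).esymm k = φ (s.esymm k) := by
  rw [← sum_wedge, wedge_map, ← sum_wedge, map_multiset_sum]

theorem esymm_zero_cons (k : ℕ) (s : Multiset A) : ((0 : A) ::ₘ s).esymm k = s.esymm k := by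
  cases k with
  | zero => simp [esymm_zero_right]
  | succ k => simp [esymm_succ_cons]

theorem esymm_add_replicate_zero (k r : ℕ) (s : Multiset A) :
    (s + Multiset.replicate r 0).esymm k = s.esymm k := by
  induction r with
  | zero => simp
  | succ r ih => rw [Multiset.replicate_succ, Multiset.add_cons, esymm_zero_cons, ih]

/-- A product with a factor `0` is `0`, so padding with zero roots only creates further zeros, which
elementary symmetric functions ignore. This lets the number of variables vary. -/
theorem exists_wedge_add_replicate_zero (k r : ℕ) (s : Multiset A) :
    ∃ q, wedge k (s + Multiset.replicate r 0) = wedge k s + Multiset.replicate q 0 := by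
  induction r with
  | zero => exact ⟨0, by simp⟩
  | succ r ih =>
    obtain ⟨q, hq⟩ := ih
    cases k with
    | zero => exact ⟨0, by simp [wedge_zero_left]⟩
    | succ k =>
      refine ⟨q + (wedge k (s + Multiset.replicate r 0)).card, ?_⟩
      rw [Multiset.replicate_succ, Multiset.add_cons, wedge_succ_cons, hq, Multiset.replicate_add,
        add_assoc]
      simp

/-- The multiset of pairwise products. -/
def pairProd (s t : Multiset A) : Multiset A := (s ×ˢ t).map fun p => p.1 * p.2

theorem pairProd_zero_left (t : Multiset A) : pairProd 0 t = 0 := by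
  simp [pairProd]

theorem pairProd_cons_left (a : A) (s t : Multiset A) :
    pairProd (a ::ₘ s) t = t.map (a * ·) + pairProd s t := by
  simp [pairProd, Multiset.map_map]

theorem pairProd_zero_right (s : Multiset A) : pairProd s 0 = 0 := by
  simp [pairProd]

theorem pairProd_add_left (s s' t : Multiset A) :
    pairProd (s + s') t = pairProd s t + pairProd s' t := by
  simp [pairProd]

theorem pairProd_add_right (s t t' : Multiset A) :
    pairProd s (t + t') = pairProd s t + pairProd s t' := by
  simp [pairProd]

theorem pairProd_singleton_right (s : Multiset A) (a : A) : pairProd s {a} = s.map (a * ·) := by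
  induction s using Multiset.induction_on with
  | empty => simp [pairProd]
  | cons b s ih => rw [pairProd_cons_left, ih]; simp [mul_comm]

theorem pairProd_singleton_left (a : A) (s : Multiset A) : pairProd {a} s = s.map (a * ·) := by
  rw [← Multiset.cons_zero, pairProd_cons_left, pairProd_zero_left, add_zero]

theorem pairProd_comm (s t : Multiset A) : pairProd s t = pairProd t s := by
  induction s using Multiset.induction_on with
  | empty => simp [pairProd]
  | cons a s ih =>
    rw [pairProd_cons_left, ih, ← Multiset.singleton_add a s, pairProd_add_right,
      pairProd_singleton_right]

theorem pairProd_singleton_one (s : Multiset A) : pairProd s {1} = s := by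
  simp [pairProd_singleton_right]

theorem pairProd_map_mul_left (a : A) (s t : Multiset A) :
    pairProd (s.map (a * ·)) t = (pairProd s t).map (a * ·) := by
  induction s using Multiset.induction_on with
  | empty => simp [pairProd]
  | cons b s ih => simp [pairProd_cons_left, ih, mul_assoc]

theorem pairProd_assoc (s t u : Multiset A) :
    pairProd (pairProd s t) u = pairProd s (pairProd t u) := by
  induction s using Multiset.induction_on with
  | empty => simp [pairProd]
  | cons a s ih => rw [pairProd_cons_left, pairProd_cons_left, pairProd_add_left, ih,
      pairProd_map_mul_left]

theorem pairProd_map (φ : A →+* B) (s t : Multiset A) :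
    pairProd (s.map φ) (t.map φ) = (pairProd s t).map φ := by
  induction s using Multiset.induction_on with
  | empty => simp [pairProd]
  | cons a s ih => simp [pairProd_cons_left, ih]

theorem pairProd_replicate_zero_left (r : ℕ) (t : Multiset A) :
    pairProd (Multiset.replicate r 0) t = Multiset.replicate (r * t.card) 0 := by
  induction r with
  | zero => simp [pairProd]
  | succ r ih =>
    rw [Multiset.replicate_succ, pairProd_cons_left, ih, add_mul, one_mul, add_comm (r * _),
      Multiset.replicate_add]
    simp

theorem sum_pairProd (s t : Multiset A) : (pairProd s t).sum = s.sum * t.sum := by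
  induction s using Multiset.induction_on with
  | empty => simp [pairProd]
  | cons a s ih => simp [pairProd_cons_left, ih, add_mul, sum_map_mul]

/-- A `k`-element part of `s + t` consists of a part of `s` and a part of `t`. On the level of roots
this is the decomposition of an exterior power of a direct sum. -/
theorem wedge_add (k : ℕ) (s t : Multiset A) :
    wedge k (s + t) = ∑ p ∈ Finset.HasAntidiagonal.antidiagonal k,
      pairProd (wedge p.1 s) (wedge p.2 t) := by
  induction s using Multiset.induction_on generalizing k with
  | empty =>
    cases k with
    | zero => simp [wedge_zero_left, pairProd]
    | succ k =>
      rw [Finset.Nat.antidiagonal_succ]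
      simp [wedge_succ_zero, wedge_zero_left, pairProd_zero_left, pairProd_singleton_left]
  | cons a s ih =>
    cases k with
    | zero => simp [wedge_zero_left, pairProd]
    | succ k =>
      rw [Multiset.cons_add, wedge_succ_cons, ih, ih, Finset.Nat.antidiagonal_succ]
      simp only [Finset.sum_cons, Finset.sum_map, Function.Embedding.prodMap,
        Function.Embedding.coeFn_mk, Prod.map, Function.Embedding.refl_apply,
        Nat.succ_eq_add_one, wedge_succ_cons, pairProd_add_left, Finset.sum_add_distrib,
        wedge_zero_left, pairProd_map_mul_left, add_assoc]
      congr 2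
      exact map_sum (Multiset.mapAddMonoidHom (a * ·)) _ _

end Wedge

/-! ### Weighted homogeneity and reduction of symmetric identities to few variables. -/

section Homogeneous

variable {R σ τ : Type*} [CommRing R]

theorem isWeightedHomogeneous_aeval {w : σ → ℕ} {w' : τ → ℕ} {h : τ → MvPolynomial σ R}
    (hh : ∀ j, IsWeightedHomogeneous w (h j) (w' j)) {P : MvPolynomial τ R} {d : ℕ}
    (hP : IsWeightedHomogeneous w' P d) : IsWeightedHomogeneous w (aeval h P) d := by
  rw [aeval_def, eval₂_eq]
  refine IsWeightedHomogeneous.sum _ _ _ fun m hm => ?_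
  have h1 : IsWeightedHomogeneous w (∏ i ∈ m.support, h i ^ m i) (∑ i ∈ m.support, m i • w' i) :=
    IsWeightedHomogeneous.prod _ _ _ fun i _ => (hh i).pow (m i)
  have h2 : ∑ i ∈ m.support, m i • w' i = d := by
    rw [← hP (mem_support_iff.1 hm), Finsupp.weight_apply, Finsupp.sum]
  rw [h2] at h1
  exact h1.C_mul _

theorem weightedHomogeneousComponent_aeval {w : σ → ℕ} {w' : τ → ℕ} {h : τ → MvPolynomial σ R}
    (hh : ∀ j, IsWeightedHomogeneous w (h j) (w' j)) (P : MvPolynomial τ R) (d : ℕ) :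
    weightedHomogeneousComponent w d (aeval h P) =
      aeval h (weightedHomogeneousComponent w' d P) := by
  induction P using MvPolynomial.induction_on' with
  | add p q hp hq => simp only [map_add, hp, hq]
  | monomial m c =>
    have h1 : IsWeightedHomogeneous w' (monomial m c) (Finsupp.weight w' m) :=
      isWeightedHomogeneous_monomial _ _ _ rfl
    have h2 := isWeightedHomogeneous_aeval hh h1
    by_cases hd : Finsupp.weight w' m = d
    · subst hd
      rw [h1.weightedHomogeneousComponent_same, h2.weightedHomogeneousComponent_same]
    · rw [h1.weightedHomogeneousComponent_ne _ (Ne.symm hd), h2.weightedHomogeneousComponent_ne _ (Ne.symm hd),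
        map_zero]

/-- Substituting homogeneous polynomials commutes with taking weighted components, so by injectivity
`P` equals its own component. It serves to give the variable standing for `e_i` the weight `i` in
the universal polynomials. -/
theorem isWeightedHomogeneous_of_aeval {w : σ → ℕ} {w' : τ → ℕ} {h : τ → MvPolynomial σ R}
    (hh : ∀ j, IsWeightedHomogeneous w (h j) (w' j)) (inj : Function.Injective (aeval (R := R) h))
    {P : MvPolynomial τ R} {d : ℕ} (hP : IsWeightedHomogeneous w (aeval h P) d) :
    IsWeightedHomogeneous w' P d := by
  have h1 := weightedHomogeneousComponent_aeval hh P d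
  rw [hP.weightedHomogeneousComponent_same] at h1
  rw [inj h1]
  exact weightedHomogeneousComponent_isWeightedHomogeneous d P

theorem isWeightedHomogeneous_multiset_prod {w : σ → ℕ} {c : ℕ} (s : Multiset (MvPolynomial σ R))
    (hs : ∀ p ∈ s, IsWeightedHomogeneous w p c) :
    IsWeightedHomogeneous w s.prod (s.card * c) := by
  induction s using Multiset.induction_on with
  | empty => simpa using isWeightedHomogeneous_one R w
  | cons a s ih =>
    rw [Multiset.prod_cons, Multiset.card_cons, add_mul, one_mul, add_comm]
    exact (hs a (Multiset.mem_cons_self a s)).mul (ih fun p hp => hs p (Multiset.mem_cons_of_mem hp))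

theorem isWeightedHomogeneous_multiset_sum {w : σ → ℕ} {c : ℕ} (s : Multiset (MvPolynomial σ R))
    (hs : ∀ p ∈ s, IsWeightedHomogeneous w p c) : IsWeightedHomogeneous w s.sum c := by
  induction s using Multiset.induction_on with
  | empty => simpa using isWeightedHomogeneous_zero R w c
  | cons a s ih =>
    rw [Multiset.sum_cons]
    exact (hs a (Multiset.mem_cons_self a s)).add (ih fun p hp => hs p (Multiset.mem_cons_of_mem hp))

theorem isWeightedHomogeneous_of_mem_wedge {w : σ → ℕ} {c k : ℕ}
    {s : Multiset (MvPolynomial σ R)} (hs : ∀ p ∈ s, IsWeightedHomogeneous w p c) :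
    ∀ p ∈ wedge k s, IsWeightedHomogeneous w p (k * c) := by
  intro p hp
  obtain ⟨u, hu, rfl⟩ := Multiset.mem_map.1 hp
  obtain rfl := (Multiset.mem_powersetCard.1 hu).2
  exact isWeightedHomogeneous_multiset_prod u fun p hp => hs p (Multiset.mem_of_le (Multiset.mem_powersetCard.1 hu).1 hp)

theorem isWeightedHomogeneous_esymm {w : σ → ℕ} {c k : ℕ} {s : Multiset (MvPolynomial σ R)}
    (hs : ∀ p ∈ s, IsWeightedHomogeneous w p c) : IsWeightedHomogeneous w (s.esymm k) (k * c) :=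
  isWeightedHomogeneous_multiset_sum _ (isWeightedHomogeneous_of_mem_wedge hs)

/-- Every variable of positive weight in a monomial contributes at least `1` to its degree.
Variables of weight `0` are left out of the count so that two families of variables can be treated
one at a time. -/
theorem card_filter_support_le {w : σ → ℕ} {D : MvPolynomial σ R} {d : ℕ}
    (hD : IsWeightedHomogeneous w D d) {m : σ →₀ ℕ} (hm : m ∈ D.support) :
    (m.support.filter fun i => w i ≠ 0).card ≤ d := by
  rw [← hD (mem_support_iff.1 hm), Finsupp.weight_apply, Finsupp.sum, Finset.card_eq_sum_ones]
  refine (Finset.sum_le_sum fun i hi => ?_).trans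
    (Finset.sum_le_sum_of_subset (Finset.filter_subset _ _))
  rw [Finset.mem_filter, Finsupp.mem_support_iff] at hi
  exact Nat.one_le_iff_ne_zero.2 (mul_ne_zero hi.1 hi.2)

/-- Killing the variables outside the range of `j` removes the monomials that involve them and
leaves the others untouched. -/
theorem coeff_aeval_retract {σ' : Type*} {j : σ' → σ} (hj : Function.Injective j)
    {q : σ → MvPolynomial σ' R} (hq : ∀ i, q (j i) = X i) (hq' : ∀ i ∉ Set.range j, q i = 0)
    (D : MvPolynomial σ R) (t : σ' →₀ ℕ) :
    coeff t (aeval q D) = coeff (t.mapDomain j) D := by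
  classical
  induction D using MvPolynomial.induction_on' with
  | add p q hp hq => simp only [map_add, coeff_add, hp, hq]
  | monomial m c =>
    by_cases hm : ∀ i ∈ m.support, i ∈ Set.range j
    · obtain ⟨m, rfl⟩ : ∃ m' : σ' →₀ ℕ, m'.mapDomain j = m :=
        ⟨m.comapDomain j hj.injOn, Finsupp.mapDomain_comapDomain j hj m fun i hi => hm i hi⟩
      rw [← rename_monomial, aeval_rename, coeff_rename_mapDomain j hj]
      have : (q ∘ j) = X := funext hq
      rw [this, aeval_X_left_apply]
    · push Not at hm
      obtain ⟨i, hi, hi'⟩ := hm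
      rw [aeval_monomial, Finsupp.prod, Finset.prod_eq_zero hi, mul_zero, coeff_zero,
        coeff_monomial, if_neg]
      · rintro rfl
        exact hi' (by
          have := Finsupp.mapDomain_support hi
          obtain ⟨a, -, ha⟩ := Finset.mem_image.1 this
          exact ⟨a, ha⟩)
      · rw [hq' i hi', zero_pow (Finsupp.mem_support_iff.1 hi)]

/-- A polynomial vanishes if it vanishes after killing the variables outside `j`, and each of its
monomials is moved into the range of `j` by a symmetry of the polynomial. -/
theorem eq_zero_of_retract {σ' : Type*} {j : σ' → σ} (hj : Function.Injective j)
    {q : σ → MvPolynomial σ' R} (hq : ∀ i, q (j i) = X i) (hq' : ∀ i ∉ Set.range j, q i = 0)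
    {D : MvPolynomial σ R} (hD : aeval q D = 0)
    (h : ∀ m ∈ D.support, ∃ e : Equiv.Perm σ, rename e D = D ∧
      ∀ i ∈ m.support, e i ∈ Set.range j) : D = 0 := by
  classical
  by_contra h0
  obtain ⟨m, hm⟩ := (support_nonempty (p := D)).2 h0
  obtain ⟨e, he, hm'⟩ := h m hm
  have h1 : coeff (m.mapDomain e) D ≠ 0 := by
    rw [← he, coeff_rename_mapDomain e e.injective]
    exact mem_support_iff.1 hm
  obtain ⟨t, ht⟩ : ∃ t : σ' →₀ ℕ, t.mapDomain j = m.mapDomain e := by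
    refine ⟨(m.mapDomain e).comapDomain j hj.injOn,
      Finsupp.mapDomain_comapDomain j hj _ fun i hi => ?_⟩
    obtain ⟨a, ha, rfl⟩ := Finset.mem_image.1 (Finsupp.mapDomain_support hi)
    exact hm' a ha
  rw [← ht, ← coeff_aeval_retract hj hq hq', hD, coeff_zero] at h1
  exact h1 rfl

/-- Enlarge `s` to exactly `n` elements; a bijection from this set to the first block extends to a
permutation of the whole finite type. -/
theorem exists_perm_sum {n N : ℕ} (s : Finset (Fin n ⊕ Fin N)) (hs : s.card ≤ n) :
    ∃ e : Equiv.Perm (Fin n ⊕ Fin N), ∀ i ∈ s, e i ∈ Set.range (Sum.inl : Fin n → Fin n ⊕ Fin N) := by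
  classical
  obtain ⟨u, hsu, hu⟩ := Finset.exists_superset_card_eq hs (by simp)
  have hc : Fintype.card {x // x ∈ u} =
      Fintype.card {x // x ∈ Set.range (Sum.inl : Fin n → Fin n ⊕ Fin N)} := by
    rw [Fintype.card_coe, hu]
    exact (Fintype.card_fin n).symm.trans
      (Fintype.card_congr (Equiv.ofInjective _ Sum.inl_injective))
  let e := Fintype.equivOfCardEq hc
  refine ⟨e.extendSubtype, fun i hi => ?_⟩
  rw [e.extendSubtype_apply_of_mem i (hsu hi)]
  exact (e ⟨i, hsu hi⟩).2

/-- A monomial of degree `n` involves at most `n` variables, so symmetry moves it into the first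
`n`, where the vanishing is assumed. -/
theorem eq_zero_of_symmetric {n N : ℕ} {D : MvPolynomial (Fin n ⊕ Fin N) R} (hD : D.IsSymmetric)
    (hd : IsWeightedHomogeneous 1 D n)
    (h : aeval (Sum.elim X 0 : Fin n ⊕ Fin N → MvPolynomial (Fin n) R) D = 0) : D = 0 := by
  refine eq_zero_of_retract Sum.inl_injective (fun _ => rfl) ?_ h fun m hm => ?_
  · rintro (i | i) hi
    · exact (hi ⟨i, rfl⟩).elim
    · rfl
  · obtain ⟨e, he⟩ := exists_perm_sum m.support (by simpa using card_filter_support_le hd hm)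
    exact ⟨e, hD e, he⟩

/-- The variables of `R[X₁, …, Xₙ]` as a multiset. -/
noncomputable def vars (R σ : Type*) [CommRing R] [Fintype σ] : Multiset (MvPolynomial σ R) :=
  Finset.univ.val.map X

theorem isWeightedHomogeneous_of_mem_vars [Fintype σ] :
    ∀ p ∈ vars R σ, IsWeightedHomogeneous 1 p 1 := by
  intro p hp
  obtain ⟨i, -, rfl⟩ := Multiset.mem_map.1 hp
  exact isWeightedHomogeneous_X R 1 i

theorem vars_map_rename [Fintype σ] (e : Equiv.Perm σ) :
    (vars R σ).map (rename e : MvPolynomial σ R →ₐ[R] MvPolynomial σ R) = vars R σ := by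
  classical
  rw [vars, Multiset.map_map]
  have : (rename e : MvPolynomial σ R →ₐ[R] MvPolynomial σ R) ∘ (X : σ → MvPolynomial σ R) =
    X ∘ e := by ext1 i; simp
  rw [this, ← Multiset.map_map]
  congr 1
  exact congrArg Finset.val (Finset.map_univ_equiv e)

theorem vars_map_aeval [Fintype σ] {A : Type*} [CommRing A] [Algebra R A] (a : σ → A) :
    (vars R σ).map (aeval a : MvPolynomial σ R →ₐ[R] A) = Finset.univ.val.map a := by
  simp [vars, Multiset.map_map]

theorem vars_map_elim {n N : ℕ} :
    (vars R (Fin n ⊕ Fin N)).map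
      (aeval (Sum.elim X 0 : Fin n ⊕ Fin N → MvPolynomial (Fin n) R)) =
    vars R (Fin n) + Multiset.replicate N 0 := by
  rw [vars_map_aeval, ← Finset.univ_disjSum_univ]
  have h2 : (Finset.univ : Finset (Fin N)).val.map (fun _ => (0 : MvPolynomial (Fin n) R)) =
      Multiset.replicate N 0 := by simp
  simp only [Finset.disjSum, Multiset.disjSum, Multiset.map_add, Multiset.map_map]
  exact congrArg₂ (· + ·) rfl h2

end Homogeneous

theorem esymm_fin_eq (R : Type*) [CommRing R] (n k : ℕ) :
    esymm (Fin n) R k = (vars R (Fin n)).esymm k := by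
  rw [esymm_eq_multiset_esymm]; rfl

theorem aeval_esymm_injective (n : ℕ) : Function.Injective
    (aeval (R := ℤ) fun i : Fin n => esymm (Fin n) ℤ (i + 1)) := fun P Q h =>
  esymmAlgHom_injective ℤ (σ := Fin n) (n := n) (by simp)
    (Subtype.ext (by rw [esymmAlgHom_apply, esymmAlgHom_apply]; exact h))

/-- An identity between a polynomial in the elementary symmetric functions and a natural
symmetric function, homogeneous of degree `n`, holds in any number of variables if it
holds in `n` variables. -/
theorem aeval_esymm_eq_of_spec {n : ℕ} {P : MvPolynomial (Fin n) ℤ}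
    (G : ∀ {N : ℕ}, Multiset (MvPolynomial (Fin n ⊕ Fin N) ℤ) → MvPolynomial (Fin n ⊕ Fin N) ℤ)
    (G₀ : Multiset (MvPolynomial (Fin n) ℤ) → MvPolynomial (Fin n) ℤ)
    (hP : aeval (fun i : Fin n => esymm (Fin n) ℤ (i + 1)) P = G₀ (vars ℤ (Fin n)))
    (hG₀ : IsWeightedHomogeneous 1 (G₀ (vars ℤ (Fin n))) n)
    (hG : ∀ N, IsWeightedHomogeneous 1 (G (vars ℤ (Fin n ⊕ Fin N))) n)
    (hsymm : ∀ {N : ℕ} (φ : MvPolynomial (Fin n ⊕ Fin N) ℤ →+* MvPolynomial (Fin n ⊕ Fin N) ℤ) s,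
      φ (G s) = G (s.map φ))
    (hkill : ∀ {N : ℕ} (φ : MvPolynomial (Fin n ⊕ Fin N) ℤ →+* MvPolynomial (Fin n) ℤ) s,
      φ (G s) = G₀ (s.map φ))
    (hzero : ∀ r s, G₀ (s + Multiset.replicate r 0) = G₀ s) (N : ℕ) :
    aeval (fun i : Fin n => (vars ℤ (Fin n ⊕ Fin N)).esymm (i + 1)) P =
      G (vars ℤ (Fin n ⊕ Fin N)) := by
  -- Homogeneity of `P` is inherited from its value in `n` variables, because the elementary
  -- symmetric polynomials there are algebraically independent.
  have hw : IsWeightedHomogeneous (fun i : Fin n => (i : ℕ) + 1) P n := by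
    refine isWeightedHomogeneous_of_aeval (w := 1) (fun i => ?_) (aeval_esymm_injective n)
      (hP ▸ hG₀)
    have := isWeightedHomogeneous_esymm (k := i + 1)
      (isWeightedHomogeneous_of_mem_vars (R := ℤ) (σ := Fin n))
    rwa [mul_one, ← esymm_fin_eq] at this
  rw [← sub_eq_zero]
  have hA : ∀ {B : Type} [CommRing B] [Algebra ℤ B] (φ : MvPolynomial (Fin n ⊕ Fin N) ℤ →ₐ[ℤ] B),
      φ (aeval (fun i : Fin n => (vars ℤ (Fin n ⊕ Fin N)).esymm (i + 1)) P) =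
        aeval (fun i : Fin n => ((vars ℤ (Fin n ⊕ Fin N)).map φ).esymm (i + 1)) P := by
    intro B _ _ φ
    rw [← AlgHom.comp_apply, comp_aeval]
    congr 2
    ext i
    exact (esymm_map φ.toRingHom _ _).symm
  -- The difference of the two sides is symmetric and homogeneous of degree `n`, and it vanishes
  -- when the `N` extra variables are killed.
  refine eq_zero_of_symmetric (fun e => ?_) ?_ ?_
  · rw [map_sub, hA, vars_map_rename]
    congr 1
    have := hsymm (rename e : MvPolynomial (Fin n ⊕ Fin N) ℤ →ₐ[ℤ] _).toRingHom
      (vars ℤ (Fin n ⊕ Fin N))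
    refine this.trans (congrArg G ?_)
    exact vars_map_rename e
  · refine IsWeightedHomogeneous.sub (isWeightedHomogeneous_aeval (fun i => ?_) hw) (hG N)
    simpa using isWeightedHomogeneous_esymm (k := i + 1)
      (isWeightedHomogeneous_of_mem_vars (R := ℤ) (σ := Fin n ⊕ Fin N))
  · rw [map_sub, hA, vars_map_elim]
    have := hkill (aeval (R := ℤ) (Sum.elim X 0 : Fin n ⊕ Fin N → MvPolynomial (Fin n) ℤ)).toRingHom
      (vars ℤ (Fin n ⊕ Fin N))
    have h2 : (vars ℤ (Fin n ⊕ Fin N)).map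
      (aeval (R := ℤ) (Sum.elim X 0 : Fin n ⊕ Fin N → MvPolynomial (Fin n) ℤ)).toRingHom =
      vars ℤ (Fin n) + Multiset.replicate N 0 := vars_map_elim
    rw [h2, hzero, ← hP] at this
    rw [sub_eq_zero]
    refine Eq.trans ?_ this.symm
    simp only [esymm_add_replicate_zero, esymm_fin_eq]

/-- Identities proved for the variables indexed by `Fin n ⊕ Fin N` specialise to an arbitrary
multiset once it is padded; with `z = 0` the padding is harmless. -/
theorem exists_fin_sum_map {A : Type*} (s : Multiset A) (n : ℕ) (z : A) :
    ∃ (N : ℕ) (a : Fin n ⊕ Fin N → A),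
      Finset.univ.val.map a = s + Multiset.replicate n z := by
  obtain ⟨l, rfl⟩ := Quotient.exists_rep s
  refine ⟨l.length, Sum.elim (fun _ => z) l.get, ?_⟩
  rw [← Finset.univ_disjSum_univ]
  have h1 : (Finset.univ : Finset (Fin l.length)).val.map l.get = (l : Multiset A) := by
    rw [Fin.univ_def]
    simp
  have h2 : (Finset.univ : Finset (Fin n)).val.map (fun _ => z) = Multiset.replicate n z := by
    simp
  simp only [Finset.disjSum, Multiset.disjSum, Multiset.map_add, Multiset.map_map]
  rw [add_comm]
  exact congrArg₂ (· + ·) h1 h2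

theorem coeff_prod_one_add {A ι : Type*} [CommRing A] (s : Finset ι) (f : ι → A) (n : ℕ) :
    (∏ i ∈ s, (1 + Polynomial.X * Polynomial.C (f i))).coeff n = (s.val.map f).esymm n := by
  classical
  induction s using Finset.induction_on generalizing n with
  | empty => cases n with
    | zero => simp [esymm_zero_right]
    | succ n => simp [esymm_succ_zero, Polynomial.coeff_one]
  | insert a s ha ih =>
    rw [Finset.prod_insert ha, Finset.insert_val_of_notMem ha, Multiset.map_cons, add_mul, one_mul,
      Polynomial.coeff_add, ih, mul_assoc]
    cases n with
    | zero => simp [esymm_zero_right]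
    | succ n => rw [Polynomial.coeff_X_mul, Polynomial.coeff_C_mul, ih, esymm_succ_cons]

theorem subsetCoeff_eq (m k : ℕ) :
    subsetCoeff m k = (wedge k (vars ℤ (Fin (m * k)))).esymm m := by
  rw [subsetCoeff, coeff_prod_one_add, vars, wedge, Multiset.powersetCard_map,
    ← Finset.map_val_val_powersetCard, Multiset.map_map, Multiset.map_map]
  rfl

/-- The defining property of `lamPoly` concerns exactly `m * k` variables. Since both sides are
homogeneous of degree `m * k` and insensitive to zero roots, it holds for any number of variables,
and then for any roots by specialisation. -/
theorem aeval_lamPoly {A : Type*} [CommRing A] (m k : ℕ) (s : Multiset A) :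
    aeval (fun i : Fin (m * k) => s.esymm (i + 1)) (lamPoly m k) = (wedge k s).esymm m := by
  obtain ⟨N, a, ha⟩ := exists_fin_sum_map s (m * k) 0
  have h0 : ∀ {B : Type} [CommRing B] (r : ℕ) (s : Multiset B),
      (wedge k (s + Multiset.replicate r 0)).esymm m = (wedge k s).esymm m := by
    intro B _ r s
    obtain ⟨q, hq⟩ := exists_wedge_add_replicate_zero k r s
    rw [hq, esymm_add_replicate_zero]
  have key := aeval_esymm_eq_of_spec (P := lamPoly m k) (fun {N} s => (wedge k s).esymm m)
    (fun s => (wedge k s).esymm m) (by rw [lamPoly_spec, subsetCoeff_eq])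
    (by simpa using isWeightedHomogeneous_esymm (isWeightedHomogeneous_of_mem_wedge (k := k)
      (isWeightedHomogeneous_of_mem_vars (R := ℤ))) (k := m))
    (fun N => by simpa using isWeightedHomogeneous_esymm (isWeightedHomogeneous_of_mem_wedge (k := k)
      (isWeightedHomogeneous_of_mem_vars (R := ℤ))) (k := m))
    (fun φ s => by rw [← esymm_map, wedge_map]) (fun φ s => by rw [← esymm_map, wedge_map])
    h0 N
  have key2 := congrArg (aeval (R := ℤ) a) key
  rw [← AlgHom.comp_apply, comp_aeval] at key2
  have h1 := vars_map_aeval (R := ℤ) a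
  have h2 : ∀ i, (aeval (R := ℤ) a) ((vars ℤ (Fin (m * k) ⊕ Fin N)).esymm i) = s.esymm i := by
    intro i
    refine (esymm_map (aeval (R := ℤ) a).toRingHom _ _).symm.trans ?_
    rw [← esymm_add_replicate_zero i (m * k) s, ← ha, ← h1]
    rfl
  have h3 : (aeval (R := ℤ) a) ((wedge k (vars ℤ (Fin (m * k) ⊕ Fin N))).esymm m) =
      (wedge k s).esymm m := by
    refine (esymm_map (aeval (R := ℤ) a).toRingHom _ _).symm.trans ?_
    rw [← wedge_map]
    obtain ⟨q, hq⟩ := exists_wedge_add_replicate_zero k (m * k) s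
    rw [← esymm_add_replicate_zero m q (wedge k s), ← hq, ← ha, ← h1]
    rfl
  simp only [h2, h3] at key2
  exact key2

/-- The reduction is the one used for `aeval_lamPoly`. The case `n = 0` is excluded because zero
roots do change the zeroth power sum. -/
theorem aeval_newtonPoly {A : Type*} [CommRing A] {n : ℕ} (hn : n ≠ 0) (s : Multiset A) :
    aeval (fun i : Fin n => s.esymm (i + 1)) (newtonPoly n) = (s.map (· ^ n)).sum := by
  obtain ⟨N, a, ha⟩ := exists_fin_sum_map s n 0
  have hom : ∀ {σ : Type} [Fintype σ],
      IsWeightedHomogeneous 1 ((vars ℤ σ).map (· ^ n)).sum n := fun {σ} _ => by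
    refine isWeightedHomogeneous_multiset_sum _ fun p hp => ?_
    obtain ⟨q, hq, rfl⟩ := Multiset.mem_map.1 hp
    simpa using (isWeightedHomogeneous_of_mem_vars q hq).pow n
  have nat : ∀ {B C : Type} [CommRing B] [CommRing C] (φ : B →+* C) (s : Multiset B),
      φ (s.map (· ^ n)).sum = ((s.map φ).map (· ^ n)).sum := by
    intro B C _ _ φ s
    rw [map_multiset_sum, Multiset.map_map, Multiset.map_map]
    simp
  have key := aeval_esymm_eq_of_spec (P := newtonPoly n) (fun {N} s => (s.map (· ^ n)).sum)
    (fun s => (s.map (· ^ n)).sum) (by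
      rw [newtonPoly_spec, psum, vars, Multiset.map_map]; rfl) hom (fun N => hom)
    nat nat (fun r s => by simp [hn]) N
  have key2 := congrArg (aeval (R := ℤ) a) key
  rw [← AlgHom.comp_apply, comp_aeval] at key2
  have h1 := vars_map_aeval (R := ℤ) a
  have h2 : ∀ i, (aeval (R := ℤ) a) ((vars ℤ (Fin n ⊕ Fin N)).esymm i) = s.esymm i := by
    intro i
    refine (esymm_map (aeval (R := ℤ) a).toRingHom _ _).symm.trans ?_
    rw [← esymm_add_replicate_zero i n s, ← ha, ← h1]
    rfl
  have h3 : (aeval (R := ℤ) a) ((vars ℤ (Fin n ⊕ Fin N)).map (· ^ n)).sum =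
      (s.map (· ^ n)).sum := by
    have h4 : (s.map (· ^ n)).sum = ((s + Multiset.replicate n 0).map (· ^ n)).sum := by simp [hn]
    rw [h4, ← ha, ← h1, map_multiset_sum, Multiset.map_map, Multiset.map_map]
    simp
  simp only [h2, h3] at key2
  exact key2

end SymmetricPolynomials

/-! ### The universal product polynomials in two families of variables. -/

section ProductPolynomials
open MvPolynomial

/-- The first family of variables, as a multiset. -/
noncomputable def varsInl (α β : Type*) [Fintype α] : Multiset (MvPolynomial (α ⊕ β) ℤ) :=
  Finset.univ.val.map fun i => X (Sum.inl i)

/-- The second family of variables, as a multiset. -/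
noncomputable def varsInr (α β : Type*) [Fintype β] : Multiset (MvPolynomial (α ⊕ β) ℤ) :=
  Finset.univ.val.map fun i => X (Sum.inr i)

section

variable {α β : Type*} {w : α ⊕ β → ℕ} {c d : ℕ}

theorem isWeightedHomogeneous_of_mem_varsInl [Fintype α] (hw : ∀ i, w (Sum.inl i) = c) :
    ∀ p ∈ varsInl α β, IsWeightedHomogeneous w p c := by
  intro p hp
  obtain ⟨i, -, rfl⟩ := Multiset.mem_map.1 hp
  exact hw i ▸ isWeightedHomogeneous_X ℤ w _

theorem isWeightedHomogeneous_of_mem_varsInr [Fintype β] (hw : ∀ i, w (Sum.inr i) = c) :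
    ∀ p ∈ varsInr α β, IsWeightedHomogeneous w p c := by
  intro p hp
  obtain ⟨i, -, rfl⟩ := Multiset.mem_map.1 hp
  exact hw i ▸ isWeightedHomogeneous_X ℤ w _

theorem isWeightedHomogeneous_pairProd [Fintype α] [Fintype β] (hw : ∀ i, w (Sum.inl i) = c)
    (hw' : ∀ i, w (Sum.inr i) = d) (h1 : c + d = 1) (n : ℕ) :
    IsWeightedHomogeneous w ((pairProd (varsInl α β) (varsInr α β)).esymm n) n := by
  have := isWeightedHomogeneous_esymm (w := w) (c := 1) (k := n)
    (s := pairProd (varsInl α β) (varsInr α β)) (fun p hp => by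
      obtain ⟨⟨a, b⟩, hab, rfl⟩ := Multiset.mem_map.1 hp
      rw [Multiset.mem_product] at hab
      exact h1 ▸ (isWeightedHomogeneous_of_mem_varsInl hw a hab.1).mul
        (isWeightedHomogeneous_of_mem_varsInr hw' b hab.2))
  rwa [mul_one] at this

theorem varsInl_map [Fintype α] {A : Type*} [CommRing A] [Algebra ℤ A] (a : α ⊕ β → A) :
    (varsInl α β).map (aeval (R := ℤ) a) = Finset.univ.val.map fun i => a (Sum.inl i) := by
  simp [varsInl, Multiset.map_map]

theorem varsInr_map [Fintype β] {A : Type*} [CommRing A] [Algebra ℤ A] (a : α ⊕ β → A) :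
    (varsInr α β).map (aeval (R := ℤ) a) = Finset.univ.val.map fun i => a (Sum.inr i) := by
  simp [varsInr, Multiset.map_map]

end

theorem esymm₂_eq (n : ℕ) : esymm₂ n =
    Sum.elim (fun i : Fin n => (varsInl (Fin n) (Fin n)).esymm (i + 1))
      (fun j : Fin n => (varsInr (Fin n) (Fin n)).esymm (j + 1)) := by
  funext x
  rcases x with i | i
  · simp only [esymm₂, Sum.elim_inl, esymm_fin_eq]
    refine (esymm_map (rename Sum.inl : _ →ₐ[ℤ] _).toRingHom _ _).symm.trans ?_
    rw [vars, Multiset.map_map]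
    exact congrArg (fun u => Multiset.esymm u _) (Multiset.map_congr rfl fun j _ => rename_X _ _)
  · simp only [esymm₂, Sum.elim_inr, esymm_fin_eq]
    refine (esymm_map (rename Sum.inr : _ →ₐ[ℤ] _).toRingHom _ _).symm.trans ?_
    rw [vars, Multiset.map_map]
    exact congrArg (fun u => Multiset.esymm u _) (Multiset.map_congr rfl fun j _ => rename_X _ _)

/-- Adding an element of the kernel to `mulPoly n` would give a second solution of the equation that
characterises it. -/
theorem aeval_esymm₂_injective (n : ℕ) : Function.Injective (aeval (R := ℤ) (esymm₂ n)) := by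
  intro P Q h
  have := (existsUnique_mulPoly n).unique (y₁ := mulPoly n + (P - Q)) (y₂ := mulPoly n)
    (by rw [map_add, map_sub, h, sub_self, add_zero, mulPoly_spec]) (mulPoly_spec n)
  rwa [add_eq_left, sub_eq_zero] at this

theorem productCoeff_eq (n : ℕ) :
    productCoeff n = (pairProd (varsInl (Fin n) (Fin n)) (varsInr (Fin n) (Fin n))).esymm n := by
  rw [productCoeff, ← Fintype.prod_prod_type', coeff_prod_one_add, pairProd, varsInl, varsInr,
    ← Finset.univ_product_univ, Finset.product_val]
  congr 1
  generalize (Finset.univ : Finset (Fin n)).val = s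
  suffices h : ∀ t u : Multiset (Fin n), Multiset.map (fun i : Fin n × Fin n =>
      X (R := ℤ) (Sum.inl i.1 : Fin n ⊕ Fin n) * X (Sum.inr i.2)) (t ×ˢ u) =
      Multiset.map (fun p => p.1 * p.2) (Multiset.map (fun i => X (R := ℤ) (Sum.inl i)) t ×ˢ
        Multiset.map (fun i => X (Sum.inr i)) u) from h s s
  intro t u
  induction t using Multiset.induction_on with
  | empty => simp
  | cons a t ih => simp [Multiset.map_map, ih]

/-- The two cases `(c, d) = (1, 0)` and `(0, 1)` say together that the polynomial has degree `n` in
each family of variables separately. -/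
theorem isWeightedHomogeneous_mulPoly {n : ℕ} {c d : ℕ} (h1 : c + d = 1) :
    IsWeightedHomogeneous (Sum.elim (fun i : Fin n => (i + 1) * c) fun j : Fin n => (j + 1) * d)
      (mulPoly n) n := by
  refine isWeightedHomogeneous_of_aeval (w := Sum.elim (fun _ => c) fun _ => d) (fun x => ?_)
    (aeval_esymm₂_injective n) ?_
  · rw [esymm₂_eq]
    rcases x with i | i
    · exact isWeightedHomogeneous_esymm (isWeightedHomogeneous_of_mem_varsInl fun _ => rfl)
    · exact isWeightedHomogeneous_esymm (isWeightedHomogeneous_of_mem_varsInr fun _ => rfl)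
  · rw [mulPoly_spec, productCoeff_eq]
    exact isWeightedHomogeneous_pairProd (fun _ => rfl) (fun _ => rfl) h1 n

/-- `P_n(e(a), e(b))` for two families of variables. -/
noncomputable def mulPolyVars (n : ℕ) (α β : Type*) [Fintype α] [Fintype β] :
    MvPolynomial (α ⊕ β) ℤ :=
  aeval (Sum.elim (fun i : Fin n => (varsInl α β).esymm (i + 1))
      (fun j : Fin n => (varsInr α β).esymm (j + 1))) (mulPoly n)

theorem isWeightedHomogeneous_mulPolyVars {n c d : ℕ} (h1 : c + d = 1) (α β : Type*) [Fintype α]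
    [Fintype β] : IsWeightedHomogeneous (Sum.elim (fun _ => c) fun _ => d)
      (mulPolyVars n α β - (pairProd (varsInl α β) (varsInr α β)).esymm n) n := by
  refine IsWeightedHomogeneous.sub (isWeightedHomogeneous_aeval (fun x => ?_)
    (isWeightedHomogeneous_mulPoly h1))
    (isWeightedHomogeneous_pairProd (fun _ => rfl) (fun _ => rfl) h1 n)
  rcases x with i | i
  · exact isWeightedHomogeneous_esymm (isWeightedHomogeneous_of_mem_varsInl fun _ => rfl)
  · exact isWeightedHomogeneous_esymm (isWeightedHomogeneous_of_mem_varsInr fun _ => rfl)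

theorem aeval_mulPolyVars {n : ℕ} {α β A : Type*} [Fintype α] [Fintype β] [CommRing A]
    [Algebra ℤ A] (a : α ⊕ β → A) :
    aeval a (mulPolyVars n α β) =
      aeval (Sum.elim (fun i : Fin n => (Finset.univ.val.map fun i => a (Sum.inl i)).esymm (i + 1))
        (fun j : Fin n => (Finset.univ.val.map fun i => a (Sum.inr i)).esymm (j + 1)))
        (mulPoly n) := by
  rw [mulPolyVars, ← AlgHom.comp_apply, comp_aeval]
  congr 2
  funext x
  rcases x with i | i
  · simp only [Sum.elim_inl, ← varsInl_map]
    exact (esymm_map (aeval (R := ℤ) a).toRingHom _ _).symm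
  · simp only [Sum.elim_inr, ← varsInr_map]
    exact (esymm_map (aeval (R := ℤ) a).toRingHom _ _).symm

theorem aeval_esymm_pairProd_vars {n : ℕ} {α β A : Type*} [Fintype α] [Fintype β] [CommRing A]
    [Algebra ℤ A] (a : α ⊕ β → A) :
    aeval (R := ℤ) a ((pairProd (varsInl α β) (varsInr α β)).esymm n) =
      (pairProd (Finset.univ.val.map fun i => a (Sum.inl i))
        (Finset.univ.val.map fun i => a (Sum.inr i))).esymm n := by
  refine (esymm_map (aeval (R := ℤ) a).toRingHom _ _).symm.trans ?_
  rw [← pairProd_map, ← varsInl_map, ← varsInr_map]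
  rfl

theorem pairProd_add_replicate_zero {A : Type*} [CommRing A] (n r q : ℕ) (s t : Multiset A) :
    (pairProd (s + Multiset.replicate r 0) (t + Multiset.replicate q 0)).esymm n =
      (pairProd s t).esymm n := by
  rw [pairProd_add_left, pairProd_replicate_zero_left, esymm_add_replicate_zero, pairProd_comm,
    pairProd_add_left, pairProd_replicate_zero_left, esymm_add_replicate_zero, pairProd_comm]

theorem univ_map_elim_zero {A : Type*} [CommRing A] {n N : ℕ} (a : Fin n → A) :
    Finset.univ.val.map (Sum.elim a (0 : Fin N → A)) =
      Finset.univ.val.map a + Multiset.replicate N 0 := by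
  rw [← Finset.univ_disjSum_univ]
  have h2 : (Finset.univ : Finset (Fin N)).val.map (fun _ => (0 : A)) =
      Multiset.replicate N 0 := by simp
  simp only [Finset.disjSum, Multiset.disjSum, Multiset.map_add, Multiset.map_map]
  exact congrArg₂ (· + ·) rfl h2

/-- Both sides are symmetric in each family and of degree `n` in each, so a monomial of their
difference involves at most `n` variables of either family and can be moved into the first `n` of
both. There the identity is `mulPoly_spec`. -/
theorem mulPolyVars_eq (n N M : ℕ) : mulPolyVars n (Fin n ⊕ Fin N) (Fin n ⊕ Fin M) =
    (pairProd (varsInl (Fin n ⊕ Fin N) (Fin n ⊕ Fin M))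
      (varsInr (Fin n ⊕ Fin N) (Fin n ⊕ Fin M))).esymm n := by
  classical
  rw [← sub_eq_zero]
  have hj : Function.Injective
      (Sum.map Sum.inl Sum.inl : Fin n ⊕ Fin n → (Fin n ⊕ Fin N) ⊕ (Fin n ⊕ Fin M)) :=
    Sum.map_injective.2 ⟨Sum.inl_injective, Sum.inl_injective⟩
  let q : (Fin n ⊕ Fin N) ⊕ (Fin n ⊕ Fin M) → MvPolynomial (Fin n ⊕ Fin n) ℤ :=
    Sum.elim (Sum.elim (fun i => X (Sum.inl i)) 0) (Sum.elim (fun i => X (Sum.inr i)) 0)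
  refine eq_zero_of_retract hj (q := q) ?_ ?_ ?_ fun m hm => ?_
  · rintro (i | i) <;> rfl
  · rintro ((i | i) | (i | i)) hi
    · exact (hi ⟨Sum.inl i, rfl⟩).elim
    · rfl
    · exact (hi ⟨Sum.inr i, rfl⟩).elim
    · rfl
  · rw [map_sub, aeval_mulPolyVars, aeval_esymm_pairProd_vars]
    simp only [q, Sum.elim_inl, Sum.elim_inr]
    have h1 := univ_map_elim_zero (N := N) fun i : Fin n =>
      (X (Sum.inl i) : MvPolynomial (Fin n ⊕ Fin n) ℤ)
    have h2 := univ_map_elim_zero (N := M) fun i : Fin n =>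
      (X (Sum.inr i) : MvPolynomial (Fin n ⊕ Fin n) ℤ)
    simp only [h1, h2, esymm_add_replicate_zero, pairProd_add_replicate_zero]
    rw [sub_eq_zero]
    have h3 := (mulPoly_spec n).trans (productCoeff_eq n)
    rwa [esymm₂_eq] at h3
  -- Weight `1` on the first family and `0` on the second bounds the number of variables of the
  -- first family alone; the second family is handled with the weights exchanged.
  · obtain ⟨e, he⟩ := exists_perm_sum (n := n) (N := N)
      (m.support.preimage Sum.inl Sum.inl_injective.injOn) (by
        have h1 := card_filter_support_le (isWeightedHomogeneous_mulPolyVars (n := n)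
          (show 1 + 0 = 1 from rfl) (Fin n ⊕ Fin N) (Fin n ⊕ Fin M)) hm
        refine le_trans ?_ h1
        refine Finset.card_le_card_of_injOn Sum.inl (fun i hi => ?_) Sum.inl_injective.injOn
        rw [Finset.mem_coe, Finset.mem_preimage] at hi
        exact Finset.mem_coe.2 (Finset.mem_filter.2 ⟨hi, one_ne_zero⟩))
    obtain ⟨e', he'⟩ := exists_perm_sum (n := n) (N := M)
      (m.support.preimage Sum.inr Sum.inr_injective.injOn) (by
        have h1 := card_filter_support_le (isWeightedHomogeneous_mulPolyVars (n := n)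
          (show 0 + 1 = 1 from rfl) (Fin n ⊕ Fin N) (Fin n ⊕ Fin M)) hm
        refine le_trans ?_ h1
        refine Finset.card_le_card_of_injOn Sum.inr (fun i hi => ?_) Sum.inr_injective.injOn
        rw [Finset.mem_coe, Finset.mem_preimage] at hi
        exact Finset.mem_coe.2 (Finset.mem_filter.2 ⟨hi, one_ne_zero⟩))
    refine ⟨Equiv.sumCongr e e', ?_, ?_⟩
    · have h1 : (Finset.univ.val.map fun i => X (R := ℤ) (Sum.inl (e i) : _ ⊕ (Fin n ⊕ Fin M))) =
          varsInl (Fin n ⊕ Fin N) (Fin n ⊕ Fin M) := by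
        conv_rhs => rw [varsInl, ← Finset.map_univ_equiv e, Finset.map_val, Multiset.map_map]
        rfl
      have h2 : (Finset.univ.val.map fun i => X (R := ℤ) (Sum.inr (e' i) : (Fin n ⊕ Fin N) ⊕ _)) =
          varsInr (Fin n ⊕ Fin N) (Fin n ⊕ Fin M) := by
        conv_rhs => rw [varsInr, ← Finset.map_univ_equiv e', Finset.map_val, Multiset.map_map]
        rfl
      have h3 : (rename (Equiv.sumCongr e e') : _ →ₐ[ℤ] _) =
          aeval (X (R := ℤ) ∘ Equiv.sumCongr e e') := by ext; simp
      rw [h3, map_sub, aeval_mulPolyVars, aeval_esymm_pairProd_vars]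
      simp only [Function.comp_apply, Equiv.sumCongr_apply, Sum.map_inl, Sum.map_inr, h1, h2]
      rfl
    · rintro (i | i) hi
      · obtain ⟨k, hk⟩ := he i (Finset.mem_preimage.2 hi)
        exact ⟨Sum.inl k, by simp [hk]⟩
      · obtain ⟨k, hk⟩ := he' i (Finset.mem_preimage.2 hi)
        exact ⟨Sum.inr k, by simp [hk]⟩

theorem aeval_mulPoly {A : Type*} [CommRing A] (n : ℕ) (s t : Multiset A) :
    aeval (Sum.elim (fun i : Fin n => s.esymm (i + 1)) fun j : Fin n => t.esymm (j + 1))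
      (mulPoly n) = (pairProd s t).esymm n := by
  obtain ⟨N, a, ha⟩ := exists_fin_sum_map s n 0
  obtain ⟨M, b, hb⟩ := exists_fin_sum_map t n 0
  have h1 := congrArg (aeval (R := ℤ) (Sum.elim a b)) (mulPolyVars_eq n N M)
  rw [aeval_mulPolyVars, aeval_esymm_pairProd_vars] at h1
  simp only [Sum.elim_inl, Sum.elim_inr] at h1
  change aeval (Sum.elim (fun i : Fin n => (Finset.univ.val.map a).esymm (i + 1))
    fun j : Fin n => (Finset.univ.val.map b).esymm (j + 1)) (mulPoly n) =
    (pairProd (Finset.univ.val.map a) (Finset.univ.val.map b)).esymm n at h1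
  rw [ha, hb, pairProd_add_replicate_zero] at h1
  simpa only [esymm_add_replicate_zero] using h1

end ProductPolynomials

universe v

/-! ### Ring extensions in which a monic polynomial splits. -/

section Splitting

/-- Adjoin one root at a time and divide it off. The map to `A[X]/(p)` is injective because a
nonzero constant is not a multiple of a monic polynomial of positive degree. -/
theorem exists_split_of_monic (N : ℕ) : ∀ (A : Type v) [CommRing A] (p : Polynomial A), p.Monic →
    p.natDegree = N → ∃ (B : Type v) (_ : CommRing B) (φ : A →+* B) (s : Multiset B),
      Function.Injective φ ∧ s.card = N ∧
        p.map φ = (s.map fun r => Polynomial.X + Polynomial.C r).prod := by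
  induction N with
  | zero =>
    intro A _ p hp hN
    refine ⟨A, inferInstance, RingHom.id A, 0, Function.injective_id, rfl, ?_⟩
    rw [Polynomial.eq_one_of_monic_natDegree_zero hp hN]
    simp
  | succ N ih =>
    intro A _ p hp hN
    have hinj : Function.Injective (AdjoinRoot.of p) := by
      rw [injective_iff_map_eq_zero]
      intro a ha
      have h1 : p ∣ Polynomial.C a := AdjoinRoot.mk_eq_zero.1 ha
      by_contra h0
      have h2 := hp.not_dvd_of_natDegree_lt (Polynomial.C_ne_zero.2 h0) (by simp [hN])
      exact h2 h1
    let r := AdjoinRoot.root p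
    obtain ⟨q, hq⟩ : (Polynomial.X - Polynomial.C r) ∣ p.map (AdjoinRoot.of p) :=
      Polynomial.dvd_iff_isRoot.2 (AdjoinRoot.isRoot_root p)
    have hq1 : q.Monic := (Polynomial.monic_X_sub_C r).of_mul_monic_left
      (hq ▸ hp.map (AdjoinRoot.of p))
    have hq2 : q.natDegree = N := by
      cases subsingleton_or_nontrivial (AdjoinRoot p) with
      | inl h =>
        have := hinj (Subsingleton.elim (AdjoinRoot.of p 0) (AdjoinRoot.of p 1))
        have h1 : Subsingleton A := subsingleton_of_zero_eq_one this
        rw [Subsingleton.elim p 0] at hN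
        simp at hN
      | inr h =>
        have h1 := congrArg Polynomial.natDegree hq
        rw [hp.natDegree_map, hN, (Polynomial.monic_X_sub_C r).natDegree_mul hq1,
          Polynomial.natDegree_X_sub_C] at h1
        omega
    obtain ⟨B, _, φ, s, hφ, hs, hs'⟩ := ih (AdjoinRoot p) q hq1 hq2
    -- The negative of the root is recorded, so that the factors read `X + r` and no signs enter the
    -- elementary symmetric functions.
    refine ⟨B, inferInstance, φ.comp (AdjoinRoot.of p), φ (-r) ::ₘ s, hφ.comp hinj, by simp [hs], ?_⟩
    rw [← Polynomial.map_map, hq, Polynomial.map_mul, hs']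
    simp [sub_eq_add_neg]

end Splitting

/-! ### The ring `1 + tA[[t]]`, its operations and power sums, via formal roots. -/

namespace OnePlus

variable {A B C : Type*} [CommRing A] [CommRing B] [CommRing C]

theorem ext_coeff {f g : OnePlus A} (h : ∀ n, coeff n f = coeff n g) : f = g :=
  Subtype.ext (PowerSeries.ext h)

theorem coeff_zero (f : OnePlus A) : coeff 0 f = 1 := by
  rw [coeff, PowerSeries.coeff_zero_eq_constantCoeff_apply, f.2]

theorem coeff_add (n : ℕ) (f g : OnePlus A) : coeff n (f.add g) =
    ∑ p ∈ Finset.HasAntidiagonal.antidiagonal n, coeff p.1 f * coeff p.2 g :=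
  PowerSeries.coeff_mul n f.1 g.1

theorem coeff_mul (n : ℕ) (f g : OnePlus A) : coeff n (f.mul g) = MvPolynomial.aeval
    (Sum.elim (fun i : Fin n => coeff (i + 1) f) (fun j : Fin n => coeff (j + 1) g))
      (mulPoly n) := by
  rw [coeff, mul, PowerSeries.coeff_mk]

theorem coeff_lam (m k : ℕ) (f : OnePlus A) : coeff m (f.lam k) = MvPolynomial.aeval
    (fun i : Fin (m * k) => coeff (i + 1) f) (lamPoly m k) := by
  rw [coeff, lam, PowerSeries.coeff_mk]

/-- The power series `∏ (1 + a t)` over the elements `a` of a multiset. -/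
noncomputable def ofRoots (s : Multiset A) : OnePlus A :=
  ⟨PowerSeries.mk fun n => s.esymm n, by
    rw [← PowerSeries.coeff_zero_eq_constantCoeff_apply, PowerSeries.coeff_mk, esymm_zero_right]⟩

theorem coeff_ofRoots (n : ℕ) (s : Multiset A) : coeff n (ofRoots s) = s.esymm n := by
  rw [coeff, ofRoots, PowerSeries.coeff_mk]

/-- On products of linear factors, the operations of `1 + tA[[t]]` become operations on the
multisets of roots: union, pairwise products and products of `k` roots. The first is this lemma, the
other two follow. -/
theorem ofRoots_add (s t : Multiset A) : ofRoots (s + t) = (ofRoots s).add (ofRoots t) := by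
  refine ext_coeff fun n => ?_
  rw [coeff_add, coeff_ofRoots, ← sum_wedge, wedge_add, ← Multiset.coe_sumAddMonoidHom, map_sum]
  refine Finset.sum_congr rfl fun p _ => ?_
  rw [coeff_ofRoots, coeff_ofRoots, Multiset.coe_sumAddMonoidHom, sum_pairProd, sum_wedge,
    sum_wedge]

theorem ofRoots_pairProd (s t : Multiset A) :
    ofRoots (pairProd s t) = (ofRoots s).mul (ofRoots t) := by
  refine ext_coeff fun n => ?_
  rw [coeff_mul, coeff_ofRoots]
  simp only [coeff_ofRoots]
  exact (aeval_mulPoly n s t).symm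

theorem ofRoots_wedge (k : ℕ) (s : Multiset A) : ofRoots (wedge k s) = (ofRoots s).lam k := by
  refine ext_coeff fun n => ?_
  rw [coeff_lam, coeff_ofRoots]
  simp only [coeff_ofRoots]
  exact (aeval_lamPoly n k s).symm

theorem ofRoots_singleton_one : ofRoots {(1 : A)} = one := by
  refine ext_coeff fun n => ?_
  rw [coeff_ofRoots, ← Multiset.cons_zero]
  rcases n with _ | _ | n
  · rw [esymm_zero_right, coeff_zero]
  · rw [esymm_succ_cons, esymm_succ_zero, esymm_zero_right]
    simp [coeff, one]
  · rw [esymm_succ_cons, esymm_succ_zero, esymm_succ_zero]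
    simp [coeff, one, PowerSeries.coeff_one, PowerSeries.coeff_X]

/-- The map on power series induced by a ring homomorphism. -/
noncomputable def map (φ : A →+* B) (f : OnePlus A) : OnePlus B :=
  ⟨PowerSeries.map φ f.1, by
    rw [← PowerSeries.coeff_zero_eq_constantCoeff_apply, PowerSeries.coeff_map,
      PowerSeries.coeff_zero_eq_constantCoeff_apply, f.2, map_one]⟩

theorem coeff_map (φ : A →+* B) (n : ℕ) (f : OnePlus A) : coeff n (map φ f) = φ (coeff n f) :=
  PowerSeries.coeff_map _ _ _

theorem map_aeval_int {σ : Type*} (φ : A →+* B) (x : σ → A) (P : MvPolynomial σ ℤ) :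
    φ (MvPolynomial.aeval x P) = MvPolynomial.aeval (fun i => φ (x i)) P := by
  have := MvPolynomial.comp_aeval (R := ℤ) x φ.toIntAlgHom
  exact DFunLike.congr_fun this P

theorem map_add (φ : A →+* B) (f g : OnePlus A) : map φ (f.add g) = (map φ f).add (map φ g) := by
  refine ext_coeff fun n => ?_
  simp only [coeff_map, coeff_add, map_sum, map_mul]

theorem map_mul (φ : A →+* B) (f g : OnePlus A) : map φ (f.mul g) = (map φ f).mul (map φ g) := by
  refine ext_coeff fun n => ?_
  rw [coeff_map, coeff_mul, coeff_mul, map_aeval_int]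
  congr 2
  funext x
  rcases x with i | i <;> simp [coeff_map]

theorem map_lam (φ : A →+* B) (k : ℕ) (f : OnePlus A) : map φ (f.lam k) = (map φ f).lam k := by
  refine ext_coeff fun n => ?_
  simp only [coeff_map, coeff_lam, map_aeval_int]

/-- Two power series agree up to order `N`. -/
def Agree (N : ℕ) (f g : OnePlus A) : Prop := ∀ n ≤ N, coeff n f = coeff n g

theorem Agree.add {N : ℕ} {f f' g g' : OnePlus A} (h : Agree N f f') (h' : Agree N g g') :
    Agree N (f.add g) (f'.add g') := by
  intro n hn
  rw [coeff_add, coeff_add]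
  refine Finset.sum_congr rfl fun p hp => ?_
  have := Finset.HasAntidiagonal.mem_antidiagonal.1 hp
  rw [h p.1 (by omega), h' p.2 (by omega)]

theorem Agree.mul {N : ℕ} {f f' g g' : OnePlus A} (h : Agree N f f') (h' : Agree N g g') :
    Agree N (f.mul g) (f'.mul g') := by
  intro n hn
  rw [coeff_mul, coeff_mul]
  congr 2
  funext x
  rcases x with i | i
  · exact h _ (by omega)
  · exact h' _ (by omega)

/-- The `n`-th coefficient of `Λ^k f` involves the coefficients of `f` up to order `n * k`, hence
the loss of precision. -/
theorem Agree.lam {N k : ℕ} {f f' : OnePlus A} (h : Agree (N * k) f f') :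
    Agree N (f.lam k) (f'.lam k) := by
  intro n hn
  rw [coeff_lam, coeff_lam]
  congr 2
  funext i
  exact h _ (by have := Nat.mul_le_mul_right k hn; omega)

/-- After extension of scalars along `φ`, the power series `f` agrees up to order `N` with the
product of the factors `1 + a t` over the elements `a` of the multiset `s`. -/
def HasRoots (N : ℕ) (φ : A →+* B) (f : OnePlus A) (s : Multiset B) : Prop :=
  Agree N (map φ f) (ofRoots s)

namespace HasRoots

variable {N : ℕ} {φ : A →+* B} {f g : OnePlus A} {s t : Multiset B}

theorem mono {M : ℕ} (hf : HasRoots N φ f s) (h : M ≤ N) : HasRoots M φ f s :=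
  fun n hn => hf n (hn.trans h)

theorem coeff_eq (hf : HasRoots N φ f s) {n : ℕ} (hn : n ≤ N) : φ (coeff n f) = s.esymm n := by
  rw [← coeff_map, hf n hn, coeff_ofRoots]

theorem add (hf : HasRoots N φ f s) (hg : HasRoots N φ g t) :
    HasRoots N φ (f.add g) (s + t) := by
  rw [HasRoots, map_add, ofRoots_add]; exact Agree.add hf hg

theorem mul (hf : HasRoots N φ f s) (hg : HasRoots N φ g t) :
    HasRoots N φ (f.mul g) (pairProd s t) := by
  rw [HasRoots, map_mul, ofRoots_pairProd]; exact Agree.mul hf hg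

theorem lam {k : ℕ} (hf : HasRoots (N * k) φ f s) : HasRoots N φ (f.lam k) (wedge k s) := by
  rw [HasRoots, map_lam, ofRoots_wedge]; exact Agree.lam hf

theorem comp (hf : HasRoots N φ f s) (ψ : B →+* C) : HasRoots N (ψ.comp φ) f (s.map ψ) := by
  intro n hn
  rw [coeff_map, RingHom.comp_apply, hf.coeff_eq hn, coeff_ofRoots, esymm_map]

theorem one : HasRoots N φ OnePlus.one {1} := by
  intro n _
  rw [ofRoots_singleton_one]
  rcases n with _ | _ | n
  · rw [coeff_zero, coeff_zero]
  · rw [coeff_map]; simp [coeff, OnePlus.one]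
  · rw [coeff_map]; simp [coeff, OnePlus.one, PowerSeries.coeff_one, PowerSeries.coeff_X]

end HasRoots

/-- Truncate `f` at order `N` and reverse its coefficients. The result is a monic polynomial of
degree `N`, and once it splits as `∏ (X + r)`, its coefficient of `X^(N - n)` is the `n`-th
elementary symmetric function of the roots. -/
theorem exists_hasRoots {A : Type v} [CommRing A] (N : ℕ) (f : OnePlus A) :
    ∃ (B : Type v) (_ : CommRing B) (φ : A →+* B) (s : Multiset B),
      Function.Injective φ ∧ HasRoots N φ f s := by
  cases subsingleton_or_nontrivial A with
  -- Over the zero ring the degree of a polynomial carries no information, so this case is separate.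
  | inl h => exact ⟨A, inferInstance, RingHom.id A, 0, Function.injective_id,
      fun n _ => Subsingleton.elim _ _⟩
  | inr h =>
  let p : Polynomial A := Polynomial.X ^ N + ∑ i ∈ Finset.range N,
    Polynomial.C (coeff (N - i) f) * Polynomial.X ^ i
  have hd : (∑ i ∈ Finset.range N, Polynomial.C (coeff (N - i) f) * Polynomial.X ^ i).degree < (N : WithBot ℕ) := by
    refine Polynomial.mem_degreeLT.1 (Submodule.sum_mem _ fun i hi => Polynomial.mem_degreeLT.2 ?_)
    refine (Polynomial.degree_C_mul_X_pow_le _ _).trans_lt ?_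
    exact_mod_cast Finset.mem_range.1 hi
  have hp : p.Monic := Polynomial.monic_X_pow_add hd
  have hN : p.natDegree = N := Polynomial.natDegree_eq_of_degree_eq_some (by
    rw [Polynomial.degree_add_eq_left_of_degree_lt (by rwa [Polynomial.degree_X_pow]),
      Polynomial.degree_X_pow])
  obtain ⟨B, _, φ, s, hφ, hs, h⟩ := exists_split_of_monic N A p hp hN
  refine ⟨B, inferInstance, φ, s, hφ, fun n hn => ?_⟩
  have h1 := congrArg (fun q => Polynomial.coeff q (N - n)) h
  simp only [Polynomial.coeff_map] at h1
  rw [Multiset.prod_X_add_C_coeff _ (by omega), hs, Nat.sub_sub_self hn] at h1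
  rw [coeff_map, coeff_ofRoots, ← h1]
  congr 1
  simp only [p, Polynomial.coeff_add, Polynomial.finsetSum_coeff, Polynomial.coeff_C_mul_X_pow,
    Polynomial.coeff_X_pow]
  rcases Nat.eq_zero_or_pos n with rfl | hn'
  · rw [if_pos (by simp), coeff_zero, Finset.sum_eq_zero, add_zero]
    intro i hi
    rw [if_neg]
    have := Finset.mem_range.1 hi
    omega
  · rw [if_neg (by omega), zero_add, Finset.sum_eq_single (N - n), if_pos rfl,
      Nat.sub_sub_self hn]
    · intro i _ hi; rw [if_neg (Ne.symm hi)]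
    · intro hi; exact (hi (Finset.mem_range.2 (by omega))).elim

theorem exists_hasRoots₂ {A : Type v} [CommRing A] (N : ℕ) (f g : OnePlus A) :
    ∃ (B : Type v) (_ : CommRing B) (φ : A →+* B) (s t : Multiset B),
      Function.Injective φ ∧ HasRoots N φ f s ∧ HasRoots N φ g t := by
  obtain ⟨B, _, φ, s, hφ, hs⟩ := exists_hasRoots N f
  obtain ⟨C, _, ψ, t, hψ, ht⟩ := exists_hasRoots N (map φ g)
  refine ⟨C, inferInstance, ψ.comp φ, s.map ψ, t, hψ.comp hφ, hs.comp ψ, fun n hn => ?_⟩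
  rw [← ht n hn, coeff_map, coeff_map, coeff_map]; rfl

theorem exists_hasRoots₃ {A : Type v} [CommRing A] (N : ℕ) (f g h : OnePlus A) :
    ∃ (B : Type v) (_ : CommRing B) (φ : A →+* B) (s t u : Multiset B),
      Function.Injective φ ∧ HasRoots N φ f s ∧ HasRoots N φ g t ∧ HasRoots N φ h u := by
  obtain ⟨B, _, φ, s, t, hφ, hs, ht⟩ := exists_hasRoots₂ N f g
  obtain ⟨C, _, ψ, u, hψ, hu⟩ := exists_hasRoots N (map φ h)
  refine ⟨C, inferInstance, ψ.comp φ, s.map ψ, t.map ψ, u, hψ.comp hφ, hs.comp ψ, ht.comp ψ,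
    fun n hn => ?_⟩
  rw [← hu n hn, coeff_map, coeff_map, coeff_map]; rfl

/-- This is the working form of the splitting principle for power series: an identity is checked one
coefficient at a time, over an extension, as an equality of multisets of roots. -/
theorem coeff_eq_of_hasRoots {N : ℕ} {φ : A →+* B} (hφ : Function.Injective φ) {f g : OnePlus A}
    {s t : Multiset B} (hf : HasRoots N φ f s) (hg : HasRoots N φ g t) (h : s = t) :
    coeff N f = coeff N g :=
  hφ (by rw [hf.coeff_eq le_rfl, hg.coeff_eq le_rfl, h])

noncomputable instance : Zero (OnePlus A) := ⟨⟨1, _root_.map_one _⟩⟩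

noncomputable instance : Neg (OnePlus A) := ⟨fun f => ⟨PowerSeries.invOfUnit f.1 1, by simp⟩⟩

noncomputable instance : Add (OnePlus A) := ⟨add⟩

theorem hasRoots_zero (N : ℕ) (φ : A →+* B) : HasRoots N φ (0 : OnePlus A) 0 := by
  intro n _
  rw [coeff_map, coeff_ofRoots]
  change φ (PowerSeries.coeff n 1) = _
  cases n with
  | zero => simp [esymm_zero_right]
  | succ n => simp [esymm_succ_zero, PowerSeries.coeff_one]

/-- The ring `1 + t A[[t]]`. -/
noncomputable instance : CommRing (OnePlus A) where
  mul := mul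
  one := one
  nsmul := nsmulRec
  zsmul := zsmulRec
  add_assoc f g h := Subtype.ext (mul_assoc f.1 g.1 h.1)
  add_comm f g := Subtype.ext (mul_comm f.1 g.1)
  zero_add f := Subtype.ext (one_mul f.1)
  add_zero f := Subtype.ext (mul_one f.1)
  neg_add_cancel f := Subtype.ext
    ((mul_comm _ _).trans (PowerSeries.mul_invOfUnit f.1 1 (by simp [f.2])))
  -- From here on each axiom is the corresponding identity of multisets of pairwise products.
  mul_comm f g := by
    refine ext_coeff fun n => ?_
    obtain ⟨B, _, φ, s, t, hφ, hs, ht⟩ := exists_hasRoots₂ n f g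
    exact coeff_eq_of_hasRoots hφ (hs.mul ht) (ht.mul hs) (pairProd_comm s t)
  mul_assoc f g h := by
    refine ext_coeff fun n => ?_
    obtain ⟨B, _, φ, s, t, u, hφ, hs, ht, hu⟩ := exists_hasRoots₃ n f g h
    exact coeff_eq_of_hasRoots hφ ((hs.mul ht).mul hu) (hs.mul (ht.mul hu)) (pairProd_assoc s t u)
  one_mul f := by
    refine ext_coeff fun n => ?_
    obtain ⟨B, _, φ, s, hφ, hs⟩ := exists_hasRoots n f
    exact coeff_eq_of_hasRoots hφ (HasRoots.one.mul hs) hs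
      (by rw [pairProd_comm, pairProd_singleton_one])
  mul_one f := by
    refine ext_coeff fun n => ?_
    obtain ⟨B, _, φ, s, hφ, hs⟩ := exists_hasRoots n f
    exact coeff_eq_of_hasRoots hφ (hs.mul HasRoots.one) hs (pairProd_singleton_one s)
  left_distrib f g h := by
    refine ext_coeff fun n => ?_
    obtain ⟨B, _, φ, s, t, u, hφ, hs, ht, hu⟩ := exists_hasRoots₃ n f g h
    exact coeff_eq_of_hasRoots hφ (hs.mul (ht.add hu)) ((hs.mul ht).add (hs.mul hu))
      (pairProd_add_right s t u)
  right_distrib f g h := by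
    refine ext_coeff fun n => ?_
    obtain ⟨B, _, φ, s, t, u, hφ, hs, ht, hu⟩ := exists_hasRoots₃ n f g h
    exact coeff_eq_of_hasRoots hφ ((hs.add ht).mul hu) ((hs.mul hu).add (ht.mul hu))
      (pairProd_add_left s t u)
  zero_mul f := by
    refine ext_coeff fun n => ?_
    obtain ⟨B, _, φ, s, hφ, hs⟩ := exists_hasRoots n f
    exact coeff_eq_of_hasRoots hφ ((hasRoots_zero n φ).mul hs) (hasRoots_zero n φ) (pairProd_zero_left s)
  mul_zero f := by
    refine ext_coeff fun n => ?_
    obtain ⟨B, _, φ, s, hφ, hs⟩ := exists_hasRoots n f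
    exact coeff_eq_of_hasRoots hφ (hs.mul (hasRoots_zero n φ)) (hasRoots_zero n φ) (pairProd_zero_right s)

theorem hasRoots_sum {ι : Type*} {N : ℕ} {φ : A →+* B} (S : Finset ι) (f : ι → OnePlus A)
    (s : ι → Multiset B) (h : ∀ i ∈ S, HasRoots N φ (f i) (s i)) :
    HasRoots N φ (∑ i ∈ S, f i) (∑ i ∈ S, s i) := by
  classical
  induction S using Finset.induction_on with
  | empty => exact hasRoots_zero N φ
  | insert a S ha ih =>
    rw [Finset.sum_insert ha, Finset.sum_insert ha]
    exact (h a (Finset.mem_insert_self a S)).add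
      (ih fun i hi => h i (Finset.mem_insert_of_mem hi))

theorem HasRoots.add' {N : ℕ} {φ : A →+* B} {f g : OnePlus A} {s t : Multiset B}
    (hf : HasRoots N φ f s) (hg : HasRoots N φ g t) : HasRoots N φ (f + g) (s + t) := hf.add hg

theorem HasRoots.mul' {N : ℕ} {φ : A →+* B} {f g : OnePlus A} {s t : Multiset B}
    (hf : HasRoots N φ f s) (hg : HasRoots N φ g t) : HasRoots N φ (f * g) (pairProd s t) :=
  hf.mul hg

/-- On roots this is `wedge_add`. Roots are taken up to order `n * k`, which is what the `n`-th
coefficient of an operation of degree at most `k` sees. -/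
theorem lam_add (k : ℕ) (f g : OnePlus A) : (f + g).lam k =
    ∑ p ∈ Finset.HasAntidiagonal.antidiagonal k, f.lam p.1 * g.lam p.2 := by
  refine ext_coeff fun n => ?_
  obtain ⟨B, _, φ, s, t, hφ, hs, ht⟩ := exists_hasRoots₂ (n * k) f g
  have h1 : HasRoots n φ ((f + g).lam k) (wedge k (s + t)) := (hs.add' ht).lam
  have h2 : HasRoots n φ (∑ p ∈ Finset.HasAntidiagonal.antidiagonal k, f.lam p.1 * g.lam p.2)
      (∑ p ∈ Finset.HasAntidiagonal.antidiagonal k, pairProd (wedge p.1 s) (wedge p.2 t)) := by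
    refine hasRoots_sum _ _ _ fun p hp => ?_
    have := Finset.HasAntidiagonal.mem_antidiagonal.1 hp
    have h3 : HasRoots n φ (f.lam p.1) (wedge p.1 s) :=
      (hs.mono (Nat.mul_le_mul_left n (by omega))).lam
    have h4 : HasRoots n φ (g.lam p.2) (wedge p.2 t) :=
      (ht.mono (Nat.mul_le_mul_left n (by omega))).lam
    exact h3.mul' h4
  exact coeff_eq_of_hasRoots hφ h1 h2 (wedge_add k s t)

theorem lam_zero (f : OnePlus A) : f.lam 0 = 1 := by
  refine ext_coeff fun n => ?_
  obtain ⟨B, _, φ, s, hφ, hs⟩ := exists_hasRoots (n * 0) f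
  exact coeff_eq_of_hasRoots hφ hs.lam HasRoots.one (wedge_zero_left s)

theorem lam_one (f : OnePlus A) : f.lam 1 = f := by
  refine ext_coeff fun n => ?_
  obtain ⟨B, _, φ, s, hφ, hs⟩ := exists_hasRoots (n * 1) f
  exact coeff_eq_of_hasRoots hφ hs.lam (hs.mono (mul_one n).ge) (wedge_one s)

theorem Agree.aeval {σ : Type*} {N : ℕ} {x y : σ → OnePlus A} (h : ∀ i, Agree N (x i) (y i))
    (P : MvPolynomial σ ℤ) : Agree N (MvPolynomial.aeval x P) (MvPolynomial.aeval y P) := by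
  induction P using MvPolynomial.induction_on with
  | C c => intro n _; simp
  | add p q hp hq => rw [_root_.map_add, _root_.map_add]; exact Agree.add hp hq
  | mul_X p i hp =>
    rw [_root_.map_mul, _root_.map_mul, MvPolynomial.aeval_X, MvPolynomial.aeval_X]
    exact Agree.mul hp (h i)

/-- The ring homomorphism induced by a ring homomorphism. -/
noncomputable def mapHom (φ : A →+* B) : OnePlus A →+* OnePlus B where
  toFun := map φ
  map_one' := by
    refine ext_coeff fun n => ?_
    exact ((HasRoots.one (N := n) (φ := φ)) n le_rfl).trans (by rw [ofRoots_singleton_one]; rfl)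
  map_mul' := map_mul φ
  map_zero' := Subtype.ext (_root_.map_one (PowerSeries.map φ))
  map_add' := map_add φ

theorem sum_map_ofRoots {ι : Type*} (s : Multiset ι) (F : ι → Multiset A) :
    (s.map fun i => ofRoots (F i)).sum = ofRoots (s.map F).sum := by
  induction s using Multiset.induction_on with
  | empty =>
    refine ext_coeff fun n => ?_
    have := hasRoots_zero n (RingHom.id A) n le_rfl
    rwa [coeff_map] at this
  | cons a s ih =>
    rw [Multiset.map_cons, Multiset.sum_cons, ih, Multiset.map_cons, Multiset.sum_cons, ofRoots_add]
    rfl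

theorem ofRoots_singleton_prod (s : Multiset A) :
    (s.map fun a => ofRoots {a}).prod = ofRoots {s.prod} := by
  induction s using Multiset.induction_on with
  | empty => exact ofRoots_singleton_one.symm
  | cons a s ih =>
    rw [Multiset.map_cons, Multiset.prod_cons, ih, Multiset.prod_cons]
    refine (ofRoots_pairProd {a} {s.prod}).symm.trans ?_
    rw [pairProd_singleton_left, Multiset.map_singleton]

theorem sum_map_singleton' {ι A : Type*} (s : Multiset ι) (F : ι → A) :
    (s.map fun i => ({F i} : Multiset A)).sum = s.map F := by
  induction s using Multiset.induction_on with
  | empty => rfl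
  | cons a s ih => simp [ih, Multiset.singleton_add]

/-- Inside the ring `1 + tA[[t]]`, the series `∏ (1 + at)` is the sum of the elements `1 + at`, and
these multiply like the roots `a`. So `Λ^k` is the elementary symmetric function, formed in this
ring, of the elements `1 + at`. -/
theorem esymm_ofRoots (k : ℕ) (s : Multiset A) :
    (s.map fun a => ofRoots {a}).esymm k = (ofRoots s).lam k := by
  rw [Multiset.esymm, Multiset.powersetCard_map, Multiset.map_map, ← ofRoots_wedge, wedge]
  simp only [Function.comp_apply, ofRoots_singleton_prod]
  rw [sum_map_ofRoots, sum_map_singleton']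

/-- By `esymm_ofRoots`, the Newton polynomial of the `Λ^i f` is the sum of the `n`-th powers of the
elements `1 + at`, which are `1 + a^n t`. The order `N * n` is needed for the operations up to
`Λ^n`. -/
theorem hasRoots_newton {N n : ℕ} (hn : n ≠ 0) {φ : A →+* B} {f : OnePlus A} {s : Multiset B}
    (hf : HasRoots (N * n) φ f s) :
    HasRoots N φ (MvPolynomial.aeval (fun i : Fin n => f.lam (i + 1)) (newtonPoly n))
      (s.map (· ^ n)) := by
  have h1 := map_aeval_int (mapHom φ) (fun i : Fin n => f.lam (i + 1)) (newtonPoly n)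
  have h2 : ∀ i : Fin n, Agree N (mapHom φ (f.lam (i + 1)))
      ((s.map fun a => ofRoots {a}).esymm (i + 1)) := fun i => by
    rw [esymm_ofRoots, ← ofRoots_wedge]
    exact (hf.mono (Nat.mul_le_mul_left N i.2)).lam
  have h3 := Agree.aeval h2 (newtonPoly n)
  -- Newton's identity is used in the ring `OnePlus B` itself, for the multiset of the series `1 + a
  -- t`.
  rw [← h1, aeval_newtonPoly hn, Multiset.map_map] at h3
  have h4 : ∀ a : B, (ofRoots {a}) ^ n = ofRoots {a ^ n} := fun a => by
    have := ofRoots_singleton_prod (Multiset.replicate n a)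
    simpa using this
  simp only [Function.comp_def, h4] at h3
  rw [sum_map_ofRoots, sum_map_singleton'] at h3
  exact h3

/-- The `n`-th power sum of the roots of a power series. -/
noncomputable def powerSum (n : ℕ) (f : OnePlus A) : A :=
  MvPolynomial.aeval (fun i : Fin n => coeff (i + 1) f) (newtonPoly n)

theorem HasRoots.powerSum {N n : ℕ} (hn : n ≠ 0) (hN : n ≤ N) {φ : A →+* B} {f : OnePlus A}
    {s : Multiset B} (hf : HasRoots N φ f s) : φ (powerSum n f) = (s.map (· ^ n)).sum := by
  rw [OnePlus.powerSum, map_aeval_int, ← aeval_newtonPoly hn]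
  congr 2
  funext i
  exact hf.coeff_eq (by omega)

theorem powerSum_add {n : ℕ} (hn : n ≠ 0) (f g : OnePlus A) :
    powerSum n (f + g) = powerSum n f + powerSum n g := by
  obtain ⟨B, _, φ, s, t, hφ, hs, ht⟩ := exists_hasRoots₂ n f g
  apply hφ
  rw [_root_.map_add, hs.powerSum hn le_rfl, ht.powerSum hn le_rfl]
  refine ((hs.add ht).powerSum hn le_rfl).trans ?_
  simp

theorem powerSum_mul {n : ℕ} (hn : n ≠ 0) (f g : OnePlus A) :
    powerSum n (f * g) = powerSum n f * powerSum n g := by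
  obtain ⟨B, _, φ, s, t, hφ, hs, ht⟩ := exists_hasRoots₂ n f g
  apply hφ
  rw [_root_.map_mul, hs.powerSum hn le_rfl, ht.powerSum hn le_rfl, ← sum_pairProd]
  refine ((hs.mul ht).powerSum hn le_rfl).trans (congrArg Multiset.sum ?_)
  clear hs ht
  induction s using Multiset.induction_on with
  | empty => simp [pairProd_zero_left]
  | cons a s ih => simp [pairProd_cons_left, ih, mul_pow]

theorem powerSum_one {n : ℕ} (hn : n ≠ 0) : powerSum n (1 : OnePlus A) = 1 := by
  have := (HasRoots.one (N := n) (φ := RingHom.id A)).powerSum hn le_rfl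
  rw [RingHom.id_apply] at this
  refine Eq.trans this ?_
  simp

/-- On roots, both sides are the sum over the `k`-element submultisets of the `n`-th powers of their
products. This symmetry is the reason why Adams operations commute with `λ^k`. -/
theorem coeff_newton_lam {n : ℕ} (hn : n ≠ 0) (k : ℕ) (f : OnePlus A) :
    coeff k (MvPolynomial.aeval (fun i : Fin n => f.lam (i + 1)) (newtonPoly n)) =
      powerSum n (f.lam k) := by
  -- The summand `k * n` serves the `k`-th coefficient of the Newton expression, and `n * k` the
  -- `n`-th power sum of `Λ^k f`.
  obtain ⟨B, _, φ, s, hφ, hs⟩ := exists_hasRoots (k * n + n * k) f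
  apply hφ
  rw [(hasRoots_newton hn (hs.mono (Nat.le_add_right _ _))).coeff_eq le_rfl,
    (hs.mono (Nat.le_add_left (n * k) (k * n))).lam.powerSum hn le_rfl, ← sum_wedge]
  congr 1
  simp only [wedge, Multiset.powersetCard_map, Multiset.map_map, Function.comp_def]
  exact Multiset.map_congr rfl fun u _ => by
    simpa using Multiset.prod_map_pow (m := u) (f := id) (n := n)

end OnePlus

/-! ### Speciality from generators, and Adams operations on special `λ`-rings. -/

section SpecialRings

variable {A : Type*} [CommRing A] [LambdaRing A]

theorem coeff_lambdaT (n : ℕ) (x : A) : (lambdaT x).coeff n = LambdaRing.lam n x := by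
  rw [OnePlus.coeff, lambdaT, PowerSeries.coeff_mk]

theorem lambdaT_add (x y : A) : lambdaT (x + y) = lambdaT x + lambdaT y := by
  refine OnePlus.ext_coeff fun n => ?_
  refine Eq.trans ?_ (OnePlus.coeff_add n (lambdaT x) (lambdaT y)).symm
  simp only [coeff_lambdaT, LambdaRing.lam_add]

/-- `λ_t` as a homomorphism of additive groups. -/
noncomputable def lambdaTAdd (A : Type*) [CommRing A] [LambdaRing A] : A →+ OnePlus A :=
  AddMonoidHom.mk' lambdaT lambdaT_add

theorem lambdaT_sub (x y : A) : lambdaT (x - y) = lambdaT x - lambdaT y :=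
  map_sub (lambdaTAdd A) x y

theorem lambdaT_sum {ι : Type*} (s : Finset ι) (f : ι → A) :
    lambdaT (∑ i ∈ s, f i) = ∑ i ∈ s, lambdaT (f i) :=
  map_sum (lambdaTAdd A) f s

/-- Expand the identity for `x + y`. The term of index `(k, 0)` is the one wanted, and all others
agree by induction on `k`, so they cancel. It is applied to a difference `x = a - b` with `y = b`.
-/
theorem lambdaT_lam_of_add (hmul : ∀ x y : A, lambdaT (x * y) = lambdaT x * lambdaT y) {x y : A}
    (hy : ∀ k, lambdaT (LambdaRing.lam k y) = (lambdaT y).lam k)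
    (hxy : ∀ k, lambdaT (LambdaRing.lam k (x + y)) = (lambdaT (x + y)).lam k) (k : ℕ) :
    lambdaT (LambdaRing.lam k x) = (lambdaT x).lam k := by
  induction k using Nat.strong_induction_on with
  | _ k ih =>
    have h := hxy k
    rw [LambdaRing.lam_add, lambdaT_sum, lambdaT_add, OnePlus.lam_add] at h
    simp only [hmul, hy] at h
    have hk : (k, 0) ∈ Finset.HasAntidiagonal.antidiagonal k := by simp
    rw [← Finset.add_sum_erase _ _ hk, ← Finset.add_sum_erase _ _ hk, OnePlus.lam_zero, mul_one,
      mul_one] at h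
    rw [Finset.sum_congr rfl fun p hp => ?_] at h
    · exact add_right_cancel h
    · obtain ⟨h1, h2⟩ := Finset.mem_erase.1 hp
      have h3 := Finset.HasAntidiagonal.mem_antidiagonal.1 h2
      have h4 : p.2 ≠ 0 := fun h0 => h1 (Prod.ext (by simp; omega) h0)
      rw [ih p.1 (by omega)]

/-- A `λ`-ring is special if `λ_t` commutes with the `λ`-operations on a set of generators closed
under addition. -/
theorem isSpecial_of_generators {G : Type*} [AddCommMonoid G] (of : G →+ A)
    (hG : ∀ x : A, ∃ a b, x = of a - of b)
    (hlam : ∀ k a, lambdaT (LambdaRing.lam k (of a)) = (lambdaT (of a)).lam k) : IsSpecial A := by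
  have hof : ∀ a b, lambdaT (of a * of b) = lambdaT (of a) * lambdaT (of b) := by
    intro a b
    -- The middle term of `λ^2(a + b)` is `a * b`. After expanding both sides, the outer terms
    -- cancel by the hypothesis for `a` and `b`, and multiplicativity is left.
    have h := hlam 2 (a + b)
    rw [map_add, LambdaRing.lam_add, lambdaT_sum, lambdaT_add, OnePlus.lam_add] at h
    simp only [Finset.Nat.antidiagonal_succ, Finset.sum_cons, Finset.Nat.antidiagonal_zero,
      Finset.map_singleton, Finset.sum_singleton, Function.Embedding.prodMap,
      Function.Embedding.coeFn_mk, Prod.map, Function.Embedding.refl_apply,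
      Finset.map_cons, LambdaRing.lam_zero, OnePlus.lam_zero, one_mul, mul_one, zero_add,
      Nat.succ_eq_add_one, LambdaRing.lam_one, OnePlus.lam_one, hlam, Nat.reduceAdd] at h
    exact add_right_cancel (add_left_cancel h)
  have hmul : ∀ x y : A, lambdaT (x * y) = lambdaT x * lambdaT y := by
    intro x y
    obtain ⟨a, b, rfl⟩ := hG x
    obtain ⟨c, d, rfl⟩ := hG y
    rw [sub_mul, mul_sub, mul_sub]
    simp only [lambdaT_sub, hof]
    ring
  refine ⟨lambdaT_add, ?_, hmul, fun k x => ?_⟩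
  -- Both `λ^0` and `Λ^0` are the constant unit, so the case `k = 0` is the preservation of the unit
  -- element.
  · have := hlam 0 0
    rw [LambdaRing.lam_zero, OnePlus.lam_zero] at this
    exact this
  · obtain ⟨a, b, rfl⟩ := hG x
    refine lambdaT_lam_of_add hmul (fun k => hlam k b) (fun k => ?_) k
    rw [sub_add_cancel]
    exact hlam k a

theorem adams_eq_powerSum (n : ℕ) (x : A) : adams n x = (lambdaT x).powerSum n := by
  rw [adams, OnePlus.powerSum]
  simp only [coeff_lambdaT]

/-- The Adams operation is the power sum of the roots of `λ_t`. Since `λ_t` is a ring homomorphism,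
`Ψ^n` inherits additivity and multiplicativity from the power sum. -/
theorem IsSpecial.adams_isLambdaHom (h : IsSpecial A) {n : ℕ} (hn : n ≠ 0) :
    ∃ φ : A →+* A, (∀ x, φ x = adams n x) ∧ IsLambdaHom φ := by
  let T : A →+* OnePlus A :=
    { toFun := lambdaT, map_one' := h.map_one, map_mul' := h.map_mul,
      map_zero' := map_zero (lambdaTAdd A), map_add' := lambdaT_add }
  have hadd : ∀ x y : A, adams n (x + y) = adams n x + adams n y := fun x y => by
    simp only [adams_eq_powerSum, lambdaT_add, OnePlus.powerSum_add hn]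
  refine ⟨{ toFun := adams n
            map_one' := by
              rw [adams_eq_powerSum]
              exact (congrArg _ (_root_.map_one T)).trans (OnePlus.powerSum_one hn)
            map_mul' := fun x y => by
              simp only [adams_eq_powerSum]
              exact (congrArg _ (_root_.map_mul T x y)).trans (OnePlus.powerSum_mul hn _ _)
            map_zero' := map_zero (AddMonoidHom.mk' (adams n) hadd)
            map_add' := hadd }, fun _ => rfl, fun k x => ?_⟩
  change adams n (LambdaRing.lam k x) = LambdaRing.lam k (adams n x)
  rw [adams_eq_powerSum, h.map_lam, ← OnePlus.coeff_newton_lam hn, ← coeff_lambdaT k (adams n x)]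
  congr 1
  -- Being a ring homomorphism, `λ_t` commutes with the integral Newton polynomial, so `λ_t(Ψ^n x)`
  -- is that polynomial in the series `Λ^i(λ_t x)`.
  refine Eq.trans ?_ (OnePlus.map_aeval_int T _ (newtonPoly n)).symm
  congr 2
  funext i
  exact (h.map_lam _ x).symm

end SpecialRings

/-! ### Tensor powers, the action of the rational group algebra, and direct summands cut out by
idempotents. -/

section TensorPowers

variable {R S : Type u} [CommRing R] [CommRing S] {σ : R →+* S}
  {M N T T' : Type u} [AddCommGroup M] [Module R M] [AddCommGroup N] [Module S N]
  [AddCommGroup T] [Module R T] [AddCommGroup T'] [Module S T']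

/-- The tensor power of a module with factors indexed by `ι`. -/
abbrev TPow (R : Type u) [CommRing R] (ι : Type) (M : Type u) [AddCommGroup M] [Module R M] :
    Type u := ⨂[R] _ : ι, M

theorem exists_tmap (ι : Type) (f : M →ₛₗ[σ] N) : ∃ F : TPow R ι M →ₛₗ[σ] TPow S ι N,
    ∀ v : ι → M, F (PiTensorProduct.tprod R v) = PiTensorProduct.tprod S fun i => f (v i) := by
  -- Viewing the target as an `R`-module along `σ` turns the semilinear problem into an
  -- `R`-multilinear one.
  let _ : Module R (TPow S ι N) := Module.compHom _ σ
  have h : ∀ [DecidableEq ι] (v : ι → M) i z, (fun j => f (Function.update v i z j)) =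
      Function.update (fun j => f (v j)) i (f z) := fun v i z => by
    ext j; by_cases hj : j = i
    · subst hj; simp
    · simp [hj]
  let a : MultilinearMap R (fun _ : ι => M) (TPow S ι N) :=
    { toFun := fun v => PiTensorProduct.tprod S fun i => f (v i)
      map_update_add' := fun {_} v i x y => by
        simp only [h, map_add]
        exact (PiTensorProduct.tprod S).map_update_add _ _ _ _
      map_update_smul' := fun {_} v i r x => by
        simp only [h, map_smulₛₗ]
        exact (PiTensorProduct.tprod S).map_update_smul _ _ _ _ }
  let F := PiTensorProduct.lift a
  exact ⟨{ toFun := F, map_add' := F.map_add, map_smul' := fun r x => F.map_smul r x },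
    fun v => PiTensorProduct.lift.tprod v⟩

/-- The semilinear map on tensor powers induced by a semilinear map. -/
noncomputable def tmap (ι : Type) (f : M →ₛₗ[σ] N) : TPow R ι M →ₛₗ[σ] TPow S ι N :=
  (exists_tmap ι f).choose

theorem tmap_tprod {ι : Type} (f : M →ₛₗ[σ] N) (v : ι → M) :
    tmap ι f (PiTensorProduct.tprod R v) = PiTensorProduct.tprod S fun i => f (v i) :=
  (exists_tmap ι f).choose_spec v

theorem tpow_induction {ι : Type} {p : TPow R ι M → Prop} (x : TPow R ι M)
    (hι : ∀ v, p (PiTensorProduct.tprod R v)) (ha : ∀ x y, p x → p y → p (x + y))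
    (hs : ∀ (r : R) x, p x → p (r • x)) : p x :=
  PiTensorProduct.induction_on x (fun r v => hs r _ (hι v)) ha

theorem semilinear_ext_tprod {ι : Type} {Q : Type u} [AddCommGroup Q] [Module S Q]
    {F G : TPow R ι M →ₛₗ[σ] Q}
    (h : ∀ v, F (PiTensorProduct.tprod R v) = G (PiTensorProduct.tprod R v)) : F = G := by
  ext x
  induction x using tpow_induction with
  | hι v => exact h v
  | ha x y hx hy => rw [map_add, map_add, hx, hy]
  | hs r x hx => rw [map_smulₛₗ, map_smulₛₗ, hx]

theorem tmap_tmap {S' : Type u} [CommRing S'] {τ : S →+* S'} {υ : R →+* S'} {P : Type u}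
    [AddCommGroup P] [Module S' P] {ι : Type} {f : M →ₛₗ[σ] N} {g : N →ₛₗ[τ] P} {h : M →ₛₗ[υ] P}
    (hυ : ∀ r, υ r = τ (σ r)) (hh : ∀ m, h m = g (f m)) (x : TPow R ι M) :
    tmap ι g (tmap ι f x) = tmap ι h x := by
  induction x using tpow_induction with
  | hι v => simp only [tmap_tprod, hh]
  | ha x y hx hy => simp only [map_add, hx, hy]
  | hs r x hx => simp only [map_smulₛₗ, hx, hυ]

theorem tmap_id {ι : Type} (x : TPow R ι M) : tmap ι (LinearMap.id : M →ₗ[R] M) x = x := by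
  induction x using tpow_induction with
  | hι v => simp only [tmap_tprod, LinearMap.id_apply]
  | ha x y hx hy => simp only [map_add, hx, hy]
  | hs r x hx => simp only [map_smulₛₗ, hx, RingHom.id_apply]

/-- The action of permutations on a tensor power. -/
noncomputable def permAct (R : Type u) [CommRing R] (ι : Type) (M : Type u) [AddCommGroup M]
    [Module R M] : Equiv.Perm ι →* Module.End R (TPow R ι M) where
  toFun s := (PiTensorProduct.reindex R (fun _ : ι => M) s).toLinearMap
  map_one' := by
    refine semilinear_ext_tprod fun v => ?_
    exact PiTensorProduct.reindex_tprod _ _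
  map_mul' s t := by
    refine semilinear_ext_tprod fun v => ?_
    have h : ∀ (q : Equiv.Perm ι) (w : ι → M), PiTensorProduct.reindex R (fun _ : ι => M) q
        (PiTensorProduct.tprod R w) = PiTensorProduct.tprod R fun i => w (q.symm i) :=
      fun q w => PiTensorProduct.reindex_tprod q w
    rw [Module.End.mul_apply]
    simp only [LinearEquiv.coe_coe, h]
    rfl

theorem permAct_tprod {ι : Type} (s : Equiv.Perm ι) (v : ι → M) :
    permAct R ι M s (PiTensorProduct.tprod R v) =
      PiTensorProduct.tprod R fun i => v (s.symm i) :=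
  PiTensorProduct.reindex_tprod s v

theorem tmap_permAct {ι : Type} (f : M →ₛₗ[σ] N) (s : Equiv.Perm ι) (x : TPow R ι M) :
    tmap ι f (permAct R ι M s x) = permAct S ι N s (tmap ι f x) := by
  induction x using tpow_induction with
  | hι v => simp only [tmap_tprod, permAct_tprod]
  | ha x y hx hy => simp only [map_add, hx, hy]
  | hs r x hx => simp only [map_smulₛₗ, hx, RingHom.id_apply]

/-- Relabelling the factors of a tensor power. -/
noncomputable def relabel (R : Type u) [CommRing R] (M : Type u) [AddCommGroup M] [Module R M]
    {ι κ : Type} (ε : ι ≃ κ) : TPow R ι M ≃ₗ[R] TPow R κ M :=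
  PiTensorProduct.reindex R (fun _ : ι => M) ε

theorem relabel_tprod {ι κ : Type} (ε : ι ≃ κ) (v : ι → M) : relabel R M ε (PiTensorProduct.tprod R v) =
    PiTensorProduct.tprod R fun k => v (ε.symm k) :=
  PiTensorProduct.reindex_tprod ε v

theorem tmap_relabel {ι κ : Type} (ε : ι ≃ κ) (f : M →ₛₗ[σ] N) (x : TPow R ι M) :
    tmap κ f (relabel R M ε x) = relabel S N ε (tmap ι f x) := by
  induction x using tpow_induction with
  | hι v => simp only [relabel_tprod, tmap_tprod]
  | ha x y hx hy => simp only [map_add, hx, hy]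
  | hs r x hx => simp only [map_smulₛₗ, hx, RingHom.id_apply]

variable [Algebra ℚ R] [Algebra ℚ S]

/-- The action of the rational group algebra of the symmetric group on a tensor power. -/
noncomputable def act (R : Type u) [CommRing R] [Algebra ℚ R] (ι : Type) (M : Type u)
    [AddCommGroup M] [Module R M] :
    MonoidAlgebra ℚ (Equiv.Perm ι) →+* Module.End R (TPow R ι M) :=
  (MonoidAlgebra.lift R (Module.End R (TPow R ι M)) (Equiv.Perm ι) (permAct R ι M)).toRingHom.comp
    (MonoidAlgebra.mapRingHom _ (algebraMap ℚ R))

theorem act_single {ι : Type} (s : Equiv.Perm ι) (c : ℚ) :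
    act R ι M (MonoidAlgebra.single s c) = algebraMap ℚ R c • permAct R ι M s := by
  rw [act, RingHom.comp_apply, MonoidAlgebra.mapRingHom_single]
  exact MonoidAlgebra.lift_single _ _ _

theorem map_algebraMap_rat (σ : R →+* S) (c : ℚ) : σ (algebraMap ℚ R c) = algebraMap ℚ S c :=
  RingHom.congr_fun (Subsingleton.elim (σ.comp (algebraMap ℚ R)) (algebraMap ℚ S)) c

/-- Every ring homomorphism between `ℚ`-algebras fixes the rational coefficients, and permuting
factors is natural. For this reason constructions with the group algebra will be compatible with
restriction of sections. -/
theorem tmap_act {ι : Type} (f : M →ₛₗ[σ] N) (e : MonoidAlgebra ℚ (Equiv.Perm ι))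
    (x : TPow R ι M) : tmap ι f (act R ι M e x) = act S ι N e (tmap ι f x) := by
  induction e using MonoidAlgebra.induction_linear with
  | zero => simp
  | add a b ha hb => simp only [map_add, LinearMap.add_apply, ha, hb]
  | single s c =>
    simp only [act_single, LinearMap.smul_apply, map_smulₛₗ, tmap_permAct, map_algebraMap_rat]

/-- A module `T` is presented as a direct summand of a tensor power of `M`, namely as the image of
the idempotent `e` of the group algebra. -/
structure Retract (R : Type u) [CommRing R] [Algebra ℚ R] (M T : Type u) [AddCommGroup M]
    [Module R M] [AddCommGroup T] [Module R T] (ι : Type)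
    (e : MonoidAlgebra ℚ (Equiv.Perm ι)) where
  i : T →ₗ[R] TPow R ι M
  p : TPow R ι M →ₗ[R] T
  p_i : ∀ x, p (i x) = x
  i_p : ∀ x, i (p x) = act R ι M e x

namespace Retract

/-- The semilinear map `F` is the one induced by `f` on direct summands of tensor powers. -/
def Compat {ι : Type} {e : MonoidAlgebra ℚ (Equiv.Perm ι)} (ρ : Retract R M T ι e)
    (ρ' : Retract S N T' ι e) (f : M →ₛₗ[σ] N) (F : T →ₛₗ[σ] T') : Prop :=
  ∀ x, ρ'.i (F x) = tmap ι f (ρ.i x)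

/-- Compatibility with the inclusions forces compatibility with the projections, because source and
target are cut out by the same element `e`, which commutes with `tmap`. -/
theorem Compat.p {ι : Type} {e : MonoidAlgebra ℚ (Equiv.Perm ι)} {ρ : Retract R M T ι e}
    {ρ' : Retract S N T' ι e} {f : M →ₛₗ[σ] N} {F : T →ₛₗ[σ] T'} (h : Compat ρ ρ' f F)
    (y : TPow R ι M) : F (ρ.p y) = ρ'.p (tmap ι f y) := by
  rw [← ρ'.p_i (F (ρ.p y)), h, ρ.i_p, tmap_act, ← ρ'.i_p, ρ'.p_i]

end Retract

/-- The idempotent of the group algebra cutting out antisymmetric tensors. -/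
noncomputable def antisymmetrizer (k : ℕ) : MonoidAlgebra ℚ (Equiv.Perm (Fin k)) :=
  ∑ s : Equiv.Perm (Fin k), MonoidAlgebra.single s
    ((k.factorial : ℚ)⁻¹ * ((Equiv.Perm.sign s : ℤˣ) : ℤ))

/-- The antisymmetrization of a wedge product. -/
noncomputable def extIncl (R M : Type u) [CommRing R] [Algebra ℚ R] [AddCommGroup M] [Module R M]
    (k : ℕ) : (⋀[R]^k M) →ₗ[R] TPow R (Fin k) M :=
  algebraMap ℚ R (k.factorial : ℚ)⁻¹ • exteriorPower.alternatingMapLinearEquiv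
    (MultilinearMap.alternatization (PiTensorProduct.tprod R))

/-- The quotient map from a tensor power to an exterior power. -/
noncomputable def extQuot (R M : Type u) [CommRing R] [AddCommGroup M] [Module R M]
    (k : ℕ) : TPow R (Fin k) M →ₗ[R] (⋀[R]^k M) :=
  PiTensorProduct.lift (exteriorPower.ιMulti R k).toMultilinearMap

theorem extQuot_tprod (k : ℕ) (v : Fin k → M) :
    extQuot R M k (PiTensorProduct.tprod R v) = exteriorPower.ιMulti R k v :=
  PiTensorProduct.lift.tprod v

theorem extIncl_ιMulti (k : ℕ) (v : Fin k → M) :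
    extIncl R M k (exteriorPower.ιMulti R k v) = algebraMap ℚ R (k.factorial : ℚ)⁻¹ •
      ∑ s : Equiv.Perm (Fin k), Equiv.Perm.sign s • PiTensorProduct.tprod R fun i => v (s i) := by
  rw [extIncl, LinearMap.smul_apply, exteriorPower.alternatingMapLinearEquiv_apply_ιMulti,
    MultilinearMap.alternatization_apply]
  rfl

theorem algebraMap_factorial_inv (k : ℕ) :
    algebraMap ℚ R (k.factorial : ℚ)⁻¹ * (k.factorial : R) = 1 := by
  have h : (k.factorial : R) = algebraMap ℚ R k.factorial := by simp
  rw [h, ← map_mul, inv_mul_cancel₀ (by exact_mod_cast k.factorial_ne_zero), map_one]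

/-- Each of the `k!` signed rearrangements maps to the same wedge product, the two signs cancelling;
the factor `1/k!` normalises. -/
theorem extQuot_extIncl (k : ℕ) (x : ⋀[R]^k M) : extQuot R M k (extIncl R M k x) = x := by
  induction x using extPow_induction with
  | hι v =>
    rw [extIncl_ιMulti, map_smul, map_sum]
    have h : ∀ s : Equiv.Perm (Fin k), extQuot R M k (Equiv.Perm.sign s •
        PiTensorProduct.tprod R fun i => v (s i)) = exteriorPower.ιMulti R k v := fun s => by
      rw [Units.smul_def, map_zsmul, extQuot_tprod]
      have := (exteriorPower.ιMulti R k).map_perm v s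
      rw [show (fun i => v (s i)) = v ∘ s from rfl, this, ← Units.smul_def, smul_smul,
        Int.units_mul_self, one_smul]
    rw [Finset.sum_congr rfl fun s _ => h s, Finset.sum_const, Finset.card_univ, Fintype.card_perm,
      Fintype.card_fin, ← Nat.cast_smul_eq_nsmul R, smul_smul, algebraMap_factorial_inv, one_smul]
  | hz => simp
  | ha x y hx hy => simp only [map_add, hx, hy]
  | hs r x hx => simp only [map_smul, hx]

theorem extIncl_extQuot (k : ℕ) (x : TPow R (Fin k) M) :
    extIncl R M k (extQuot R M k x) = act R (Fin k) M (antisymmetrizer k) x := by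
  induction x using tpow_induction with
  | hι v =>
    -- A permutation acts on tensors through its inverse on indices, so the sum is reindexed by
    -- inversion, which keeps the sign.
    rw [extQuot_tprod, extIncl_ιMulti, antisymmetrizer, map_sum, LinearMap.sum_apply,
      Finset.smul_sum, ← Equiv.sum_comp (Equiv.inv (Equiv.Perm (Fin k)))]
    refine Finset.sum_congr rfl fun s _ => ?_
    rw [act_single, LinearMap.smul_apply, permAct_tprod, Equiv.inv_apply, Equiv.Perm.sign_inv,
      map_mul, mul_smul]
    congr 1
    rw [Units.smul_def, map_intCast, Int.cast_smul_eq_zsmul]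
    rfl
  | ha x y hx hy => simp only [map_add, hx, hy]
  | hs r x hx => simp only [map_smul, hx]

theorem tmap_extIncl (k : ℕ) (f : M →ₛₗ[σ] N) (x : ⋀[R]^k M) :
    extIncl S N k (extMap k f x) = tmap (Fin k) f (extIncl R M k x) := by
  induction x using extPow_induction with
  | hι v =>
    rw [extMap_ιMulti, extIncl_ιMulti, extIncl_ιMulti, map_smulₛₗ, map_algebraMap_rat, map_sum]
    congr 1
    refine Finset.sum_congr rfl fun s _ => ?_
    rw [Units.smul_def, Units.smul_def, map_zsmul, tmap_tprod]
  | hz => simp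
  | ha x y hx hy => simp only [map_add, hx, hy]
  | hs r x hx => simp only [map_smulₛₗ, hx, RingHom.id_apply]

/-- The exterior power as a summand of the tensor power. -/
noncomputable def Retract.ext (R M : Type u) [CommRing R] [Algebra ℚ R] [AddCommGroup M]
    [Module R M] (k : ℕ) : Retract R M (⋀[R]^k M) (Fin k) (antisymmetrizer k) where
  i := extIncl R M k
  p := extQuot R M k
  p_i := extQuot_extIncl k
  i_p := extIncl_extQuot k

theorem Retract.ext_compat (k : ℕ) (f : M →ₛₗ[σ] N) :
    Compat (Retract.ext R M k) (Retract.ext S N k) f (extMap k f) := tmap_extIncl k f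

/-- The trivial module as the tensor power with no factors. -/
noncomputable def Retract.unit (R M : Type u) [CommRing R] [Algebra ℚ R] [AddCommGroup M]
    [Module R M] : Retract R M R (Fin 0) 1 where
  i := (PiTensorProduct.isEmptyEquiv (Fin 0)).symm.toLinearMap
  p := (PiTensorProduct.isEmptyEquiv (Fin 0)).toLinearMap
  p_i x := by simp
  i_p x := by simp

theorem Retract.unit_compat (f : M →ₛₗ[σ] N) :
    Compat (Retract.unit R M) (Retract.unit S N) f σ.toSemilinearMap := by
  intro x
  apply (PiTensorProduct.isEmptyEquiv (R := S) (s := fun _ : Fin 0 => N) (Fin 0)).injective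
  have h : ∀ r : R, (PiTensorProduct.isEmptyEquiv (R := R) (s := fun _ : Fin 0 => M)
      (Fin 0)).symm r = r • PiTensorProduct.tprod R (fun i => i.elim0) := fun r => by
    rw [LinearEquiv.symm_apply_eq, map_smul, PiTensorProduct.isEmptyEquiv_apply_tprod]
    simp
  simp only [unit, LinearEquiv.coe_coe, LinearEquiv.apply_symm_apply, h, map_smulₛₗ, tmap_tprod,
    PiTensorProduct.isEmptyEquiv_apply_tprod]
  simp

section Reindex

variable {ι κ : Type} (ε : ι ≃ κ)

/-- Relabelling in the group algebra of the symmetric group. -/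
noncomputable def permAlgCongr {ι κ : Type} (ε : ι ≃ κ) :
    MonoidAlgebra ℚ (Equiv.Perm ι) →+* MonoidAlgebra ℚ (Equiv.Perm κ) :=
  MonoidAlgebra.mapDomainRingHom ℚ (ε.permCongrHom : Equiv.Perm ι →* Equiv.Perm κ)

theorem act_permAlgCongr (e : MonoidAlgebra ℚ (Equiv.Perm ι)) (x : TPow R ι M) :
    act R κ M (permAlgCongr ε e) (relabel R M ε x) = relabel R M ε (act R ι M e x) := by
  induction e using MonoidAlgebra.induction_linear with
  | zero => simp
  | add a b ha hb => simp only [map_add, LinearMap.add_apply, ha, hb]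
  | single s c =>
    have : permAlgCongr ε (MonoidAlgebra.single s c) =
        MonoidAlgebra.single (ε.permCongr s) c := by
      simp [permAlgCongr]
    rw [this, act_single, act_single, LinearMap.smul_apply, LinearMap.smul_apply, map_smul]
    congr 1
    induction x using tpow_induction with
    | hι v =>
      rw [relabel_tprod, permAct_tprod, permAct_tprod, relabel_tprod]
      refine congrArg _ (funext fun k => congrArg v ?_)
      exact ε.symm_apply_apply _
    | ha x y hx hy => simp only [map_add, hx, hy]
    | hs r x hx => simp only [map_smul, hx]

/-- Relabelling the factors in a presentation as a summand of a tensor power. -/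
noncomputable def Retract.congr {e : MonoidAlgebra ℚ (Equiv.Perm ι)} (ρ : Retract R M T ι e) :
    Retract R M T κ (permAlgCongr ε e) where
  i := (relabel R M ε).toLinearMap ∘ₗ ρ.i
  p := ρ.p ∘ₗ (relabel R M ε).symm.toLinearMap
  p_i x := by simp [ρ.p_i]
  i_p x := by
    simp only [LinearMap.comp_apply, LinearEquiv.coe_coe, ρ.i_p, ← act_permAlgCongr,
      LinearEquiv.apply_symm_apply]

theorem Retract.Compat.congr {e : MonoidAlgebra ℚ (Equiv.Perm ι)} {ρ : Retract R M T ι e}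
    {ρ' : Retract S N T' ι e} {f : M →ₛₗ[σ] N} {F : T →ₛₗ[σ] T'} (h : Compat ρ ρ' f F) :
    Compat (ρ.congr ε) (ρ'.congr ε) f F := by
  intro x
  simp only [Retract.congr, LinearMap.comp_apply, LinearEquiv.coe_coe, h x, tmap_relabel]

end Reindex

section Tensor

variable {ι κ : Type} {U : Type u} [AddCommGroup U] [Module R U] {U' : Type u} [AddCommGroup U']
  [Module S U']

/-- The product of commuting group algebra elements acting on two groups of factors. -/
noncomputable def boxProd (e : MonoidAlgebra ℚ (Equiv.Perm ι)) (e' : MonoidAlgebra ℚ (Equiv.Perm κ)) :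
    MonoidAlgebra ℚ (Equiv.Perm (ι ⊕ κ)) :=
  MonoidAlgebra.mapDomainRingHom ℚ
      ((Equiv.Perm.sumCongrHom ι κ).comp (MonoidHom.inl _ _)) e *
    MonoidAlgebra.mapDomainRingHom ℚ
      ((Equiv.Perm.sumCongrHom ι κ).comp (MonoidHom.inr _ _)) e'

theorem act_boxProd (e : MonoidAlgebra ℚ (Equiv.Perm ι)) (e' : MonoidAlgebra ℚ (Equiv.Perm κ))
    (x : TPow R ι M) (y : TPow R κ M) :
    act R (ι ⊕ κ) M (boxProd e e') (PiTensorProduct.tmulEquiv R M (x ⊗ₜ y)) =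
      PiTensorProduct.tmulEquiv R M (act R ι M e x ⊗ₜ act R κ M e' y) := by
  rw [boxProd, map_mul, Module.End.mul_apply]
  have h1 : ∀ x : TPow R ι M, act R (ι ⊕ κ) M (MonoidAlgebra.mapDomainRingHom ℚ
      ((Equiv.Perm.sumCongrHom ι κ).comp (MonoidHom.inr _ _)) e')
      (PiTensorProduct.tmulEquiv R M (x ⊗ₜ y)) =
      PiTensorProduct.tmulEquiv R M (x ⊗ₜ act R κ M e' y) := by
    intro x
    induction e' using MonoidAlgebra.induction_linear with
    | zero => simp
    | add a b ha hb => simp only [map_add, LinearMap.add_apply, ha, hb, TensorProduct.tmul_add]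
    | single s c =>
      rw [MonoidAlgebra.mapDomainRingHom_apply, MonoidAlgebra.mapDomain_single, act_single,
        act_single, LinearMap.smul_apply, LinearMap.smul_apply, TensorProduct.tmul_smul, map_smul]
      congr 1
      induction x using tpow_induction with
      | ha x y hx hy => simp only [map_add, TensorProduct.add_tmul, hx, hy]
      | hs r x hx => simp only [map_smul, ← TensorProduct.smul_tmul', hx]
      | hι v =>
      induction y using tpow_induction with
      | ha x y hx hy => simp only [map_add, TensorProduct.tmul_add, hx, hy]
      | hs r x hx => simp only [map_smul, TensorProduct.tmul_smul, hx]
      | hι w =>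
        rw [permAct_tprod, PiTensorProduct.tmulEquiv_apply, PiTensorProduct.tmulEquiv_apply,
          permAct_tprod]
        congr 1
        funext j
        rcases j with j | j <;> rfl
  have h2 : ∀ y : TPow R κ M, act R (ι ⊕ κ) M (MonoidAlgebra.mapDomainRingHom ℚ
      ((Equiv.Perm.sumCongrHom ι κ).comp (MonoidHom.inl _ _)) e)
      (PiTensorProduct.tmulEquiv R M (x ⊗ₜ y)) =
      PiTensorProduct.tmulEquiv R M (act R ι M e x ⊗ₜ y) := by
    intro y
    induction e using MonoidAlgebra.induction_linear with
    | zero => simp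
    | add a b ha hb => simp only [map_add, LinearMap.add_apply, ha, hb, TensorProduct.add_tmul]
    | single s c =>
      rw [MonoidAlgebra.mapDomainRingHom_apply, MonoidAlgebra.mapDomain_single, act_single,
        act_single, LinearMap.smul_apply, LinearMap.smul_apply, ← TensorProduct.smul_tmul',
        map_smul]
      congr 1
      induction x using tpow_induction with
      | ha x y hx hy => simp only [map_add, TensorProduct.add_tmul, hx, hy]
      | hs r x hx => simp only [map_smul, ← TensorProduct.smul_tmul', hx]
      | hι v =>
      induction y using tpow_induction with
      | ha x y hx hy => simp only [map_add, TensorProduct.tmul_add, hx, hy]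
      | hs r x hx => simp only [map_smul, TensorProduct.tmul_smul, hx]
      | hι w =>
        rw [permAct_tprod, PiTensorProduct.tmulEquiv_apply, PiTensorProduct.tmulEquiv_apply,
          permAct_tprod]
        congr 1
        funext j
        rcases j with j | j <;> rfl
  rw [h1, h2]

theorem tmap_tmulEquiv (f : M →ₛₗ[σ] N) (z : TPow R ι M ⊗[R] TPow R κ M) :
    tmap (ι ⊕ κ) f (PiTensorProduct.tmulEquiv R M z) =
      PiTensorProduct.tmulEquiv S N (TensorProduct.map (tmap ι f) (tmap κ f) z) := by
  induction z with
  | zero => simp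
  | add x y hx hy => simp only [map_add, hx, hy]
  | tmul x y =>
  induction x using tpow_induction with
  | ha x y hx hy => simp only [map_add, TensorProduct.add_tmul, hx, hy]
  | hs r x hx => simp only [map_smulₛₗ, ← TensorProduct.smul_tmul', hx, RingHom.id_apply]
  | hι v =>
  induction y using tpow_induction with
  | ha x y hx hy => simp only [map_add, TensorProduct.tmul_add, hx, hy]
  | hs r x hx => simp only [map_smulₛₗ, TensorProduct.tmul_smul, hx, RingHom.id_apply]
  | hι w =>
    rw [PiTensorProduct.tmulEquiv_apply, tmap_tprod, TensorProduct.map_tmul, tmap_tprod, tmap_tprod,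
      PiTensorProduct.tmulEquiv_apply]
    congr 1
    funext j
    rcases j with j | j <;> rfl

/-- Tensor products of summands of tensor powers. -/
noncomputable def Retract.tensor {e : MonoidAlgebra ℚ (Equiv.Perm ι)}
    {e' : MonoidAlgebra ℚ (Equiv.Perm κ)} (ρ : Retract R M T ι e) (ρ' : Retract R M U κ e') :
    Retract R M (T ⊗[R] U) (ι ⊕ κ) (boxProd e e') where
  i := (PiTensorProduct.tmulEquiv R M).toLinearMap ∘ₗ TensorProduct.map ρ.i ρ'.i
  p := TensorProduct.map ρ.p ρ'.p ∘ₗ (PiTensorProduct.tmulEquiv R M).symm.toLinearMap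
  p_i x := by
    simp only [LinearMap.comp_apply, LinearEquiv.coe_coe, LinearEquiv.symm_apply_apply]
    induction x with
    | zero => simp
    | add x y hx hy => simp only [map_add, hx, hy]
    | tmul x y => simp [ρ.p_i, ρ'.p_i]
  i_p x := by
    obtain ⟨z, rfl⟩ := (PiTensorProduct.tmulEquiv R M).surjective x
    simp only [LinearMap.comp_apply, LinearEquiv.coe_coe, LinearEquiv.symm_apply_apply]
    induction z with
    | zero => simp
    | add x y hx hy => simp only [map_add, hx, hy]
    | tmul x y => rw [act_boxProd]; simp [ρ.i_p, ρ'.i_p]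

theorem Retract.Compat.tensor {e : MonoidAlgebra ℚ (Equiv.Perm ι)}
    {e' : MonoidAlgebra ℚ (Equiv.Perm κ)} {ρ : Retract R M T ι e} {ρ' : Retract S N T' ι e}
    {μ : Retract R M U κ e'} {μ' : Retract S N U' κ e'} {f : M →ₛₗ[σ] N} {F : T →ₛₗ[σ] T'}
    {G : U →ₛₗ[σ] U'} (h : Compat ρ ρ' f F) (h' : Compat μ μ' f G) :
    Compat (ρ.tensor μ) (ρ'.tensor μ') f (TensorProduct.map F G) := by
  intro x
  simp only [Retract.tensor, LinearMap.comp_apply, LinearEquiv.coe_coe, tmap_tmulEquiv]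
  congr 1
  induction x with
  | zero => simp
  | add x y hx hy => simp only [map_add, hx, hy]
  | tmul x y => simp only [TensorProduct.map_tmul, h x, h' y]

end Tensor

end TensorPowers

/-! ### Nested tensor powers and exterior powers of summands. -/

section Plethysm

variable {R S : Type u} [CommRing R] [CommRing S] {σ : R →+* S}
  {M N T T' : Type u} [AddCommGroup M] [Module R M] [AddCommGroup N] [Module S N]
  [AddCommGroup T] [Module R T] [AddCommGroup T'] [Module S T']

/-- Induction on the number of blocks: the last block is split off, the others are flattened by
induction, and the pieces are put together again. -/
theorem exists_nestEquiv (R : Type u) [CommRing R] (M : Type u) [AddCommGroup M] [Module R M]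
    (κ : Type) (m : ℕ) :
    ∃ A : TPow R (Fin m) (TPow R κ M) ≃ₗ[R] TPow R (Fin m × κ) M, ∀ v : Fin m × κ → M,
      A (PiTensorProduct.tprod R fun j => PiTensorProduct.tprod R fun i => v (j, i)) =
        PiTensorProduct.tprod R v := by
  induction m with
  | zero =>
    refine ⟨PiTensorProduct.isEmptyEquiv (Fin 0) ≪≫ₗ
      (PiTensorProduct.isEmptyEquiv (Fin 0 × κ)).symm, fun v => ?_⟩
    rw [LinearEquiv.trans_apply, LinearEquiv.symm_apply_eq,
      PiTensorProduct.isEmptyEquiv_apply_tprod, PiTensorProduct.isEmptyEquiv_apply_tprod]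
  | succ m ih =>
    obtain ⟨A, hA⟩ := ih
    let δ : Fin (m + 1) ≃ Fin m ⊕ Fin 1 := finSumFinEquiv.symm
    let δ' : (Fin m × κ) ⊕ κ ≃ Fin (m + 1) × κ :=
      (Equiv.sumCongr (Equiv.refl _) (Equiv.uniqueProd κ (Fin 1)).symm).trans
        ((Equiv.sumProdDistrib _ _ _).symm.trans (Equiv.prodCongr δ.symm (Equiv.refl κ)))
    let B := relabel R (TPow R κ M) δ ≪≫ₗ (PiTensorProduct.tmulEquiv R (TPow R κ M)).symm ≪≫ₗ
      TensorProduct.congr A (PiTensorProduct.subsingletonEquiv (R := R)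
        (s := fun _ => TPow R κ M) (0 : Fin 1)) ≪≫ₗ
      PiTensorProduct.tmulEquiv R M ≪≫ₗ relabel R M δ'
    refine ⟨B, fun v => ?_⟩
    have h1 : (PiTensorProduct.tmulEquiv R (TPow R κ M)).symm
        (PiTensorProduct.tprod R fun k => (PiTensorProduct.tprod R fun i => v (δ.symm k, i))) =
        (PiTensorProduct.tprod R fun k => (PiTensorProduct.tprod R fun i =>
          v (δ.symm (Sum.inl k), i))) ⊗ₜ
        (PiTensorProduct.tprod R fun k => (PiTensorProduct.tprod R fun i =>
          v (δ.symm (Sum.inr k), i))) := by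
      rw [LinearEquiv.symm_apply_eq, PiTensorProduct.tmulEquiv_apply]
      congr 1
      funext j
      rcases j with j | j <;> rfl
    simp only [B, LinearEquiv.trans_apply]
    rw [relabel_tprod, h1, TensorProduct.congr_tmul]
    have h2 := hA fun q => v (δ.symm (Sum.inl q.1), q.2)
    simp only at h2
    rw [h2, PiTensorProduct.subsingletonEquiv_apply_tprod, PiTensorProduct.tmulEquiv_apply,
      relabel_tprod]
    congr 1
    funext q
    obtain ⟨⟨j, i⟩, rfl⟩ | ⟨i, rfl⟩ : (∃ a, δ' (Sum.inl a) = q) ∨ ∃ a, δ' (Sum.inr a) = q := by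
      obtain ⟨a | a, h⟩ := δ'.surjective q
      · exact Or.inl ⟨a, h⟩
      · exact Or.inr ⟨a, h⟩
    · rw [Equiv.symm_apply_apply]; rfl
    · rw [Equiv.symm_apply_apply]; rfl

/-- A tensor power of a tensor power is a tensor power. -/
noncomputable def nestEquiv (R : Type u) [CommRing R] (M : Type u) [AddCommGroup M] [Module R M]
    (κ : Type) (m : ℕ) : TPow R (Fin m) (TPow R κ M) ≃ₗ[R] TPow R (Fin m × κ) M :=
  (exists_nestEquiv R M κ m).choose

theorem nestEquiv_tprod {κ : Type} {m : ℕ} (v : Fin m × κ → M) :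
    nestEquiv R M κ m (PiTensorProduct.tprod R fun j => PiTensorProduct.tprod R fun i => v (j, i)) =
        PiTensorProduct.tprod R v :=
  (exists_nestEquiv R M κ m).choose_spec v

/-- Pure tensors of pure tensors suffice, since flattening carries them onto the pure tensors of the
long tensor power. -/
theorem nest_induction {κ : Type} {m : ℕ} {p : TPow R (Fin m) (TPow R κ M) → Prop}
    (x : TPow R (Fin m) (TPow R κ M))
    (hι : ∀ v : Fin m × κ → M, p (PiTensorProduct.tprod R fun j => PiTensorProduct.tprod R fun i =>
      v (j, i))) (ha : ∀ x y, p x → p y → p (x + y))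
    (hs : ∀ (r : R) x, p x → p (r • x)) : p x := by
  obtain ⟨y, rfl⟩ := (nestEquiv R M κ m).symm.surjective x
  induction y using tpow_induction with
  | hι v =>
    have := nestEquiv_tprod (R := R) v
    rw [← LinearEquiv.eq_symm_apply] at this
    rw [← this]
    exact hι v
  | ha x y hx hy => rw [map_add]; exact ha _ _ hx hy
  | hs r x hx => rw [map_smul]; exact hs _ _ hx

theorem tmap_nestEquiv {κ : Type} {m : ℕ} (f : M →ₛₗ[σ] N) (x : TPow R (Fin m) (TPow R κ M)) :
    tmap (Fin m × κ) f (nestEquiv R M κ m x) =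
      nestEquiv S N κ m (tmap (Fin m) (tmap κ f) x) := by
  induction x using nest_induction with
  | hι v =>
    rw [nestEquiv_tprod, tmap_tprod, tmap_tprod]
    simp only [tmap_tprod]
    exact (nestEquiv_tprod fun q => f (v q)).symm
  | ha x y hx hy => simp only [map_add, hx, hy]
  | hs r x hx => simp only [map_smulₛₗ, hx, RingHom.id_apply]

variable [Algebra ℚ R] [Algebra ℚ S]

/-- Permutations of the blocks of factors. -/
noncomputable def blockAlg (m : ℕ) (κ : Type) :
    MonoidAlgebra ℚ (Equiv.Perm (Fin m)) →+* MonoidAlgebra ℚ (Equiv.Perm (Fin m × κ)) :=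
  MonoidAlgebra.mapDomainRingHom ℚ
    ({ toFun := fun s => Equiv.prodCongr s (Equiv.refl κ)
       map_one' := rfl
       map_mul' := fun _ _ => rfl } : Equiv.Perm (Fin m) →* Equiv.Perm (Fin m × κ))

theorem act_blockAlg {κ : Type} {m : ℕ} (e : MonoidAlgebra ℚ (Equiv.Perm (Fin m)))
    (x : TPow R (Fin m) (TPow R κ M)) :
    act R (Fin m × κ) M (blockAlg m κ e) (nestEquiv R M κ m x) =
      nestEquiv R M κ m (act R (Fin m) (TPow R κ M) e x) := by
  induction e using MonoidAlgebra.induction_linear with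
  | zero => simp
  | add a b ha hb => simp only [map_add, LinearMap.add_apply, ha, hb]
  | single s c =>
    rw [blockAlg, MonoidAlgebra.mapDomainRingHom_apply, MonoidAlgebra.mapDomain_single, act_single,
      act_single, LinearMap.smul_apply, LinearMap.smul_apply, map_smul]
    congr 1
    induction x using nest_induction with
    | hι v =>
      rw [nestEquiv_tprod, permAct_tprod, permAct_tprod]
      exact (nestEquiv_tprod fun q => v (s.symm q.1, q.2)).symm
    | ha x y hx hy => simp only [map_add, hx, hy]
    | hs r x hx => simp only [map_smul, hx]

/-- Permutations within the block of index `j`. -/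
noncomputable def slotAlg {m : ℕ} (κ : Type) (j : Fin m) :
    MonoidAlgebra ℚ (Equiv.Perm κ) →+* MonoidAlgebra ℚ (Equiv.Perm (Fin m × κ)) :=
  MonoidAlgebra.mapDomainRingHom ℚ
    ({ toFun := fun s => Equiv.prodShear (Equiv.refl _) (fun l => if l = j then s else 1)
       map_one' := by ext q <;> simp
       map_mul' := fun s t => by
         ext q
         · simp
         · by_cases h : q.1 = j <;> simp [h] } :
      Equiv.Perm κ →* Equiv.Perm (Fin m × κ))

theorem act_slotAlg {κ : Type} {m : ℕ} (j : Fin m) (e : MonoidAlgebra ℚ (Equiv.Perm κ))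
    (y : Fin m → TPow R κ M) :
    act R (Fin m × κ) M (slotAlg κ j e) (nestEquiv R M κ m (PiTensorProduct.tprod R y)) =
      nestEquiv R M κ m (PiTensorProduct.tprod R (Function.update y j (act R κ M e (y j)))) := by
  -- The claim is restated for an operator on the whole tensor power, so that it can be tested on
  -- nested pure tensors and on single permutations.
  let L : MonoidAlgebra ℚ (Equiv.Perm κ) → Module.End R (TPow R (Fin m) (TPow R κ M)) := fun e =>
    PiTensorProduct.map (Function.update (fun _ => LinearMap.id) j (act R κ M e))
  have hL : ∀ e y, L e (PiTensorProduct.tprod R y) =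
      PiTensorProduct.tprod R (Function.update y j (act R κ M e (y j))) := fun e y => by
    rw [PiTensorProduct.map_tprod]
    congr 1
    funext l
    by_cases h : l = j
    · subst h; simp
    · simp [h]
  suffices h : ∀ x, act R (Fin m × κ) M (slotAlg κ j e) (nestEquiv R M κ m x) =
      nestEquiv R M κ m (L e x) by rw [h, hL]
  intro x
  induction e using MonoidAlgebra.induction_linear with
  | zero =>
    have : L 0 = 0 := by
      refine semilinear_ext_tprod fun v => ?_
      rw [hL, map_zero, LinearMap.zero_apply, LinearMap.zero_apply]
      exact MultilinearMap.map_update_zero _ _ _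
    simp [this]
  | add a b ha hb =>
    have : L (a + b) = L a + L b := by
      refine semilinear_ext_tprod fun v => ?_
      rw [LinearMap.add_apply, hL, hL, hL, map_add, LinearMap.add_apply,
        MultilinearMap.map_update_add]
    simp only [this, map_add, LinearMap.add_apply, ha, hb]
  | single s c =>
    induction x using nest_induction with
    | hι v =>
      rw [slotAlg, MonoidAlgebra.mapDomainRingHom_apply, MonoidAlgebra.mapDomain_single, hL,
        act_single, act_single, LinearMap.smul_apply, LinearMap.smul_apply,
        MultilinearMap.map_update_smul, map_smul, nestEquiv_tprod, permAct_tprod, permAct_tprod]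
      congr 1
      have : Function.update (fun l => PiTensorProduct.tprod R fun i => v (l, i)) j
          (PiTensorProduct.tprod R fun i => v (j, s.symm i)) = fun l =>
          PiTensorProduct.tprod R fun i => (fun q : Fin m × κ =>
            v (q.1, (if q.1 = j then s else 1).symm q.2)) (l, i) := by
        funext l
        by_cases h : l = j
        · subst h; simp
        · simp only [Function.update_of_ne h, if_neg h]
          rfl
      rw [this]
      exact (nestEquiv_tprod fun q : Fin m × κ =>
        v (q.1, (if q.1 = j then s else 1).symm q.2)).symm
    | ha x y hx hy => simp only [map_add, hx, hy]
    | hs r x hx => simp only [map_smul, hx]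

/-- The product of the copies of a group algebra element acting on all blocks. -/
noncomputable def allSlots (m : ℕ) {κ : Type} (e : MonoidAlgebra ℚ (Equiv.Perm κ)) :
    MonoidAlgebra ℚ (Equiv.Perm (Fin m × κ)) :=
  ((List.finRange m).map fun j => slotAlg κ j e).prod

theorem act_allSlots {κ : Type} {m : ℕ} (e : MonoidAlgebra ℚ (Equiv.Perm κ))
    (x : TPow R (Fin m) (TPow R κ M)) :
    act R (Fin m × κ) M (allSlots m e) (nestEquiv R M κ m x) =
      nestEquiv R M κ m (tmap (Fin m) (act R κ M e) x) := by
  induction x using tpow_induction with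
  | ha x y hx hy => simp only [map_add, hx, hy]
  | hs r x hx => simp only [map_smul, hx]
  | hι y =>
    -- Without repetitions in the list, each block is still untouched when its turn comes, so `e`
    -- acts on it exactly once.
    have : ∀ l : List (Fin m), l.Nodup → act R (Fin m × κ) M
        ((l.map fun j => slotAlg κ j e).prod) (nestEquiv R M κ m (PiTensorProduct.tprod R y)) =
        nestEquiv R M κ m (PiTensorProduct.tprod R fun j =>
          if j ∈ l then act R κ M e (y j) else y j) := by
      intro l hl
      induction l with
      | nil => simp
      | cons j l ih =>
        rw [List.nodup_cons] at hl
        rw [List.map_cons, List.prod_cons, map_mul, Module.End.mul_apply, ih hl.2, act_slotAlg]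
        congr 2
        funext i
        by_cases h : i = j
        · subst h; simp [hl.1]
        · simp [h]
    rw [allSlots, this _ (List.nodup_finRange m), tmap_tprod]
    simp

/-- Exterior powers of summands of tensor powers. -/
noncomputable def Retract.extOf (m : ℕ) {κ : Type} {e : MonoidAlgebra ℚ (Equiv.Perm κ)}
    (ρ : Retract R M T κ e) : Retract R M (⋀[R]^m T) (Fin m × κ)
      (blockAlg m κ (antisymmetrizer m) * allSlots m e) where
  i := (nestEquiv R M κ m).toLinearMap ∘ₗ tmap (Fin m) ρ.i ∘ₗ (Retract.ext R T m).i
  p := (Retract.ext R T m).p ∘ₗ tmap (Fin m) ρ.p ∘ₗ (nestEquiv R M κ m).symm.toLinearMap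
  p_i x := by
    simp only [LinearMap.comp_apply, LinearEquiv.coe_coe, LinearEquiv.symm_apply_apply]
    rw [tmap_tmap (h := LinearMap.id) (fun _ => rfl) (fun m => (ρ.p_i m).symm), tmap_id,
      Retract.p_i]
  i_p x := by
    obtain ⟨y, rfl⟩ := (nestEquiv R M κ m).surjective x
    simp only [LinearMap.comp_apply, LinearEquiv.coe_coe, LinearEquiv.symm_apply_apply]
    rw [Retract.i_p, tmap_act, tmap_tmap (h := act R κ M e) (fun _ => rfl)
      (fun m => (ρ.i_p m).symm), map_mul, Module.End.mul_apply, act_allSlots, act_blockAlg]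

theorem Retract.Compat.extOf (m : ℕ) {κ : Type} {e : MonoidAlgebra ℚ (Equiv.Perm κ)}
    {ρ : Retract R M T κ e} {ρ' : Retract S N T' κ e} {f : M →ₛₗ[σ] N} {F : T →ₛₗ[σ] T'}
    (h : Compat ρ ρ' f F) : Compat (ρ.extOf m) (ρ'.extOf m) f (extMap m F) := by
  intro x
  simp only [Retract.extOf, LinearMap.comp_apply, LinearEquiv.coe_coe, tmap_nestEquiv]
  congr 1
  rw [Retract.ext_compat m F x,
    tmap_tmap (h := ρ'.i.comp F) (fun _ => rfl) (fun _ => rfl),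
    tmap_tmap (h := ρ'.i.comp F) (fun _ => rfl) (fun y => h y)]

end Plethysm

/-! ### Modules over `ℚ[G]` and their characters. -/

section Characters

variable {G : Type} [Group G]
  {V W : Type} [AddCommGroup V] [Module ℚ V] [Module (MonoidAlgebra ℚ G) V]
  [IsScalarTower ℚ (MonoidAlgebra ℚ G) V] [AddCommGroup W] [Module ℚ W]
  [Module (MonoidAlgebra ℚ G) W] [IsScalarTower ℚ (MonoidAlgebra ℚ G) W]

/-- The character of a module over the group algebra. -/
noncomputable def modChar (V : Type) [AddCommGroup V] [Module ℚ V] [Module (MonoidAlgebra ℚ G) V]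
    [IsScalarTower ℚ (MonoidAlgebra ℚ G) V] (g : G) : ℚ :=
  LinearMap.trace ℚ V (Algebra.lsmul ℚ ℚ V (MonoidAlgebra.single g 1 : MonoidAlgebra ℚ G))

theorem modChar_congr (e : V ≃ₗ[MonoidAlgebra ℚ G] W) (g : G) : modChar V g = modChar W g := by
  rw [modChar, modChar, ← LinearMap.trace_conj' _ (e.restrictScalars ℚ)]
  congr 1
  ext w
  simp [LinearEquiv.conj_apply]

theorem modChar_prod [FiniteDimensional ℚ V] [FiniteDimensional ℚ W] (g : G) :
    modChar (V × W) g = modChar V g + modChar W g := by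
  rw [modChar, modChar, modChar, ← LinearMap.trace_prodMap']
  rfl

theorem modChar_one [FiniteDimensional ℚ V] : modChar V (1 : G) = Module.finrank ℚ V := by
  rw [modChar, ← LinearMap.trace_one]
  congr 1
  rw [← MonoidAlgebra.one_def, map_one]

/-- The dimension of the space of intertwiners is an inner product of characters. So `Hom(V, W)` has
the dimension of `Hom(V, V)`, which contains the identity. -/
theorem exists_ne_zero_of_modChar_eq [Fintype G] [FiniteDimensional ℚ V] [FiniteDimensional ℚ W]
    [Nontrivial V] (h : ∀ g : G, modChar V g = modChar W g) :
    ∃ f : V →ₗ[MonoidAlgebra ℚ G] W, f ≠ 0 := by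
  let ρ := Representation.ofModule' (k := ℚ) (G := G) V
  let σ := Representation.ofModule' (k := ℚ) (G := G) W
  have : Invertible (Nat.card G : ℚ) := invertibleOfNonzero (by simp)
  have h1 := Representation.card_inv_mul_sum_char_mul_char_eq_finrank ρ σ
  have h2 := Representation.card_inv_mul_sum_char_mul_char_eq_finrank ρ ρ
  have h3 : ∀ g, σ.character g = ρ.character g := fun g => (h g).symm
  simp only [h3] at h1
  have h4 : Module.finrank ℚ (Representation.IntertwiningMap ρ σ) =
      Module.finrank ℚ (Representation.IntertwiningMap ρ ρ) := by
    exact_mod_cast h1.symm.trans h2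
  have h5 : 0 < Module.finrank ℚ (Representation.IntertwiningMap ρ ρ) := by
    have : Nontrivial (Representation.IntertwiningMap ρ ρ) := by
      obtain ⟨v, hv⟩ := exists_ne (0 : V)
      refine ⟨⟨⟨LinearMap.id, fun _ => rfl⟩, 0, fun h => hv ?_⟩⟩
      exact congrArg (fun f : Representation.IntertwiningMap ρ ρ => f.toLinearMap v) h
    exact Module.finrank_pos
  rw [← h4] at h5
  have := Module.nontrivial_of_finrank_pos h5
  obtain ⟨φ, hφ⟩ := exists_ne (0 : Representation.IntertwiningMap ρ σ)
  refine ⟨MonoidAlgebra.equivariantOfLinearOfComm φ.toLinearMap fun g v => ?_, fun h0 => hφ ?_⟩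
  · exact LinearMap.congr_fun (φ.isIntertwining' g) v
  · apply Representation.IntertwiningMap.ext
    exact LinearMap.ext fun v => LinearMap.congr_fun h0 v

/-- No classification of irreducibles is needed. A nonzero `f : V → W` identifies a complement of
its kernel with its range. The kernel and a complement of the range then have equal characters, and
the kernel is smaller than `V`. -/
theorem nonempty_equiv_of_modChar_eq [Fintype G] [FiniteDimensional ℚ V] [FiniteDimensional ℚ W]
    (h : ∀ g : G, modChar V g = modChar W g) : Nonempty (V ≃ₗ[MonoidAlgebra ℚ G] W) := by
  induction hn : Module.finrank ℚ V using Nat.strong_induction_on generalizing V W with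
  | _ n ih =>
  have hfr : Module.finrank ℚ V = Module.finrank ℚ W := by
    have := h 1
    rw [modChar_one, modChar_one] at this
    exact_mod_cast this
  rcases subsingleton_or_nontrivial V with hV | hV
  · have : Subsingleton W := by
      rw [← Module.finrank_zero_iff (R := ℚ), ← hfr, Module.finrank_zero_iff]; exact hV
    exact ⟨LinearEquiv.ofSubsingleton V W⟩
  · obtain ⟨f, hf⟩ := exists_ne_zero_of_modChar_eq h
    -- The order of the group is invertible, so Maschke's theorem provides the two complements.
    have : NeZero (Nat.card G : ℚ) := ⟨by simp⟩
    obtain ⟨C, hC⟩ := exists_isCompl (LinearMap.ker f)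
    obtain ⟨D, hD⟩ := exists_isCompl (LinearMap.range f)
    have : ∀ P : Submodule (MonoidAlgebra ℚ G) V, FiniteDimensional ℚ P := fun P =>
      FiniteDimensional.finiteDimensional_submodule (P.restrictScalars ℚ)
    have : ∀ P : Submodule (MonoidAlgebra ℚ G) W, FiniteDimensional ℚ P := fun P =>
      FiniteDimensional.finiteDimensional_submodule (P.restrictScalars ℚ)
    let e1 := Submodule.prodEquivOfIsCompl _ _ hC
    let e2 := Submodule.prodEquivOfIsCompl _ _ hD
    let e3 : C ≃ₗ[MonoidAlgebra ℚ G] LinearMap.range f :=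
      (Submodule.quotientEquivOfIsCompl _ _ hC).symm ≪≫ₗ f.quotKerEquivRange
    have hlt : Module.finrank ℚ (LinearMap.ker f) < n := by
      rw [← hn]
      have : (LinearMap.ker f).restrictScalars ℚ ≠ ⊤ := by
        rw [Ne, Submodule.restrictScalars_eq_top_iff, LinearMap.ker_eq_top]
        exact hf
      exact Submodule.finrank_lt this
    obtain ⟨e4⟩ := ih _ hlt (V := LinearMap.ker f) (W := D) (fun g => by
      have h1 := modChar_congr e1 g
      have h2 := modChar_congr e2 g
      have h3 := modChar_congr e3 g
      rw [modChar_prod] at h1 h2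
      have := h g
      linarith) rfl
    exact ⟨e1.symm ≪≫ₗ LinearEquiv.prodComm _ _ _ ≪≫ₗ LinearEquiv.prodCongr e3 e4 ≪≫ₗ e2⟩

/-- The left ideal generated by an idempotent. -/
def leftIdeal {A : Type} [Ring A] (e : A) : Submodule A A where
  carrier := {x | x * e = x}
  add_mem' {x y} hx hy := by
    change (x + y) * e = x + y
    rw [add_mul, hx, hy]
  zero_mem' := zero_mul e
  smul_mem' c x hx := by
    change c * x * e = c * x
    rw [mul_assoc, hx]

/-- Right multiplication by `e` projects the group algebra onto the left ideal, so the trace is that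
of `x ↦ g x e` on the whole algebra. In the basis of group elements, its diagonal entry at `t` is
the coefficient of `e` at `t⁻¹ g⁻¹ t`. -/
theorem modChar_leftIdeal [Fintype G] {e : MonoidAlgebra ℚ G} (he : e * e = e) (g : G) :
    modChar (leftIdeal e) g = ∑ t : G, e.coeff (t⁻¹ * g⁻¹ * t) := by
  classical
  let p : MonoidAlgebra ℚ G →ₗ[ℚ] leftIdeal e :=
    { toFun := fun x => ⟨x * e, by change x * e * e = x * e; rw [mul_assoc, he]⟩
      map_add' := fun x y => Subtype.ext (add_mul x y e)
      map_smul' := fun r x => Subtype.ext (smul_mul_assoc r x e) }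
  let L : leftIdeal e →ₗ[ℚ] leftIdeal e :=
    Algebra.lsmul ℚ ℚ (leftIdeal e) (MonoidAlgebra.single g 1 : MonoidAlgebra ℚ G)
  let i : leftIdeal e →ₗ[ℚ] MonoidAlgebra ℚ G := (leftIdeal e).subtype.restrictScalars ℚ
  have h1 : L = p ∘ₗ (i ∘ₗ L) := by
    refine LinearMap.ext fun x => Subtype.ext ?_
    exact (L x).2.symm
  have : FiniteDimensional ℚ (leftIdeal e) :=
    FiniteDimensional.finiteDimensional_submodule ((leftIdeal e).restrictScalars ℚ)
  change LinearMap.trace ℚ _ L = _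
  rw [h1, LinearMap.trace_comp_comm']
  let b : Module.Basis G ℚ (MonoidAlgebra ℚ G) :=
    Module.Basis.ofRepr (MonoidAlgebra.coeffLinearEquiv ℚ)
  rw [LinearMap.trace_eq_matrix_trace ℚ b, Matrix.trace]
  refine Finset.sum_congr rfl fun t _ => ?_
  rw [Matrix.diag_apply, LinearMap.toMatrix_apply]
  have h2 : b t = MonoidAlgebra.single t 1 := rfl
  have h3 : ((i ∘ₗ L) ∘ₗ p) (b t) =
      MonoidAlgebra.single g 1 * (MonoidAlgebra.single t 1 * e) := by rw [h2]; rfl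
  rw [h3, ← mul_assoc, MonoidAlgebra.single_mul_single]
  change (MonoidAlgebra.single (g * t) (1 * 1) * e).coeff t = _
  simp [mul_assoc]

theorem modChar_pi {J : Type} [Fintype J] (V : J → Type) [∀ j, AddCommGroup (V j)]
    [∀ j, Module ℚ (V j)] [∀ j, Module (MonoidAlgebra ℚ G) (V j)]
    [∀ j, IsScalarTower ℚ (MonoidAlgebra ℚ G) (V j)] [∀ j, FiniteDimensional ℚ (V j)] (g : G) :
    modChar (∀ j, V j) g = ∑ j, modChar (V j) g := by
  classical
  let L : Module.End ℚ (∀ j, V j) :=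
    Algebra.lsmul ℚ ℚ (∀ j, V j) (MonoidAlgebra.single g 1 : MonoidAlgebra ℚ G)
  have h1 : L = ∑ j, (LinearMap.single ℚ V j) ∘ₗ (LinearMap.proj j ∘ₗ L) := by
    ext1 j
    refine LinearMap.ext fun x => ?_
    simp only [LinearMap.comp_apply, LinearMap.sum_apply]
    exact (Finset.univ_sum_single _).symm
  change LinearMap.trace ℚ _ L = _
  rw [h1, map_sum]
  refine Finset.sum_congr rfl fun j _ => ?_
  rw [LinearMap.trace_comp_comm', modChar]
  congr 1
  ext x
  simp [L]

/-- By the hypothesis the two sums of left ideals have equal characters, hence are isomorphic. A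
homomorphism out of such a sum is right multiplication by the matrix of images of the idempotents,
and the relations say that the two matrices are inverse to each other. -/
theorem exists_matrices_of_idempotents [Fintype G] {J K : Type} [Fintype J] [Fintype K]
    [DecidableEq J] [DecidableEq K] {e : J → MonoidAlgebra ℚ G} {f : K → MonoidAlgebra ℚ G}
    (he : ∀ j, e j * e j = e j) (hf : ∀ k, f k * f k = f k)
    (h : ∀ g : G, ∑ j, ∑ t : G, (e j).coeff (t⁻¹ * g * t) =
      ∑ k, ∑ t : G, (f k).coeff (t⁻¹ * g * t)) :
    ∃ (a : J → K → MonoidAlgebra ℚ G) (b : K → J → MonoidAlgebra ℚ G),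
      (∀ j k, a j k * f k = a j k) ∧ (∀ k j, b k j * e j = b k j) ∧
      (∀ j j', ∑ k, a j k * b k j' = if j = j' then e j else 0) ∧
      (∀ k k', ∑ j, b k j * a j k' = if k = k' then f k else 0) := by
  have fin : ∀ e : MonoidAlgebra ℚ G, FiniteDimensional ℚ (leftIdeal e) := fun e =>
    FiniteDimensional.finiteDimensional_submodule ((leftIdeal e).restrictScalars ℚ)
  obtain ⟨φ⟩ := nonempty_equiv_of_modChar_eq (G := G) (V := ∀ j, leftIdeal (e j))
    (W := ∀ k, leftIdeal (f k)) (fun g => by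
      rw [modChar_pi, modChar_pi]
      simp only [modChar_leftIdeal (he _), modChar_leftIdeal (hf _)]
      exact h g⁻¹)
  have key : ∀ {J K : Type} [Fintype J] [DecidableEq J] {e : J → MonoidAlgebra ℚ G}
      {f : K → MonoidAlgebra ℚ G} (he : ∀ j, e j * e j = e j)
      (φ : (∀ j, leftIdeal (e j)) →ₗ[MonoidAlgebra ℚ G] (∀ k, leftIdeal (f k)))
      (x : ∀ j, leftIdeal (e j)) (k : K), (φ x k : MonoidAlgebra ℚ G) =
        ∑ j, (x j : MonoidAlgebra ℚ G) * (φ (Pi.single j ⟨e j, he j⟩) k : MonoidAlgebra ℚ G) := by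
    intro J K _ _ e f he φ x k
    -- Each component satisfies `x j = x j * e j`, so the idempotents generate the sum of left
    -- ideals.
    have hx : x = ∑ j, (x j : MonoidAlgebra ℚ G) •
        (Pi.single j ⟨e j, he j⟩ : ∀ j, leftIdeal (e j)) := by
      conv_lhs => rw [← Finset.univ_sum_single x]
      refine Finset.sum_congr rfl fun j _ => ?_
      rw [← Pi.single_smul]
      congr 1
      exact Subtype.ext (x j).2.symm
    conv_lhs => rw [hx]
    simp
  have single_apply : ∀ {J : Type} [DecidableEq J] {e : J → MonoidAlgebra ℚ G}
      (he : ∀ j, e j * e j = e j) (j j' : J),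
      (((Pi.single j ⟨e j, he j⟩ : ∀ j, leftIdeal (e j)) j' : leftIdeal (e j')) :
        MonoidAlgebra ℚ G) = if j = j' then e j else 0 := by
    intro J _ e he j j'
    by_cases hj : j = j'
    · subst hj; simp
    · rw [if_neg hj, Pi.single_eq_of_ne (Ne.symm hj)]; rfl
  refine ⟨fun j k => φ (Pi.single j ⟨e j, he j⟩) k,
    fun k j => φ.symm (Pi.single k ⟨f k, hf k⟩) j, fun j k => (φ _ k).2,
    fun k j => (φ.symm _ j).2, fun j j' => ?_, fun k k' => ?_⟩
  · have := key hf φ.symm.toLinearMap (φ (Pi.single j ⟨e j, he j⟩)) j'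
    rw [← single_apply he]
    refine this.symm.trans ?_
    rw [LinearEquiv.coe_coe, LinearEquiv.symm_apply_apply]
  · have := key he φ.toLinearMap (φ.symm (Pi.single k ⟨f k, hf k⟩)) k'
    rw [← single_apply hf]
    refine this.symm.trans ?_
    rw [LinearEquiv.coe_coe, LinearEquiv.apply_symm_apply]

end Characters

/-! ### Class functions on the symmetric group are detected by words. -/

section ClassFunctions

variable {ι : Type} [Fintype ι] [DecidableEq ι]

/-- The cycle type is the multiset of sizes of the orbits with more than one element, so it depends
only on the orbit relation. -/
theorem isConj_of_sameCycle_iff {s t : Equiv.Perm ι}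
    (h : ∀ x y, s.SameCycle x y ↔ t.SameCycle x y) : IsConj s t := by
  rw [Equiv.Perm.isConj_iff_cycleType_eq]
  have key : ∀ s : Equiv.Perm ι, s.cycleType = ((Finset.univ.filter fun x => ∃ y, y ≠ x ∧
      s.SameCycle x y).image (fun x => Finset.univ.filter fun y => s.SameCycle x y)).val.map
        Finset.card := by
    intro s
    have h1 : ∀ x, (∃ y, y ≠ x ∧ s.SameCycle x y) ↔ x ∈ s.support := by
      intro x
      rw [Equiv.Perm.mem_support]
      constructor
      · rintro ⟨y, hy, hxy⟩ hx
        exact hy (hxy.eq_of_left hx).symm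
      · exact fun hx => ⟨s x, hx, ⟨1, rfl⟩⟩
    have h2 : (Finset.univ.filter fun x => ∃ y, y ≠ x ∧ s.SameCycle x y).image
        (fun x => Finset.univ.filter fun y => s.SameCycle x y) =
        s.cycleFactorsFinset.image Equiv.Perm.support := by
      ext A
      simp only [Finset.mem_image, Finset.mem_filter, Finset.mem_univ, true_and, h1]
      have h3 : ∀ x ∈ s.support, (Finset.univ.filter fun y => s.SameCycle x y) =
          (s.cycleOf x).support := by
        intro x hx
        ext y
        rw [Equiv.Perm.mem_support_cycleOf_iff' (Equiv.Perm.mem_support.1 hx)]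
        simp
      constructor
      · rintro ⟨x, hx, rfl⟩
        exact ⟨s.cycleOf x, Equiv.Perm.cycleOf_mem_cycleFactorsFinset_iff.2 hx, (h3 x hx).symm⟩
      · rintro ⟨c, hc, rfl⟩
        obtain ⟨x, hx⟩ := (Equiv.Perm.mem_cycleFactorsFinset_iff.1 hc).1.nonempty_support
        have h4 := Equiv.Perm.cycle_is_cycleOf hx hc
        have h5 : x ∈ s.support := Equiv.Perm.mem_cycleFactorsFinset_support_le hc hx
        exact ⟨x, h5, by rw [h3 x h5, ← h4]⟩
    rw [h2, Finset.image_val_of_injOn, Multiset.map_map, Equiv.Perm.cycleType_def]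
    intro c hc d hd hcd
    by_contra hne
    have h6 := (Equiv.Perm.cycleFactorsFinset_pairwise_disjoint s hc hd hne).disjoint_support
    change c.support = d.support at hcd
    rw [hcd, disjoint_self] at h6
    have h7 := (Equiv.Perm.mem_cycleFactorsFinset_iff.1 hd).1.nonempty_support
    rw [h6] at h7
    exact Finset.not_nonempty_empty h7
  rw [key s, key t]
  simp only [h]

/-- A triangularity argument, by induction from many orbits to few. Colour the points by the orbits
of `s`. A permutation `t` preserving the colours has orbits contained in those of `s`, so it either
has the same orbits and is conjugate to `s`, or has strictly more, and then `c t = 0` by induction.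
The hypothesis for this colouring leaves a positive multiple of `c s`. -/
theorem classFunction_eq_zero {c : Equiv.Perm ι → ℚ} (hc : ∀ s t, IsConj s t → c s = c t)
    (h : ∀ w : ι → ι, ∑ s with w ∘ (s : Equiv.Perm ι) = w, c s = 0) (s : Equiv.Perm ι) :
    c s = 0 := by
  -- The number of orbits, fixed points included.
  let q : Equiv.Perm ι → ℕ := fun s => Nat.card (Quotient (Equiv.Perm.SameCycle.setoid s))
  have hq : ∀ s, q s ≤ Fintype.card ι := fun s => by
    rw [← Nat.card_eq_fintype_card]
    exact Nat.card_le_card_of_surjective _ Quotient.mk_surjective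
  induction hn : Fintype.card ι - q s using Nat.strong_induction_on generalizing s with
  | _ n ih =>
  let w : ι → ι := fun x => (Quotient.mk (Equiv.Perm.SameCycle.setoid s) x).out
  have hw : ∀ x y, w x = w y ↔ s.SameCycle x y := by
    intro x y
    have h1 : w x = w y ↔ (Quotient.mk (Equiv.Perm.SameCycle.setoid s) x) =
        Quotient.mk (Equiv.Perm.SameCycle.setoid s) y := Quotient.out_inj
    rw [h1, Quotient.eq]
    rfl
  have h0 := h w
  have key : ∀ t ∈ Finset.univ.filter (fun t : Equiv.Perm ι => w ∘ t = w),
      c t = if IsConj s t ∧ c t = c s then c s else 0 := by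
    intro t ht
    have ht' : ∀ x, s.SameCycle (t x) x := fun x => (hw _ _).1 (congrFun (Finset.mem_filter.1 ht).2 x)
    have ht'' : ∀ x y, t.SameCycle x y → s.SameCycle x y := by
      rintro x _ ⟨n, rfl⟩
      induction n using Int.induction_on generalizing x with
      | zero => exact Equiv.Perm.SameCycle.refl _ _
      | succ n ih =>
        rw [zpow_add, zpow_one, Equiv.Perm.mul_apply]
        exact (ht' x).symm.trans (ih _)
      | pred n ih =>
        rw [zpow_sub, zpow_one, Equiv.Perm.mul_apply]
        have := ht' (t⁻¹ x)
        rw [show t (t⁻¹ x) = x from t.apply_symm_apply x] at this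
        exact this.trans (ih _)
    by_cases hconj : IsConj s t
    · rw [if_pos ⟨hconj, (hc _ _ hconj).symm⟩, hc _ _ hconj]
    · rw [if_neg fun h => hconj h.1]
      let π : Quotient (Equiv.Perm.SameCycle.setoid t) → Quotient (Equiv.Perm.SameCycle.setoid s) :=
        Quotient.map id ht''
      have hπ : Function.Surjective π := by
        rintro ⟨x⟩
        exact ⟨Quotient.mk _ x, rfl⟩
      have hle : q s ≤ q t := Nat.card_le_card_of_surjective π hπ
      have hne : q s ≠ q t := by
        intro heq
        have hinj : Function.Injective π :=
          ((Nat.bijective_iff_surjective_and_card π).2 ⟨hπ, heq.symm⟩).1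
        refine hconj (isConj_of_sameCycle_iff fun x y => ⟨fun hxy => ?_, ht'' x y⟩)
        exact Quotient.exact (hinj (Quotient.sound hxy :
          π (Quotient.mk _ x) = π (Quotient.mk _ y)))
      have := hq t
      exact ih _ (by omega) t rfl
  rw [Finset.sum_congr rfl key, ← Finset.sum_filter, Finset.sum_const, smul_eq_zero] at h0
  refine h0.resolve_left ?_
  rw [Finset.card_eq_zero]
  refine Finset.Nonempty.ne_empty ⟨s, ?_⟩
  simp only [Finset.mem_filter, Finset.mem_univ, true_and, and_true]
  refine ⟨funext fun x => (hw _ _).2 ?_, IsConj.refl s⟩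
  exact Equiv.Perm.SameCycle.symm ⟨1, rfl⟩

theorem exists_perm_of_sum_single_eq {v w : ι → ι}
    (h : ∑ i, (Finsupp.single (v i) 1 : ι →₀ ℕ) = ∑ i, Finsupp.single (w i) 1) :
    ∃ t : Equiv.Perm ι, v = w ∘ t := by
  have h1 : ∀ a, Fintype.card {i // v i = a} = Fintype.card {i // w i = a} := by
    intro a
    have := DFunLike.congr_fun h a
    simp only [Finsupp.finsetSum_apply, Finsupp.single_apply, Finset.sum_boole,
      Nat.cast_id] at this
    rw [Fintype.card_subtype, Fintype.card_subtype, this]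
  exact ⟨Equiv.ofFiberEquiv fun a => Fintype.equivOfCardEq (h1 a), funext fun i =>
    (Equiv.ofFiberEquiv_map _ i).symm⟩

theorem sum_single_comp_perm {ι : Type} [Fintype ι] (w : ι → ι) (t : Equiv.Perm ι) :
    ∑ i, (Finsupp.single ((w ∘ t) i) 1 : ι →₀ ℕ) = ∑ i, Finsupp.single (w i) 1 :=
  Equiv.sum_comp t fun i => Finsupp.single (w i) 1

/-- A function on words whose sum over the words of each content vanishes has vanishing averages
over the rearrangements of any word. -/
theorem sum_rearrangements_eq_zero {g : (ι → ι) → ℚ}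
    (h : ∑ f : ι → ι, MvPolynomial.monomial (∑ i, Finsupp.single (f i) 1) (g f) = 0) (w : ι → ι) :
    ∑ t : Equiv.Perm ι, g (w ∘ t) = 0 := by
  have h1 := congrArg (MvPolynomial.coeff (∑ i, Finsupp.single (w i) 1)) h
  simp only [MvPolynomial.coeff_sum, MvPolynomial.coeff_monomial, MvPolynomial.coeff_zero] at h1
  rw [← Finset.sum_filter] at h1
  rw [← Finset.sum_fiberwise_of_maps_to (g := fun t : Equiv.Perm ι => w ∘ t)
    (t := Finset.univ.filter fun f : ι → ι =>
      (∑ i, Finsupp.single (f i) 1 : ι →₀ ℕ) = ∑ i, Finsupp.single (w i) 1)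
    (fun t _ => by simpa using sum_single_comp_perm w t)]
  -- The permutations turning `w` into a given rearrangement `f` form a coset of the stabiliser of
  -- `w`, so every word with the content of `w` is counted equally often.
  have h2 : ∀ f ∈ Finset.univ.filter (fun f : ι → ι =>
      (∑ i, Finsupp.single (f i) 1 : ι →₀ ℕ) = ∑ i, Finsupp.single (w i) 1),
      ∑ t with w ∘ (t : Equiv.Perm ι) = f, g (w ∘ t) =
        (Finset.univ.filter fun t : Equiv.Perm ι => w ∘ t = w).card * g f := by
    intro f hf
    obtain ⟨s, rfl⟩ := exists_perm_of_sum_single_eq (Finset.mem_filter.1 hf).2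
    rw [Finset.sum_congr rfl (g := fun _ => g (w ∘ s)) (fun t ht => by
      rw [(Finset.mem_filter.1 ht).2]), Finset.sum_const, nsmul_eq_mul]
    congr 2
    refine Finset.card_equiv (Equiv.mulRight s⁻¹) fun t => ?_
    simp only [Finset.mem_filter, Finset.mem_univ, true_and, Equiv.coe_mulRight,
      Equiv.Perm.coe_mul]
    rw [← Function.comp_assoc]
    constructor
    · intro h
      rw [h, Function.comp_assoc, ← Equiv.Perm.coe_mul, mul_inv_cancel]
      rfl
    · intro h
      funext x
      have := congrFun h (s x)
      simpa using this
  rw [Finset.sum_congr rfl h2, ← Finset.mul_sum, h1, mul_zero]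

/-- The sum of the monomials of the words fixed by `s` is the power-sum product of its cycle type,
so the hypothesis is that the Frobenius characteristic of `E` vanishes. Averaging over
rearrangements of a word `w`, and conjugating the stabiliser of `w ∘ t` to that of `w`, gives the
hypothesis of `classFunction_eq_zero` for the class sums. -/
theorem classSum_eq_zero {E : Equiv.Perm ι → ℚ}
    (h : ∑ s, ∑ f : ι → ι, (if f ∘ (s : Equiv.Perm ι) = f then
      MvPolynomial.monomial (∑ i, Finsupp.single (f i) 1) (E s) else 0) = 0) (s : Equiv.Perm ι) :
    ∑ t : Equiv.Perm ι, E (t⁻¹ * s * t) = 0 := by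
  refine classFunction_eq_zero (c := fun s => ∑ t : Equiv.Perm ι, E (t⁻¹ * s * t)) ?_ ?_ s
  · intro s s' hs
    obtain ⟨r, rfl⟩ := isConj_iff.1 hs
    conv_rhs => rw [← Equiv.sum_comp (Equiv.mulLeft r)]
    refine Finset.sum_congr rfl fun t _ => congrArg E ?_
    simp only [Equiv.coe_mulLeft]
    group
  · intro w
    have h1 := sum_rearrangements_eq_zero (g := fun f => ∑ s with f ∘ (s : Equiv.Perm ι) = f, E s)
      (by
        rw [← h, Finset.sum_comm]
        refine Finset.sum_congr rfl fun f _ => ?_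
        rw [map_sum, Finset.sum_filter]) w
    rw [Finset.sum_comm, ← h1]
    refine Finset.sum_congr rfl fun t _ => ?_
    refine Finset.sum_equiv (MulAut.conj t⁻¹).toEquiv (fun s => ?_) (fun s _ => ?_)
    · simp only [Finset.mem_filter, Finset.mem_univ, true_and, MulEquiv.toEquiv_eq_coe,
        MulEquiv.coe_toEquiv, MulAut.conj_apply, inv_inv, Equiv.Perm.coe_mul]
      constructor
      · intro h
        funext x
        have := congrFun h (t x)
        simpa using this
      · intro h
        funext x
        have := congrFun h (t⁻¹ x)
        simpa using this
    · simp

end ClassFunctions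

/-! ### Diagonal operators and traces on tensor powers. -/

section Spectrum

variable {R : Type u} [CommRing R] {T U M : Type u} [AddCommGroup T] [Module R T] [AddCommGroup U]
  [Module R U] [AddCommGroup M] [Module R M]

/-- The endomorphism `F` is diagonal in some finite basis, with eigenvalues `s`. -/
def HasSpectrum (F : T →ₗ[R] T) (s : Multiset R) : Prop :=
  ∃ (n : ℕ) (b : Module.Basis (Fin n) R T) (x : Fin n → R), (∀ i, F (b i) = x i • b i) ∧
    s = Finset.univ.val.map x

theorem HasSpectrum.of_basis {I : Type} [Fintype I] {F : T →ₗ[R] T} (b : Module.Basis I R T)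
    {x : I → R} (h : ∀ i, F (b i) = x i • b i) : HasSpectrum F (Finset.univ.val.map x) := by
  let ε := Fintype.equivFin I
  refine ⟨Fintype.card I, b.reindex ε, x ∘ ε.symm, fun i => by simp [h], ?_⟩
  have h1 := congrArg Finset.val (Finset.map_univ_equiv ε.symm)
  rw [Finset.map_val] at h1
  rw [← Multiset.map_map, ← h1]
  rfl

theorem HasSpectrum.exists_basis {F : T →ₗ[R] T} {s : Multiset R} (h : HasSpectrum F s) :
    Module.Free R T ∧ Module.Finite R T := by
  obtain ⟨n, b, -⟩ := h
  exact ⟨Module.Free.of_basis b, Module.Finite.of_basis b⟩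

theorem HasSpectrum.trace_eq {F : T →ₗ[R] T} {s : Multiset R} (h : HasSpectrum F s) :
    LinearMap.trace R T F = s.sum := by
  obtain ⟨n, b, x, hF, rfl⟩ := h
  rw [LinearMap.trace_eq_matrix_trace R b, Matrix.trace]
  refine Finset.sum_congr rfl fun i _ => ?_
  rw [Matrix.diag_apply, LinearMap.toMatrix_apply, hF]
  simp

theorem HasSpectrum.ext {F : T →ₗ[R] T} {s : Multiset R} (h : HasSpectrum F s) (k : ℕ) :
    HasSpectrum (extMap k F) (wedge k s) := by
  obtain ⟨n, b, x, hF, rfl⟩ := h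
  have : Fintype (Set.powersetCard (Fin n) k) := Fintype.ofFinite _
  have h1 : wedge k (Finset.univ.val.map x) = Finset.univ.val.map
      fun S : Set.powersetCard (Fin n) k => ∏ i ∈ S.1, x i := by
    rw [wedge, Multiset.powersetCard_map, Multiset.map_map,
      ← Finset.map_val_val_powersetCard, Multiset.map_map]
    have h2 : (Finset.univ : Finset (Set.powersetCard (Fin n) k)).map (Function.Embedding.subtype _)
        = Finset.powersetCard k Finset.univ := by
      ext S
      simp only [Finset.mem_map, Finset.mem_powersetCard_univ]
      exact ⟨fun ⟨S', _, h⟩ => h ▸ S'.2, fun h => ⟨⟨S, h⟩, Finset.mem_univ _, rfl⟩⟩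
    rw [← h2, Finset.map_val, Multiset.map_map]
    rfl
  rw [h1]
  -- Wedges of distinct eigenvectors are eigenvectors, with the product of the eigenvalues over the
  -- subset.
  refine HasSpectrum.of_basis (b.exteriorPower k) fun S => ?_
  rw [exteriorPower.basis_apply, exteriorPower.ιMulti_family, extMap_ιMulti]
  simp only [Function.comp_apply, hF]
  rw [AlternatingMap.map_smul_univ]
  congr 1
  refine (Finset.prod_map Finset.univ
    (Set.powersetCard.ofFinEmbEquiv.symm S).toEmbedding x).symm.trans ?_
  refine Finset.prod_congr ?_ fun _ _ => rfl
  ext i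
  have := Set.powersetCard.mem_range_ofFinEmbEquiv_symm_iff_mem S i
  rw [Finset.mem_map]
  simp only [Finset.mem_univ, true_and]
  exact this

theorem HasSpectrum.tensor {F : T →ₗ[R] T} {s : Multiset R} (h : HasSpectrum F s)
    {G : U →ₗ[R] U} {t : Multiset R} (h' : HasSpectrum G t) :
    HasSpectrum (TensorProduct.map F G) (pairProd s t) := by
  obtain ⟨n, b, x, hF, rfl⟩ := h
  obtain ⟨m, c, y, hG, rfl⟩ := h'
  have h1 : pairProd (Finset.univ.val.map x) (Finset.univ.val.map y) =
      Finset.univ.val.map fun p : Fin n × Fin m => x p.1 * y p.2 := by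
    rw [pairProd, ← Finset.univ_product_univ, Finset.product_val]
    simp [SProd.sprod, Multiset.product, Multiset.bind_map, Multiset.map_bind, Function.comp_def]
  rw [h1]
  refine HasSpectrum.of_basis (b.tensorProduct c) fun p => ?_
  rw [Module.Basis.tensorProduct_apply, TensorProduct.map_tmul, hF, hG, TensorProduct.smul_tmul_smul]

theorem HasSpectrum.unit : HasSpectrum ((RingHom.id R).toSemilinearMap : R →ₗ[R] R) {1} :=
  HasSpectrum.of_basis (Module.Basis.singleton Unit R) (x := fun _ => 1) fun i => by
    simp

variable [Algebra ℚ R]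

/-- The operator factors as `i ∘ F ∘ p`. By cyclicity of the trace and `p ∘ i = id`, its trace is
that of `F` on the summand. -/
theorem HasSpectrum.trace_tmap_act {ι : Type} [Finite ι] {e : MonoidAlgebra ℚ (Equiv.Perm ι)}
    {ρ : Retract R M T ι e} {g : M →ₗ[R] M} {F : T →ₗ[R] T} {s : Multiset R}
    (hF : HasSpectrum F s) (hρ : Retract.Compat ρ ρ g F) [Module.Free R M] [Module.Finite R M] :
    LinearMap.trace R (TPow R ι M) (tmap ι g ∘ₗ act R ι M e) = s.sum := by
  obtain ⟨_, _⟩ := hF.exists_basis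
  have : Module.Free R (TPow R ι M) :=
    Module.Free.of_basis (Basis.piTensorProduct fun _ : ι => Module.Free.chooseBasis R M)
  have : Module.Finite R (TPow R ι M) :=
    Module.Finite.of_basis (Basis.piTensorProduct fun _ : ι => Module.Free.chooseBasis R M)
  have h1 : tmap ι g ∘ₗ act R ι M e = ρ.i ∘ₗ (F ∘ₗ ρ.p) := by
    ext1
    refine MultilinearMap.ext fun v => ?_
    simp only [LinearMap.compMultilinearMap_apply, LinearMap.comp_apply, hρ _, ρ.i_p]
  rw [h1, LinearMap.trace_comp_comm', ← hF.trace_eq]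
  congr 1
  ext x
  simp [ρ.p_i]

/-- The basis of the tensor power is indexed by words `f`. A permutation moves words, so only the
words it fixes contribute to the diagonal, each with the product of the eigenvalues of its letters.
-/
theorem trace_tmap_act_of_basis {ι κ : Type} [Fintype ι] [DecidableEq ι] [Fintype κ]
    [DecidableEq κ] (b : Module.Basis κ R M) {x : κ → R} {g : M →ₗ[R] M}
    (hg : ∀ i, g (b i) = x i • b i) (e : MonoidAlgebra ℚ (Equiv.Perm ι)) :
    LinearMap.trace R (TPow R ι M) (tmap ι g ∘ₗ act R ι M e) =
      ∑ s : Equiv.Perm ι, ∑ f : ι → κ,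
        if f ∘ s = f then algebraMap ℚ R (e.coeff s) * ∏ i, x (f i) else 0 := by
  induction e using MonoidAlgebra.induction_linear with
  | zero => simp
  | add a b ha hb =>
    rw [map_add, LinearMap.comp_add, map_add, ha, hb, ← Finset.sum_add_distrib]
    refine Finset.sum_congr rfl fun s _ => ?_
    rw [← Finset.sum_add_distrib]
    refine Finset.sum_congr rfl fun f _ => ?_
    split_ifs
    · simp [add_mul]
    · simp
  | single s c =>
    rw [Finset.sum_eq_single s (fun t _ ht => Finset.sum_eq_zero fun f _ => by
        simp [Ne.symm ht]) (by simp),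
      LinearMap.trace_eq_matrix_trace R (Basis.piTensorProduct fun _ : ι => b), Matrix.trace]
    refine Finset.sum_congr rfl fun f _ => ?_
    rw [Matrix.diag_apply, LinearMap.toMatrix_apply, Basis.piTensorProduct_apply,
      LinearMap.comp_apply, act_single, LinearMap.smul_apply, map_smul, permAct_tprod, tmap_tprod,
      map_smul, Finsupp.smul_apply, Basis.piTensorProduct_repr_tprod_apply]
    simp only [hg, map_smul, Module.Basis.repr_self, Finsupp.smul_apply, smul_eq_mul,
      Finsupp.single_apply]
    by_cases h : f ∘ s = f
    · have h' : ∀ i, f (s.symm i) = f i := fun i => by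
        have := congrFun h (s.symm i)
        simpa using this.symm
      simp [h, h']
    · rw [if_neg h]
      obtain ⟨i, hi⟩ := Function.ne_iff.1 h
      rw [Finset.prod_eq_zero (Finset.mem_univ (s i)), mul_zero]
      rw [if_neg, mul_zero]
      simpa using Ne.symm hi

end Spectrum

/-! ### The monomials of `lamPoly`, separated by sign. -/

section Monomials

open MvPolynomial

/-- Thanks to this, every monomial of the polynomial is realised by a summand of one and the same
tensor power, with `m * k` factors. -/
theorem isWeightedHomogeneous_lamPoly (m k : ℕ) :
    IsWeightedHomogeneous (fun i : Fin (m * k) => (i : ℕ) + 1) (lamPoly m k) (m * k) := by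
  refine isWeightedHomogeneous_of_aeval (w := 1) (fun i => ?_) (aeval_esymm_injective (m * k)) ?_
  · have := isWeightedHomogeneous_esymm (k := i + 1)
      (isWeightedHomogeneous_of_mem_vars (R := ℤ) (σ := Fin (m * k)))
    rwa [mul_one, ← esymm_fin_eq] at this
  · rw [lamPoly_spec, subsetCoeff_eq]
    simpa using isWeightedHomogeneous_esymm (isWeightedHomogeneous_of_mem_wedge (k := k)
      (isWeightedHomogeneous_of_mem_vars (R := ℤ))) (k := m)

/-- A monomial in the variables of `lamPoly m k` as the list of the degrees of its factors. -/
def monomialList {n : ℕ} (d : Fin n →₀ ℕ) : List ℕ :=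
  (List.finRange n).flatMap fun i => List.replicate (d i) ((i : ℕ) + 1)

theorem prod_map_monomialList {n : ℕ} {A : Type*} [CommMonoid A] (y : ℕ → A) (d : Fin n →₀ ℕ) :
    ((monomialList d).map y).prod = ∏ i : Fin n, y (i + 1) ^ d i := by
  rw [monomialList, List.map_flatMap, List.flatMap_def, List.prod_flatten, List.map_map,
    ← List.prod_ofFn, List.ofFn_eq_map]
  simp [Function.comp_def]

theorem sum_monomialList {n : ℕ} (d : Fin n →₀ ℕ) :
    (monomialList d).sum = ∑ i, d i * ((i : ℕ) + 1) := by
  rw [monomialList, List.flatMap_def, List.sum_flatten, List.map_map, ← List.sum_ofFn,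
    List.ofFn_eq_map]
  simp [Function.comp_def]

theorem sum_monomialList_of_mem {m k : ℕ} (d : (lamPoly m k).support) :
    (monomialList d.1).sum = m * k := by
  rw [sum_monomialList]
  refine Eq.trans ?_ (isWeightedHomogeneous_lamPoly m k (mem_support_iff.1 d.2))
  rw [Finsupp.weight_apply, Finsupp.sum_fintype _ _ (by simp)]
  simp

/-- The monomials of `lamPoly m k` with positive coefficient, repeated according to the
coefficient. -/
abbrev PosIndex (m k : ℕ) : Type :=
  Σ d : (lamPoly m k).support, Fin ((lamPoly m k).coeff d.1).toNat

/-- The monomials of `lamPoly m k` with negative coefficient, repeated according to the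
coefficient. -/
abbrev NegIndex (m k : ℕ) : Type :=
  Σ d : (lamPoly m k).support, Fin (-(lamPoly m k).coeff d.1).toNat

/-- Moving the negative monomials to the other side leaves only sums, which can be realised by
direct sums. -/
theorem sum_posIndex_eq {A : Type*} [CommRing A] (m k : ℕ) (y : ℕ → A) :
    ∑ p : PosIndex m k, ((monomialList p.1.1).map y).prod =
      aeval (fun i : Fin (m * k) => y (i + 1)) (lamPoly m k) +
        ∑ p : NegIndex m k, ((monomialList p.1.1).map y).prod := by
  rw [Fintype.sum_sigma, Fintype.sum_sigma, aeval_def, eval₂_eq',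
    ← Finset.sum_coe_sort (lamPoly m k).support, ← Finset.sum_add_distrib]
  refine Finset.sum_congr rfl fun d _ => ?_
  simp only [Finset.sum_const, Finset.card_univ, Fintype.card_fin, prod_map_monomialList,
    nsmul_eq_mul]
  rw [← add_mul]
  congr 1
  have h := Int.toNat_sub_toNat_neg ((lamPoly m k).coeff d.1)
  have h2 : (lamPoly m k).coeff d.1 + ((-(lamPoly m k).coeff d.1).toNat : ℤ) =
    (((lamPoly m k).coeff d.1).toNat : ℤ) := by omega
  have h3 := congrArg (Int.cast : ℤ → A) h2
  push_cast at h3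
  rw [← h3]
  simp

end Monomials

/-! ### The idempotents of `ℚ[S_n]` behind the plethysm identity. -/

section Idempotents

/-- The idempotent cutting out `⋀^{l₁} ⊗ ⋀^{l₂} ⊗ ⋯`. -/
noncomputable def listIdem : (l : List ℕ) → MonoidAlgebra ℚ (Equiv.Perm (Fin l.sum))
  | [] => 1
  | i :: l => permAlgCongr finSumFinEquiv (boxProd (antisymmetrizer i) (listIdem l))

/-- The idempotent cutting out `⋀^{l₁} ⊗ ⋀^{l₂} ⊗ ⋯` for a list `l` of sum `n`. -/
noncomputable def monIdem {n : ℕ} (l : List ℕ) (h : l.sum = n) :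
    MonoidAlgebra ℚ (Equiv.Perm (Fin n)) :=
  permAlgCongr (finCongr h) (listIdem l)

/-- The idempotent cutting out `⋀^m ⋀^k`. -/
noncomputable def plethIdem (m k : ℕ) : MonoidAlgebra ℚ (Equiv.Perm (Fin (m * k))) :=
  permAlgCongr finProdFinEquiv
    (blockAlg m (Fin k) (antisymmetrizer m) * allSlots m (antisymmetrizer k))

/-- The tensor of all basis vectors in order has distinct translates under the permutations, so the
coefficients of `e` can be read off. In particular the group algebra acts faithfully. -/
theorem act_repr {ι : Type} [Fintype ι] [DecidableEq ι] (e : MonoidAlgebra ℚ (Equiv.Perm ι))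
    (s : Equiv.Perm ι) :
    (Basis.piTensorProduct fun _ : ι => Pi.basisFun ℚ ι).repr
      (act ℚ ι (ι → ℚ) e (PiTensorProduct.tprod ℚ fun i => Pi.basisFun ℚ ι i)) s.symm =
      e.coeff s := by
  induction e using MonoidAlgebra.induction_linear with
  | zero => simp
  | add a b ha hb => simp only [map_add, LinearMap.add_apply, Finsupp.add_apply, ha, hb,
      MonoidAlgebra.coeff_add]
  | single t c =>
    rw [act_single, LinearMap.smul_apply, permAct_tprod, map_smul, Finsupp.smul_apply,
      Basis.piTensorProduct_repr_tprod_apply]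
    simp only [Module.Basis.repr_self, Finsupp.single_apply, MonoidAlgebra.coeff_single]
    by_cases h : t = s
    · subst h; simp
    · rw [if_neg h]
      have h' : t.symm ≠ s.symm := fun h' => h (Equiv.symm_bijective.1 h')
      obtain ⟨i, hi⟩ := not_forall.1 fun h'' => h' (Equiv.ext h'')
      rw [Finset.prod_eq_zero (Finset.mem_univ i) (if_neg hi), smul_zero]

/-- Since `i ∘ p` is idempotent, `e * e` and `e` act in the same way, and the action is faithful. -/
theorem Retract.isIdempotent {ι : Type} [Fintype ι] {T : Type} [AddCommGroup T] [Module ℚ T]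
    {e : MonoidAlgebra ℚ (Equiv.Perm ι)} (ρ : Retract ℚ (ι → ℚ) T ι e) : e * e = e := by
  classical
  ext s
  rw [← act_repr, ← act_repr, map_mul, Module.End.mul_apply, ← ρ.i_p, ← ρ.i_p, ρ.p_i]

variable {R M : Type} [CommRing R] [Algebra ℚ R] [AddCommGroup M] [Module R M]

/-- The summand is the tensor product of the exterior powers with the operator induced by `g`.
Keeping its spectrum along the recursion yields the trace as a product of elementary symmetric
functions. -/
theorem exists_list_retract {g : M →ₗ[R] M} {s : Multiset R} (hg : HasSpectrum g s) (l : List ℕ) :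
    ∃ (T : Type) (_ : AddCommGroup T) (_ : Module R T) (ρ : Retract R M T (Fin l.sum) (listIdem l))
      (F : T →ₗ[R] T) (t : Multiset R), Retract.Compat ρ ρ g F ∧ HasSpectrum F t ∧
        t.sum = (l.map s.esymm).prod := by
  induction l with
  | nil =>
    exact ⟨R, inferInstance, inferInstance, Retract.unit R M, (RingHom.id R).toSemilinearMap, {1},
      Retract.unit_compat g, HasSpectrum.unit, by simp⟩
  | cons i l ih =>
    obtain ⟨T, _, _, ρ, F, t, h1, h2, h3⟩ := ih
    refine ⟨(⋀[R]^i M) ⊗[R] T, inferInstance, inferInstance,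
      ((Retract.ext R M i).tensor ρ).congr finSumFinEquiv, TensorProduct.map (extMap i g) F,
      pairProd (wedge i s) t, ((Retract.ext_compat i g).tensor h1).congr _, (hg.ext i).tensor h2, ?_⟩
    rw [sum_pairProd, sum_wedge, h3, List.map_cons, List.prod_cons]

theorem exists_monomial_retract {g : M →ₗ[R] M} {s : Multiset R} (hg : HasSpectrum g s) {n : ℕ}
    (l : List ℕ) (h : l.sum = n) :
    ∃ (T : Type) (_ : AddCommGroup T) (_ : Module R T) (ρ : Retract R M T (Fin n) (monIdem l h))
      (F : T →ₗ[R] T) (t : Multiset R), Retract.Compat ρ ρ g F ∧ HasSpectrum F t ∧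
        t.sum = (l.map s.esymm).prod := by
  obtain ⟨T, _, _, ρ, F, t, h1, h2, h3⟩ := exists_list_retract hg l
  exact ⟨T, inferInstance, inferInstance, ρ.congr (finCongr h), F, t, h1.congr _, h2, h3⟩

theorem exists_plethysm_retract {g : M →ₗ[R] M} {s : Multiset R} (hg : HasSpectrum g s)
    (m k : ℕ) :
    ∃ (T : Type) (_ : AddCommGroup T) (_ : Module R T)
      (ρ : Retract R M T (Fin (m * k)) (plethIdem m k))
      (F : T →ₗ[R] T) (t : Multiset R), Retract.Compat ρ ρ g F ∧ HasSpectrum F t ∧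
        t.sum = (wedge k s).esymm m :=
  ⟨⋀[R]^m (⋀[R]^k M), inferInstance, inferInstance,
    ((Retract.ext R M k).extOf m).congr finProdFinEquiv, extMap m (extMap k g),
    wedge m (wedge k s), ((Retract.ext_compat k g).extOf m).congr _, (hg.ext k).ext m, rfl⟩

/-- It allows the preceding constructions to be run on `ℚ^n`, where they supply the retracts that
prove idempotency. -/
theorem hasSpectrum_id (n : ℕ) :
    ∃ s, HasSpectrum (LinearMap.id : (Fin n → ℚ) →ₗ[ℚ] (Fin n → ℚ)) s :=
  ⟨_, HasSpectrum.of_basis (Pi.basisFun ℚ (Fin n)) (x := fun _ => 1) fun i => by simp⟩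

theorem monIdem_mul_self {n : ℕ} (l : List ℕ) (h : l.sum = n) :
    monIdem l h * monIdem l h = monIdem l h := by
  obtain ⟨s, hs⟩ := hasSpectrum_id n
  obtain ⟨T, _, _, ρ, -⟩ := exists_monomial_retract hs l h
  exact ρ.isIdempotent

theorem plethIdem_mul_self (m k : ℕ) : plethIdem m k * plethIdem m k = plethIdem m k := by
  obtain ⟨s, hs⟩ := hasSpectrum_id (m * k)
  obtain ⟨T, _, _, ρ, -⟩ := exists_plethysm_retract hs m k
  exact ρ.isIdempotent

/-- The idempotents of the monomials of `lamPoly m k` with positive coefficient. -/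
noncomputable def posIdem {m k : ℕ} (p : PosIndex m k) :
    MonoidAlgebra ℚ (Equiv.Perm (Fin (m * k))) :=
  monIdem (monomialList p.1.1) (sum_monomialList_of_mem p.1)

/-- The idempotent of `⋀^m ⋀^k` together with those of the monomials of `lamPoly m k` with negative
coefficient. -/
noncomputable def negIdem {m k : ℕ} :
    Option (NegIndex m k) → MonoidAlgebra ℚ (Equiv.Perm (Fin (m * k)))
  | none => plethIdem m k
  | some p => monIdem (monomialList p.1.1) (sum_monomialList_of_mem p.1)

/-- Compare the traces of `diag(X_1, …, X_n)^{⊗n} ∘ e` for the idempotents of the two sides. As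
symmetric functions they satisfy the defining identity of `lamPoly`, so the difference `E` of the
two sums has trace zero. Expanding that trace over words, `classSum_eq_zero` yields the equality of
class sums. -/
theorem sum_class_eq (m k : ℕ) (g : Equiv.Perm (Fin (m * k))) :
    ∑ p : PosIndex m k, ∑ t : Equiv.Perm (Fin (m * k)), (posIdem p).coeff (t⁻¹ * g * t) =
      ∑ p : Option (NegIndex m k), ∑ t : Equiv.Perm (Fin (m * k)),
        (negIdem p).coeff (t⁻¹ * g * t) := by
  -- There are as many variables as tensor factors; words of length `n` in `n` letters suffice to
  -- detect class functions on `S_n`.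
  let n := m * k
  let R := MvPolynomial (Fin n) ℚ
  let b := Pi.basisFun R (Fin n)
  let D : (Fin n → R) →ₗ[R] (Fin n → R) := b.constr R fun i => (MvPolynomial.X i : R) • b i
  have hD : ∀ i, D (b i) = (MvPolynomial.X i : R) • b i := fun i => b.constr_basis _ _ _
  have hs : HasSpectrum D (vars ℚ (Fin n)) := HasSpectrum.of_basis b hD
  let tr : MonoidAlgebra ℚ (Equiv.Perm (Fin n)) →+ R := AddMonoidHom.mk' (fun e =>
    LinearMap.trace R (TPow R (Fin n) (Fin n → R)) (tmap (Fin n) D ∘ₗ act R (Fin n) (Fin n → R) e))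
    fun x y => by rw [map_add, LinearMap.comp_add, map_add]
  have hmon : ∀ (l : List ℕ) (h : l.sum = n),
      tr (monIdem l h) = (l.map (vars ℚ (Fin n)).esymm).prod := fun l h => by
    obtain ⟨T, _, _, ρ, F, t, h1, h2, h3⟩ := exists_monomial_retract hs l h
    rw [← h3]
    exact h2.trace_tmap_act h1
  have hpleth : tr (plethIdem m k) = (wedge k (vars ℚ (Fin n))).esymm m := by
    obtain ⟨T, _, _, ρ, F, t, h1, h2, h3⟩ := exists_plethysm_retract hs m k
    rw [← h3]
    exact h2.trace_tmap_act h1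
  let E : MonoidAlgebra ℚ (Equiv.Perm (Fin n)) :=
    ∑ p : PosIndex m k, posIdem p - ∑ p : Option (NegIndex m k), negIdem p
  -- The negative monomials are added on both sides, so what remains is the equality of `lamPoly` at
  -- the elementary symmetric functions with `e_m` of the `k`-fold products.
  have hE : tr E = 0 := by
    rw [map_sub, map_sum, map_sum, Fintype.sum_option]
    simp only [posIdem, negIdem]
    rw [hpleth, Finset.sum_congr rfl fun p _ => hmon _ _, sum_posIndex_eq, ← aeval_lamPoly,
      Finset.sum_congr rfl fun (p : NegIndex m k) _ => hmon _ _, sub_self]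
  have key := classSum_eq_zero (ι := Fin n) (E := fun s => E.coeff s) (by
    refine Eq.trans ?_ hE
    refine Eq.trans ?_ (trace_tmap_act_of_basis b hD E).symm
    refine Finset.sum_congr rfl fun s _ => Finset.sum_congr rfl fun f _ => ?_
    split_ifs
    · rw [MvPolynomial.monomial_sum_index]
      rfl
    · rfl) g
  rw [← sub_eq_zero, ← key, Finset.sum_comm, Finset.sum_comm (γ := Option (NegIndex m k)),
    ← Finset.sum_sub_distrib]
  refine Finset.sum_congr rfl fun t _ => ?_
  have hc : ∀ {I : Type} (S : Finset I) (x : I → MonoidAlgebra ℚ (Equiv.Perm (Fin n))) r,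
      (∑ i ∈ S, x i).coeff r = ∑ i ∈ S, (x i).coeff r := fun S x r => by
    rw [MonoidAlgebra.coeff_sum, Finsupp.finsetSum_apply]
  simp only [E]
  rw [MonoidAlgebra.coeff_sub, Finsupp.sub_apply, hc, hc]

theorem exists_lamPoly_matrices (m k : ℕ) :
    ∃ (a : PosIndex m k → Option (NegIndex m k) → MonoidAlgebra ℚ (Equiv.Perm (Fin (m * k))))
      (b : Option (NegIndex m k) → PosIndex m k → MonoidAlgebra ℚ (Equiv.Perm (Fin (m * k)))),
      (∀ j p, a j p * negIdem p = a j p) ∧ (∀ p j, b p j * posIdem j = b p j) ∧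
      (∀ j j', ∑ p, a j p * b p j' = if j = j' then posIdem j else 0) ∧
      (∀ p p', ∑ j, b p j * a j p' = if p = p' then negIdem p else 0) := by
  refine exists_matrices_of_idempotents (fun j => monIdem_mul_self _ _) ?_ (sum_class_eq m k)
  rintro (_ | p)
  · exact plethIdem_mul_self m k
  · exact monIdem_mul_self _ _

end Idempotents

/-! ### Matrices over the group algebra as maps between sums of summands. -/

section RetractMatrices

variable {R S : Type u} [CommRing R] [CommRing S] [Algebra ℚ R] [Algebra ℚ S] {σ : R →+* S}
  {M N : Type u} [AddCommGroup M] [Module R M] [AddCommGroup N] [Module S N] {ι J K : Type}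
  [Fintype J] [Fintype K] {T : J → Type u} [∀ j, AddCommGroup (T j)] [∀ j, Module R (T j)]
  {W : K → Type u} [∀ k, AddCommGroup (W k)] [∀ k, Module R (W k)]
  {T' : J → Type u} [∀ j, AddCommGroup (T' j)] [∀ j, Module S (T' j)]
  {W' : K → Type u} [∀ k, AddCommGroup (W' k)] [∀ k, Module S (W' k)]
  {e : J → MonoidAlgebra ℚ (Equiv.Perm ι)} {f : K → MonoidAlgebra ℚ (Equiv.Perm ι)}

/-- The map between direct sums of summands of a tensor power given by a matrix over the group
algebra. -/
noncomputable def matrixMap (ρ : ∀ j, Retract R M (T j) ι (e j))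
    (μ : ∀ k, Retract R M (W k) ι (f k)) (b : K → J → MonoidAlgebra ℚ (Equiv.Perm ι)) :
    (∀ j, T j) →ₗ[R] ∀ k, W k :=
  LinearMap.pi fun k => ∑ j, (μ k).p ∘ₗ act R ι M (b k j) ∘ₗ (ρ j).i ∘ₗ LinearMap.proj j

theorem matrixMap_apply (ρ : ∀ j, Retract R M (T j) ι (e j))
    (μ : ∀ k, Retract R M (W k) ι (f k)) (b : K → J → MonoidAlgebra ℚ (Equiv.Perm ι))
    (x : ∀ j, T j) (k : K) : matrixMap ρ μ b x k =
      ∑ j, (μ k).p (act R ι M (b k j) ((ρ j).i (x j))) := by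
  simp [matrixMap]

/-- In the composite, the middle `i ∘ p` acts as `f k` and is absorbed by `a j k`. What remains is
the matrix product of `a` and `b`, whose diagonal entries `e j` act as the identity on the summands.
-/
theorem matrixMap_matrixMap [DecidableEq J] (ρ : ∀ j, Retract R M (T j) ι (e j))
    (μ : ∀ k, Retract R M (W k) ι (f k)) {a : J → K → MonoidAlgebra ℚ (Equiv.Perm ι)}
    {b : K → J → MonoidAlgebra ℚ (Equiv.Perm ι)} (ha : ∀ j k, a j k * f k = a j k)
    (hab : ∀ j j', ∑ k, a j k * b k j' = if j = j' then e j else 0) (x : ∀ j, T j) :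
    matrixMap μ ρ a (matrixMap ρ μ b x) = x := by
  funext j
  simp only [matrixMap_apply, map_sum, (μ _).i_p]
  have h1 : ∀ k j' (z : TPow R ι M), act R ι M (a j k) (act R ι M (f k) (act R ι M (b k j') z)) =
      act R ι M (a j k * b k j') z := fun k j' z => by
    rw [map_mul, Module.End.mul_apply, ← Module.End.mul_apply, ← map_mul, ha]
  simp only [h1]
  rw [Finset.sum_comm]
  have h2 : ∀ j', ∑ k, (ρ j).p (act R ι M (a j k * b k j') ((ρ j').i (x j'))) =
      if j = j' then x j else 0 := fun j' => by
    rw [← map_sum, ← LinearMap.sum_apply, ← map_sum, hab]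
    split_ifs with h
    · subst h
      rw [← (ρ j).i_p, (ρ j).p_i, (ρ j).p_i]
    · simp
  exact (Finset.sum_congr rfl fun j' _ => h2 j').trans (by simp)

/-- Inclusions, projections and group algebra elements are all natural, so one matrix defines
compatible maps over all affine opens. -/
theorem matrixMap_compat {ρ : ∀ j, Retract R M (T j) ι (e j)} {μ : ∀ k, Retract R M (W k) ι (f k)}
    {ρ' : ∀ j, Retract S N (T' j) ι (e j)} {μ' : ∀ k, Retract S N (W' k) ι (f k)}
    {g : M →ₛₗ[σ] N} {F : ∀ j, T j →ₛₗ[σ] T' j} {G : ∀ k, W k →ₛₗ[σ] W' k}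
    (hF : ∀ j, (ρ j).Compat (ρ' j) g (F j)) (hG : ∀ k, (μ k).Compat (μ' k) g (G k))
    (b : K → J → MonoidAlgebra ℚ (Equiv.Perm ι)) (x : ∀ j, T j) :
    matrixMap ρ' μ' b (semiPi F x) = semiPi G (matrixMap ρ μ b x) := by
  funext k
  have h1 : semiPi G (matrixMap ρ μ b x) k = G k (matrixMap ρ μ b x k) := rfl
  have h2 : ∀ j, semiPi F x j = F j (x j) := fun _ => rfl
  simp only [h1, h2, matrixMap_apply, map_sum, (hG k).p, tmap_act, hF _ _]

end RetractMatrices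

/-! ### Summands of tensor powers of bundles and the plethysm identity for classes. -/

section BundleRetracts

variable {X : Scheme.{u}}

/-- The bundle `⋀^{l₁} E ⊗ ⋀^{l₂} E ⊗ ⋯`. -/
noncomputable def listBundle (E : AlgVectorBundle X) : List ℕ → AlgVectorBundle X
  | [] => AlgVectorBundle.unit X
  | i :: l => (E.ext i).tensor (listBundle E l)

theorem cls_listBundle (E : AlgVectorBundle X) (l : List ℕ) :
    Kbar.cls (listBundle E l) = (l.map fun i => LambdaRing.lam i (Kbar.cls E)).prod := by
  induction l with
  | nil => rfl
  | cons i l ih =>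
    rw [listBundle, Kbar.cls_tensor, ih, List.map_cons, List.prod_cons, Kbar.lam_cls]

theorem cls_pi {J : Type} [Fintype J] (T : J → AlgVectorBundle X) :
    Kbar.cls (AlgVectorBundle.pi T) = ∑ j, Kbar.cls (T j) := by
  rw [Kbar.cls, BundleClass.mk_pi, map_sum]
  rfl

variable [∀ U : X.affineOpens, Algebra ℚ (Fun X U)]

/-- A vector bundle `T` is presented as a direct summand of a tensor power of the vector
bundle `E`. -/
structure BundleRetract (E T : AlgVectorBundle X) (ι : Type)
    (e : MonoidAlgebra ℚ (Equiv.Perm ι)) where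
  ret : ∀ U : X.affineOpens, Retract (Fun X U) (E.sec U) (T.sec U) ι e
  compat : ∀ {U V : X.affineOpens} (h : V ≤ U), (ret U).Compat (ret V) (E.res h) (T.res h)

namespace BundleRetract

variable {E T W : AlgVectorBundle X} {ι κ : Type} {e : MonoidAlgebra ℚ (Equiv.Perm ι)}
  {f : MonoidAlgebra ℚ (Equiv.Perm κ)}

/-- The trivial line bundle. -/
noncomputable def unit (E : AlgVectorBundle X) :
    BundleRetract E (AlgVectorBundle.unit X) (Fin 0) 1 where
  ret U := Retract.unit (Fun X U) (E.sec U)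
  compat h := Retract.unit_compat (E.res h)

/-- Exterior powers. -/
noncomputable def ext (E : AlgVectorBundle X) (k : ℕ) :
    BundleRetract E (E.ext k) (Fin k) (antisymmetrizer k) where
  ret U := Retract.ext (Fun X U) (E.sec U) k
  compat h := Retract.ext_compat k (E.res h)

/-- Tensor products of summands of tensor powers. -/
noncomputable def tensor (ρ : BundleRetract E T ι e) (μ : BundleRetract E W κ f) :
    BundleRetract E (T.tensor W) (ι ⊕ κ) (boxProd e f) where
  ret U := (ρ.ret U).tensor (μ.ret U)
  compat h := (ρ.compat h).tensor (μ.compat h)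

/-- Relabelling the factors of a tensor power. -/
noncomputable def congr (ε : ι ≃ κ) (ρ : BundleRetract E T ι e) :
    BundleRetract E T κ (permAlgCongr ε e) where
  ret U := (ρ.ret U).congr ε
  compat h := (ρ.compat h).congr ε

/-- Exterior powers of summands of tensor powers. -/
noncomputable def extOf (m : ℕ) (ρ : BundleRetract E T ι e) :
    BundleRetract E (T.ext m) (Fin m × ι)
      (blockAlg m ι (antisymmetrizer m) * allSlots m e) where
  ret U := (ρ.ret U).extOf m
  compat h := (ρ.compat h).extOf m

end BundleRetract

/-- Families of summands of a tensor power have isomorphic direct sums if their idempotents are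
equivalent. -/
theorem BundleRetract.iso_pi {E : AlgVectorBundle X} {ι J K : Type} [Fintype J] [Fintype K]
    [DecidableEq J] [DecidableEq K] {T : J → AlgVectorBundle X} {W : K → AlgVectorBundle X}
    {e : J → MonoidAlgebra ℚ (Equiv.Perm ι)} {f : K → MonoidAlgebra ℚ (Equiv.Perm ι)}
    (ρ : ∀ j, BundleRetract E (T j) ι (e j)) (μ : ∀ k, BundleRetract E (W k) ι (f k))
    {a : J → K → MonoidAlgebra ℚ (Equiv.Perm ι)} {b : K → J → MonoidAlgebra ℚ (Equiv.Perm ι)}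
    (ha : ∀ j k, a j k * f k = a j k) (hb : ∀ k j, b k j * e j = b k j)
    (hab : ∀ j j', ∑ k, a j k * b k j' = if j = j' then e j else 0)
    (hba : ∀ k k', ∑ j, b k j * a j k' = if k = k' then f k else 0) :
    (AlgVectorBundle.pi T).Iso (AlgVectorBundle.pi W) := by
  refine ⟨fun U =>
    { matrixMap (fun j => (ρ j).ret U) (fun k => (μ k).ret U) b with
      invFun := matrixMap (fun k => (μ k).ret U) (fun j => (ρ j).ret U) a
      left_inv := matrixMap_matrixMap _ _ ha hab
      right_inv := matrixMap_matrixMap _ _ hb hba }, fun {U V} h x => ?_⟩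
  exact matrixMap_compat (fun j => (ρ j).compat h) (fun k => (μ k).compat h) b x

/-- The bundle `⋀^{l₁} E ⊗ ⋀^{l₂} E ⊗ ⋯` as a summand of a tensor power of `E`. -/
noncomputable def listRetract (E : AlgVectorBundle X) :
    (l : List ℕ) → BundleRetract E (listBundle E l) (Fin l.sum) (listIdem l)
  | [] => BundleRetract.unit E
  | i :: l => ((BundleRetract.ext E i).tensor (listRetract E l)).congr finSumFinEquiv

/-- The matrices of `exists_lamPoly_matrices` give an isomorphism from the sum of the positive
monomials in the `⋀^i E` to `⋀^m ⋀^k E` plus the sum of the negative ones. Passing to classes, the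
negative monomials cancel. -/
theorem lam_lam_cls (E : AlgVectorBundle X) (m k : ℕ) :
    LambdaRing.lam m (LambdaRing.lam k (Kbar.cls E)) =
      MvPolynomial.aeval (fun i : Fin (m * k) => LambdaRing.lam (i + 1) (Kbar.cls E))
        (lamPoly m k) := by
  classical
  obtain ⟨a, b, ha, hb, hab, hba⟩ := exists_lamPoly_matrices m k
  let W : Option (NegIndex m k) → AlgVectorBundle X := fun p =>
    p.elim ((E.ext k).ext m) fun p => listBundle E (monomialList p.1.1)
  let ρ : ∀ p : PosIndex m k, BundleRetract E (listBundle E (monomialList p.1.1)) (Fin (m * k))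
    (posIdem p) := fun p => (listRetract E _).congr (finCongr (sum_monomialList_of_mem p.1))
  let μ : ∀ p, BundleRetract E (W p) (Fin (m * k)) (negIdem p)
    | none => ((BundleRetract.ext E k).extOf m).congr finProdFinEquiv
    | some p => (listRetract E _).congr (finCongr (sum_monomialList_of_mem p.1))
  have h := congrArg GrothendieckRing.of
    (BundleClass.mk_eq (BundleRetract.iso_pi ρ μ ha hb hab hba))
  change Kbar.cls _ = Kbar.cls _ at h
  rw [cls_pi, cls_pi, Fintype.sum_option] at h
  simp only [W, Option.elim_none, Option.elim_some, cls_listBundle] at h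
  rw [sum_posIndex_eq] at h
  rw [Kbar.lam_cls, Kbar.lam_cls]
  exact (add_right_cancel h).symm

/-- Classes of bundles are closed under addition and every element is a difference of two of them,
so only the plethysm identity for bundles remains. -/
theorem isSpecial_Kbar : IsSpecial (Kbar X) := by
  refine isSpecial_of_generators (GrothendieckRing.of : BundleClass X →+ Kbar X)
    (fun x => GrothendieckRing.induction
      (p := fun x => ∃ a b, x = GrothendieckRing.of a - GrothendieckRing.of b) x fun a b => ⟨a, b, rfl⟩) fun k E => ?_
  obtain ⟨E⟩ := E
  refine OnePlus.ext_coeff fun m => ?_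
  rw [coeff_lambdaT, OnePlus.coeff_lam]
  simp only [coeff_lambdaT]
  exact lam_lam_cls E m k

end BundleRetracts

end SplitK

/-! ### The theorem for complex varieties. -/

theorem mainTheorem2 (X : AlgebraicGeometry.Scheme.{0})
    (f : X ⟶ AlgebraicGeometry.Spec (CommRingCat.of ℂ)) [AlgebraicGeometry.IsReduced X]
    [AlgebraicGeometry.IsSeparated f] [AlgebraicGeometry.LocallyOfFiniteType f]
    [AlgebraicGeometry.QuasiCompact f] :
    SplitK.IsSpecial (SplitK.Kbar X) ∧
      ∀ n : ℕ, 1 ≤ n → ∃ φ : SplitK.Kbar X →+* SplitK.Kbar X,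
        (∀ x, φ x = SplitK.adams n x) ∧ SplitK.IsLambdaHom φ := by
  -- The structure morphism to `Spec ℂ` makes all rings of functions algebras over `ℂ`, hence over
  -- `ℚ`; this supplies the denominators in the idempotents.
  let _ : ∀ U : X.affineOpens, Algebra ℚ (SplitK.Fun X U) := fun U =>
    ((X.presheaf.map (homOfLE le_top : U.1 ⟶ ⊤).op).hom.comp
      ((f.appTop.hom.comp (Scheme.ΓSpecIso (CommRingCat.of ℂ)).inv.hom).comp
        (algebraMap ℚ ℂ))).toAlgebra
  have h : SplitK.IsSpecial (SplitK.Kbar X) := SplitK.isSpecial_Kbar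
  exact ⟨h, fun n hn => h.adams_isLambdaHom (by omega)⟩
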